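/- Let $M$ be a connected oriented smooth $4$-manifold with a smooth pseudo-Riemannian metric $g$ of signature $(2,2)$, and let $\nabla$, $\rho$ and $W$ be its Levi-Civita connection, Ricci tensor ($\rho(X,Y)=\operatorname{Tr}\{Z\mapsto\mathcal R(X,Z)Y\}$ with $\mathcal R(X,Y)=\nabla_{[X,Y]}-[\nabla_X,\nabla_Y]$) and Weyl tensor. Suppose that $(M,g)$ is self-dual, that is, the anti-self-dual part $W^-$ of $W$ vanishes, and that $g$ is not Ricci flat ($\rho\not\equiv0$). Let $\mu\in\mathbb R$ with $\mu\ne-\frac12$, and let $f,\lambda\in C^\infty(M)$ satisfy the generalized quasi-Einstein equation $$\operatorname{Hes}_f+\rho-\mu\,df\otimes df=\lambda g,\qquad \operatorname{Hes}_f(X,Y)=XY(f)-(\nabla_XY)(f).$$ Suppose that $g(\nabla f,\nabla f)=0$ and $\nabla f\neq0$ at every point of $M$. For an affine surface $(\Sigma,D)$ (a smooth surface with a torsion free connection $D$ with Christoffel symbols $\Gamma_{ij}{}^k$), let $\pi:T^*\Sigma\to\Sigma$ be the projection, let $\rho^D_s$ be the symmetric part of the Ricci tensor of $D$, and let $(x^1,x^2,x_{1'},x_{2'})$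 be the local coordinates on $T^*\Sigma$ in which a covector is $x_{1'}dx^1+x_{2'}dx^2$. For a symmetric $(0,2)$-tensor field $\Phi$ and endomorphism fields $T=(T_i^j)$, $S=(S_i^j)$ of $T\Sigma$ put $$g_{D,\Phi}=2\,dx^i\circ dx_{i'}+\{-2x_{k'}\Gamma_{ij}{}^k+\Phi_{ij}\}\,dx^i\circ dx^j,$$ $$g_{D,\Phi,T,S}=2\,dx^i\circ dx_{i'}+\{\tfrac12x_{r'}x_{s'}(T^r_iS^s_j+T^r_jS^s_i)-2x_{k'}\Gamma_{ij}{}^k+\Phi_{ij}\}\,dx^i\circ dx^j,$$ where $\circ$ is the symmetric product, so that $2\,dx^i\circ dx_{i'}=dx^i\otimes dx_{i'}+dx_{i'}\otimes dx^i$. 1. If $\lambda$ is constant, then $\lambda=0$, and for every $p\in M$ there are an affine surface $(\Sigma,D)$, a smooth symmetric $(0,2)$-tensor field $\Phi$ on $\Sigma$, a function $\hat f\in C^\infty(\Sigma)$ with $$\operatorname{Hes}^D_{\hat f}+2\rho^D_s-\mu\,d\hat f\otimes d\hat f=0,$$ and an isometry from a neighbourhood of $p$ in $(M,g)$ onto an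 open subset of $(T^*\Sigma,g_{D,\Phi})$ that takes $f$ to $\pi^*\hat f$. 2. If $\lambda$ is not constant, then for every $p\in M$ there are an affine surface $(\Sigma,D)$, a function $\hat f\in C^\infty(\Sigma)$, a real number $C\neq0$ and an isometry from a neighbourhood of $p$ in $(M,g)$ onto an open subset of $(T^*\Sigma,g_{D,\Phi,T,\operatorname{Id}})$ that takes $f$ to $\pi^*\hat f$, where $$\Phi=\tfrac2Ce^{\hat f}\bigl(\operatorname{Hes}^D_{\hat f}+2\rho^D_s-\mu\,d\hat f\otimes d\hat f\bigr),\qquad T=Ce^{-\hat f}\operatorname{Id};$$ moreover $\lambda=\frac32Ce^{-f}$ near $p$. -/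

import Mathlib

open scoped Manifold ContDiff Topology

noncomputable section

/-- The coordinate space `ℝⁿ`. -/
abbrev Coord (n : ℕ) : Type := EuclideanSpace ℝ (Fin n)

/-! ### Affine and pseudo-Riemannian geometry in local coordinates

A connection on an open subset of `ℝⁿ` is given by its Christoffel symbols, where `Γ i j k` is the
function `Γ_ij^k`, that is `D_{∂_i} ∂_j = ∑ k, Γ i j k • ∂_k`.  A metric on an open subset of `ℝⁿ`
is given by the matrix of its components. -/

/-- The partial derivative `∂F/∂xⁱ` at `x`. -/
def partialDeriv {n : ℕ} (i : Fin n) (F : Coord n → ℝ) (x : Coord n) : ℝ :=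
  fderiv ℝ F x (EuclideanSpace.single i 1)

/-- Christoffel symbols of a connection on an open subset of `ℝⁿ`. -/
abbrev ConnectionCoeffs (n : ℕ) : Type := Fin n → Fin n → Fin n → Coord n → ℝ

/-- The curvature operator, with the sign convention
`𝓡(X,Y)Z = ∇_[X,Y] Z - [∇_X, ∇_Y] Z`; the number `curvature Γ i j k l x` is the component of
`𝓡(∂_i,∂_j)∂_k` along `∂_l`. -/
def curvature {n : ℕ} (Γ : ConnectionCoeffs n) (i j k l : Fin n) (x : Coord n) : ℝ :=
  -(partialDeriv i (Γ j k l) x - partialDeriv j (Γ i k l) x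
    + ∑ m, (Γ i m l x * Γ j k m x - Γ j m l x * Γ i k m x))

/-- The Ricci tensor `ρ(X,Y) = Tr {Z ↦ 𝓡(X,Z)Y}`. -/
def ricci {n : ℕ} (Γ : ConnectionCoeffs n) (i j : Fin n) (x : Coord n) : ℝ :=
  ∑ k, curvature Γ i k j k x

/-- The symmetric part `ρ_s` of the Ricci tensor. -/
def ricciSymm {n : ℕ} (Γ : ConnectionCoeffs n) (i j : Fin n) (x : Coord n) : ℝ :=
  (1 / 2 : ℝ) * (ricci Γ i j x + ricci Γ j i x)

/-- The Hessian `Hes_F(X,Y) = X Y(F) - (∇_X Y)(F)`. -/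
def hessian {n : ℕ} (Γ : ConnectionCoeffs n) (F : Coord n → ℝ) (i j : Fin n) (x : Coord n) : ℝ :=
  partialDeriv i (partialDeriv j F) x - ∑ k, Γ i j k x * partialDeriv k F x

/-- The Christoffel symbols of the Levi-Civita connection of the metric with components `G`. -/
def christoffel {n : ℕ} (G : Coord n → Matrix (Fin n) (Fin n) ℝ) : ConnectionCoeffs n :=
  fun i j k x => (1 / 2 : ℝ) * ∑ l, (G x)⁻¹ k l *
    (partialDeriv i (fun y => G y j l) x + partialDeriv j (fun y => G y i l) x
      - partialDeriv l (fun y => G y i j) x)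

/-- The curvature tensor `R(X,Y,Z,T) = g(𝓡(X,Y)Z,T)`. -/
def curvatureTensor {n : ℕ} (G : Coord n → Matrix (Fin n) (Fin n) ℝ) (i j k l : Fin n)
    (x : Coord n) : ℝ :=
  ∑ m, curvature (christoffel G) i j k m x * G x m l

/-- The scalar curvature `τ`. -/
def scalarCurvature {n : ℕ} (G : Coord n → Matrix (Fin n) (Fin n) ℝ) (x : Coord n) : ℝ :=
  ∑ i, ∑ j, (G x)⁻¹ i j * ricci (christoffel G) i j x

/-- The Weyl conformal curvature tensor in dimension `4`. -/
def weyl (G : Coord 4 → Matrix (Fin 4) (Fin 4) ℝ) (i j k l : Fin 4) (x : Coord 4) : ℝ :=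
  curvatureTensor G i j k l x
    + scalarCurvature G x / 6 * (G x i k * G x j l - G x i l * G x j k)
    + (1 / 2 : ℝ) *
      (ricci (christoffel G) i l x * G x j k - ricci (christoffel G) i k x * G x j l
        + ricci (christoffel G) j k x * G x i l - ricci (christoffel G) j l x * G x i k)

/-- The components of the gradient `∇F`. -/
def gradientCoeff {n : ℕ} (G : Coord n → Matrix (Fin n) (Fin n) ℝ) (F : Coord n → ℝ) (i : Fin n)
    (x : Coord n) : ℝ :=
  ∑ j, (G x)⁻¹ i j * partialDeriv j F x

/-! ### Pseudo-Riemannian manifolds -/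

section Manifold

variable {n : ℕ} {M : Type*} [TopologicalSpace M] [ChartedSpace (Coord n) M]

/-- The components `t(∂_i, ∂_j)` in the chart `e` of a family of bilinear forms on the tangent
spaces, as a matrix valued function on `e.target`. -/
def chartMatrix (t : (p : M) → TangentSpace (𝓡 n) p →L[ℝ] TangentSpace (𝓡 n) p →L[ℝ] ℝ)
    (e : OpenPartialHomeomorph M (Coord n)) (x : Coord n) : Matrix (Fin n) (Fin n) ℝ :=
  Matrix.of fun i j =>
    t (e.symm x) (mfderiv (𝓡 n) (𝓡 n) e.symm x (EuclideanSpace.single i (1 : ℝ)))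
      (mfderiv (𝓡 n) (𝓡 n) e.symm x (EuclideanSpace.single j (1 : ℝ)))

variable (n M) in
/-- A smooth pseudo-Riemannian metric on an `n`-dimensional manifold.  Smoothness says that the
components in every chart of the smooth structure are smooth. -/
structure PseudoRiemannianMetric where
  /-- the scalar product on each tangent space -/
  inner : (p : M) → TangentSpace (𝓡 n) p →L[ℝ] TangentSpace (𝓡 n) p →L[ℝ] ℝ
  symm : ∀ (p : M) (u v : TangentSpace (𝓡 n) p), inner p u v = inner p v u
  nondegenerate : ∀ (p : M) (u : TangentSpace (𝓡 n) p), (∀ v, inner p u v = 0) → u = 0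
  smooth : ∀ e ∈ IsManifold.maximalAtlas (𝓡 n) ∞ M, ∀ i j : Fin n,
    ContDiffOn ℝ ∞ (fun x => chartMatrix inner e x i j) e.target

/-- The components of the metric in the chart `e`. -/
def PseudoRiemannianMetric.matrix (g : PseudoRiemannianMetric n M)
    (e : OpenPartialHomeomorph M (Coord n)) : Coord n → Matrix (Fin n) (Fin n) ℝ :=
  chartMatrix g.inner e

/-- The Levi-Civita Christoffel symbols of the metric in the chart `e`. -/
def PseudoRiemannianMetric.leviCivita (g : PseudoRiemannianMetric n M)
    (e : OpenPartialHomeomorph M (Coord n)) : ConnectionCoeffs n :=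
  christoffel (g.matrix e)

/-- The Ricci tensor vanishes identically. -/
def PseudoRiemannianMetric.IsRicciFlat (g : PseudoRiemannianMetric n M) : Prop :=
  ∀ e ∈ IsManifold.maximalAtlas (𝓡 n) ∞ M, ∀ x ∈ e.target, ∀ i j : Fin n,
    ricci (g.leviCivita e) i j x = 0

/-- `(M, g, f, μ)` is generalized quasi-Einstein with the function `lam`: the functions `f` and
`lam` are smooth and `Hes_f + ρ - μ df ⊗ df = lam g`. -/
structure IsGeneralizedQuasiEinstein (g : PseudoRiemannianMetric n M) (f : M → ℝ) (μ : ℝ)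
    (lam : M → ℝ) : Prop where
  smooth_potential : ContMDiff (𝓡 n) 𝓘(ℝ) ∞ f
  smooth_lam : ContMDiff (𝓡 n) 𝓘(ℝ) ∞ lam
  equation : ∀ e ∈ IsManifold.maximalAtlas (𝓡 n) ∞ M, ∀ x ∈ e.target, ∀ i j : Fin n,
    hessian (g.leviCivita e) (fun y => f (e.symm y)) i j x + ricci (g.leviCivita e) i j x
      - μ * (partialDeriv i (fun y => f (e.symm y)) x * partialDeriv j (fun y => f (e.symm y)) x)
    = lam (e.symm x) * g.matrix e x i j

/-- `g(∇f, ∇f) = 0` and `∇f ≠ 0` at every point. -/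
def IsIsotropic (g : PseudoRiemannianMetric n M) (f : M → ℝ) : Prop :=
  ∀ e ∈ IsManifold.maximalAtlas (𝓡 n) ∞ M, ∀ x ∈ e.target,
    (∑ i, ∑ j, g.matrix e x i j * gradientCoeff (g.matrix e) (fun y => f (e.symm y)) i x
      * gradientCoeff (g.matrix e) (fun y => f (e.symm y)) j x = 0) ∧
    ∃ i, gradientCoeff (g.matrix e) (fun y => f (e.symm y)) i x ≠ 0

/-- The local isometry relation, near `p`, between `(M, g, f)` and the open subset `V` of `ℝⁿ` with
the metric of components `G` and the function `F`: an open neighbourhood of `p` is diffeomorphic to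
an open subset of `V`, and the diffeomorphism takes `g` to `G` and `f` to `F`.  A diffeomorphism
from an open subset of `M` to an open subset of `ℝⁿ` is the same as a chart of the smooth
structure. -/
def IsLocallyIsometricAt (g : PseudoRiemannianMetric n M) (f : M → ℝ) (p : M)
    (V : Set (Coord n)) (G : Coord n → Matrix (Fin n) (Fin n) ℝ) (F : Coord n → ℝ) : Prop :=
  ∃ e ∈ IsManifold.maximalAtlas (𝓡 n) ∞ M, p ∈ e.source ∧ e.target ⊆ V ∧
    ∀ x ∈ e.target, g.matrix e x = G x ∧ f (e.symm x) = F x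

variable (n M) in
/-- An orientation of a smooth manifold, given by a family of charts of the smooth structure which
covers the manifold and whose coordinate changes have positive Jacobian determinant. -/
structure OrientedAtlas where
  /-- the positively oriented charts of the family -/
  charts : Set (OpenPartialHomeomorph M (Coord n))
  subset_maximalAtlas : charts ⊆ IsManifold.maximalAtlas (𝓡 n) ∞ M
  covers : ∀ p : M, ∃ e ∈ charts, p ∈ e.source
  jacobian_pos : ∀ e ∈ charts, ∀ e' ∈ charts, ∀ x ∈ (e.symm.trans e').source,
    0 < (fderiv ℝ (e.symm.trans e') x).det

end Manifold

section DimensionFour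

variable {M : Type*} [TopologicalSpace M] [ChartedSpace (Coord 4) M]

/-- The metric has signature `(2,2)`. -/
def PseudoRiemannianMetric.HasNeutralSignature (g : PseudoRiemannianMetric 4 M) : Prop :=
  ∀ p : M, ∃ b : Module.Basis (Fin 4) ℝ (TangentSpace (𝓡 4) p), ∀ i j : Fin 4,
    g.inner p (b i) (b j) = if i = j then (![-1, -1, 1, 1] : Fin 4 → ℝ) i else 0

/-- `W(E_a, E_b, ∂_k, ∂_l)` for a frame `E`, where `E a` is the list of components of `E_a`. -/
def weylFrame (G : Coord 4 → Matrix (Fin 4) (Fin 4) ℝ) (E : Matrix (Fin 4) (Fin 4) ℝ)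
    (a b k l : Fin 4) (x : Coord 4) : ℝ :=
  ∑ i, ∑ j, E a i * E b j * weyl G i j k l x

/-- The oriented manifold `(M, g)` is self-dual: `W⁻ = 0`, that is, `W` vanishes on the space `Λ⁻`
of anti-self-dual bivectors.  If `E` is a positively oriented orthonormal frame with
`ε i = g(E i, E i)`, then `Λ⁻` is spanned by `E₀ ∧ E₁ - ε₂ε₃ E₂ ∧ E₃`, `E₀ ∧ E₂ + ε₁ε₃ E₁ ∧ E₃`
and `E₀ ∧ E₃ - ε₁ε₂ E₁ ∧ E₂`. -/
def IsSelfDual (g : PseudoRiemannianMetric 4 M) (o : OrientedAtlas 4 M) : Prop :=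
  ∀ e ∈ o.charts, ∀ x ∈ e.target, ∀ (E : Matrix (Fin 4) (Fin 4) ℝ) (ε : Fin 4 → ℝ),
    (∀ a, ε a = 1 ∨ ε a = -1) →
    (∀ a b, ∑ i, ∑ j, E a i * E b j * g.matrix e x i j = if a = b then ε a else 0) →
    0 < E.det →
    ∀ k l : Fin 4,
      weylFrame (g.matrix e) E 0 1 k l x - ε 2 * ε 3 * weylFrame (g.matrix e) E 2 3 k l x = 0 ∧
      weylFrame (g.matrix e) E 0 2 k l x + ε 1 * ε 3 * weylFrame (g.matrix e) E 1 3 k l x = 0 ∧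
      weylFrame (g.matrix e) E 0 3 k l x - ε 1 * ε 2 * weylFrame (g.matrix e) E 1 2 k l x = 0

end DimensionFour

/-! ### Affine surfaces and Riemannian extensions -/

/-- An affine surface `(Σ, D)` with a global coordinate system: an open subset `Σ` of `ℝ²` with a
smooth torsion free connection `D`. -/
structure AffineSurface where
  /-- the surface -/
  carrier : Set (Coord 2)
  isOpen_carrier : IsOpen carrier
  /-- the Christoffel symbols of `D` -/
  Γ : ConnectionCoeffs 2
  smooth : ∀ i j k, ContDiffOn ℝ ∞ (Γ i j k) carrier
  torsion_free : ∀ i j k, ∀ x ∈ carrier, Γ i j k x = Γ j i k x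

/-- `Φ` is a smooth symmetric `(0,2)`-tensor field on the surface. -/
def AffineSurface.IsSymmTensor (S : AffineSurface) (Φ : Fin 2 → Fin 2 → Coord 2 → ℝ) : Prop :=
  (∀ i j, ContDiffOn ℝ ∞ (Φ i j) S.carrier) ∧ ∀ i j, ∀ x ∈ S.carrier, Φ i j x = Φ j i x

/-- The tensor `Hes^D_h + 2 ρ^D_s - μ dh ⊗ dh` of the surface. -/
def AffineSurface.quasiEinsteinTensor (S : AffineSurface) (μ : ℝ) (h : Coord 2 → ℝ)
    (i j : Fin 2) (y : Coord 2) : ℝ :=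
  hessian S.Γ h i j y + 2 * ricciSymm S.Γ i j y - μ * (partialDeriv i h y * partialDeriv j h y)

/-- The projection `π : T*Σ → Σ` in the coordinates `(x¹, x², x₁', x₂')` of `T*Σ`, where the point
with these coordinates is the covector `x₁' dx¹ + x₂' dx²` at `(x¹, x²)`. -/
def cotangentProj (x : Coord 4) : Coord 2 :=
  WithLp.toLp 2 fun i : Fin 2 => x (Fin.castAdd 2 i)

/-- The fibre coordinate `x_{k'}` on `T*Σ`. -/
def fibreCoord (k : Fin 2) (x : Coord 4) : ℝ := x (Fin.natAdd 2 k)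

/-- The cotangent bundle `T*Σ = Σ × ℝ²`, an open subset of `ℝ⁴`. -/
def AffineSurface.cotangentBundle (S : AffineSurface) : Set (Coord 4) :=
  {x | cotangentProj x ∈ S.carrier}

/-- The matrix of the metric `2 dxⁱ ∘ dx_{i'} + a_ij dxⁱ ∘ dxʲ` in the coordinates
`(x¹, x², x₁', x₂')`; the blocks are `a`, the identity, the identity and zero. -/
def walkerMatrix (a : Matrix (Fin 2) (Fin 2) ℝ) : Matrix (Fin 4) (Fin 4) ℝ :=
  (Matrix.fromBlocks a 1 1 0).submatrix (finSumFinEquiv (m := 2) (n := 2)).symm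
    (finSumFinEquiv (m := 2) (n := 2)).symm

/-- The deformed Riemannian extension `g_{D,Φ}` on `T*Σ`. -/
def deformedRiemannianExtension (S : AffineSurface) (Φ : Fin 2 → Fin 2 → Coord 2 → ℝ)
    (x : Coord 4) : Matrix (Fin 4) (Fin 4) ℝ :=
  walkerMatrix <| Matrix.of fun i j =>
    -2 * (∑ k, fibreCoord k x * S.Γ i j k (cotangentProj x)) + Φ i j (cotangentProj x)

/-- The modified Riemannian extension `g_{D,Φ,T,U}` on `T*Σ`, for endomorphism fields `T` and `U` of
the tangent bundle of `Σ`; the matrix entry `T y r i` is the component `T^r_i` at `y`. -/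
def modifiedRiemannianExtension (S : AffineSurface) (Φ : Fin 2 → Fin 2 → Coord 2 → ℝ)
    (T U : Coord 2 → Matrix (Fin 2) (Fin 2) ℝ) (x : Coord 4) : Matrix (Fin 4) (Fin 4) ℝ :=
  walkerMatrix <| Matrix.of fun i j =>
    (1 / 2 : ℝ) * (∑ r, ∑ s, fibreCoord r x * fibreCoord s x *
      (T (cotangentProj x) r i * U (cotangentProj x) s j
        + T (cotangentProj x) r j * U (cotangentProj x) s i))
    - 2 * (∑ k, fibreCoord k x * S.Γ i j k (cotangentProj x)) + Φ i j (cotangentProj x)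

end

/-! Near a point choose a null frame `n₁, n₂, m₁, m₂` with `n₁ = ∇f`, where `n₁, n₂` span a totally
null plane dual to the one spanned by `m₁, m₂`, oriented so that `n₁ ∧ m₂`, `n₂ ∧ m₁` and `n₁ ∧ m₁ -
n₂ ∧ m₂` span `Λ⁻`. The quasi-Einstein equation expresses the Ricci tensor by the Hessian `H` of
`f`. Since `∇f` is null, the Schouten tensor is `P = ½ (ψ g + μ df ⊗ df - H)` with `ψ = λ - τ/6`.
Self-duality says that on `Λ⁻` the curvature equals the Kulkarni-Nomizu product of `P` and `g`.

The crucial step compares two evaluations of the Cotton tensor of `P` on `Λ⁻`. As `Λ⁻` is preserved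
by covariant differentiation, the second Bianchi identity makes the Cotton tensor vanish there
(`covDeriv_vanishes`, `cotton_eq_zero`). The Ricci identity for `df` expresses it through `dψ`, `μ`,
`H` and the curvature applied to `∇f`, whose Weyl part is again zero. The resulting linear system
gives `dψ = -ψ df` and `(μ + ½) H(n₂, ·) = 0` (`fderiv_ψ_and_hessForm`). Since `μ ≠ -½`, and `H(n₁,
·) = 0` because the gradient is null, both `n₁` and `n₂` lie in the kernel of `H`. Hence `span(n₁,
n₂)` is a parallel null plane field, `3ψ = λ`, and `dλ = -λ df`. On a connected manifold `λ = σ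
e^{-f}`; a constant `λ` must vanish because `df ≠ 0`.

A parallel null plane field is integrable. The gradients of functions constant on its leaves lie in
the plane and commute, and their joint flow gives Walker coordinates with `g = 2 dxⁱ ∘ dx_{i'} +
a_ij dxⁱ ∘ dxʲ` (`exists_walker_coordinates`). The flow with smooth dependence on all parameters
comes from the inverse function theorem in the Banach space of continuous curves, applied to the
integral form of the equation (`exists_flow_of_pairing`).

Parallelism gives `R(n₁, n₂, n₁, n₂) = 0`. Together with self-duality it determines the curvature on
pairs (plane vector, orthogonal vector) by `ψ` alone (`inner_riem_plane`). In Walker coordinates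
these components are second fibre derivatives of `a_ij`, and with the mixed Ricci components they
force `∂_{k'} ∂_{l'} a_ij = ⅔ λ (δ_ki δ_lj + δ_kj δ_li)` (`fibre_hessian`). As `f` and `λ` are
constant on the fibres, `a_ij` is the quadratic polynomial `⅔ λ x_{i'} x_{j'} - 2 x_{k'} Γ_ij^k +
Φ_ij`. Its linear part is a torsion free connection `D` on the base and its constant part is `Φ`.
The base components of the quasi-Einstein equation on the zero section become `Hes^D + 2 ρ^D_s - μ
df̂ ⊗ df̂ = ⅓ λ Φ` (`exists_extension`). For `λ = 0` this is the first alternative; for `λ = σ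
e^{-f}` with `σ ≠ 0` it is solved for `Φ`, with `C = ⅔ σ`. -/

noncomputable section

/-! ### Smooth inverse functions and flows -/

section InverseFunction

variable {E F : Type*} [NormedAddCommGroup E] [NormedSpace ℝ E] [CompleteSpace E]
  [NormedAddCommGroup F] [NormedSpace ℝ F]

/-- The inverse function theorem for smooth maps, with smoothness of the inverse on all of its
domain. -/
theorem exists_openPartialHomeomorph_of_contDiffOn {U : Set E} (hU : IsOpen U) {f : E → F}
    (hf : ContDiffOn ℝ ∞ f U) {a : E} (ha : a ∈ U) (f' : E ≃L[ℝ] F)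
    (hf' : HasFDerivAt f (f' : E →L[ℝ] F) a) :
    ∃ e : OpenPartialHomeomorph E F, a ∈ e.source ∧ e.source ⊆ U ∧ (∀ x, e x = f x) ∧
      ContDiffOn ℝ ∞ e.symm e.target ∧
      ∀ x ∈ e.source, ∃ L : E ≃L[ℝ] F, HasFDerivAt f (L : E →L[ℝ] F) x := by
  have hfa : ContDiffAt ℝ ∞ f a := hf.contDiffAt (hU.mem_nhds ha)
  set e₀ := hfa.toOpenPartialHomeomorph f hf' (by simp) with he₀
  -- Restricting to the open set where the derivative is invertible makes the inverse smooth on its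
  -- whole domain, not only at the image of `a`.
  set R : Set (E →L[ℝ] F) := Set.range ((↑) : (E ≃L[ℝ] F) → E →L[ℝ] F)
  have hR : IsOpen R := ContinuousLinearEquiv.isOpen
  have hV : IsOpen (U ∩ fderiv ℝ f ⁻¹' R) :=
    (hf.continuousOn_fderiv_of_isOpen hU (by simp)).isOpen_inter_preimage hU hR
  have haV : a ∈ U ∩ fderiv ℝ f ⁻¹' R := ⟨ha, f', hf'.fderiv.symm⟩
  have hcoe : ∀ x, e₀ x = f x := fun x => by
    rw [he₀, ContDiffAt.toOpenPartialHomeomorph_coe]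
  have hinv : ∀ x ∈ U ∩ fderiv ℝ f ⁻¹' R, ∃ L : E ≃L[ℝ] F, HasFDerivAt f (L : E →L[ℝ] F) x := by
    rintro x ⟨hxU, L, hL⟩
    exact ⟨L, hL ▸ ((hf.contDiffAt (hU.mem_nhds hxU)).differentiableAt (by simp)).hasFDerivAt⟩
  refine ⟨e₀.restrOpen _ hV, ⟨hfa.mem_toOpenPartialHomeomorph_source hf' (by simp), haV⟩,
    fun x hx => hx.2.1, hcoe, ?_, fun x hx => hinv x hx.2⟩
  intro y hy
  have hy' := (e₀.restrOpen _ hV).map_target hy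
  obtain ⟨L, hL⟩ := hinv _ hy'.2
  have hL' : HasFDerivAt (e₀.restrOpen _ hV) (L : E →L[ℝ] F) ((e₀.restrOpen _ hV).symm y) := by
    refine hL.congr_of_eventuallyEq (Filter.Eventually.of_forall hcoe)
  refine ((e₀.restrOpen _ hV).contDiffAt_symm hy hL' ?_).contDiffWithinAt
  exact (hf.contDiffAt (hU.mem_nhds hy'.2.1)).congr_of_eventuallyEq
    (Filter.Eventually.of_forall hcoe)

end InverseFunction

/-! ### Superposition operators on spaces of continuous maps -/

section Nemytskii

variable {K : Type*} [TopologicalSpace K] [CompactSpace K]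
  {E F : Type*} [NormedAddCommGroup E] [NormedSpace ℝ E] [NormedAddCommGroup F] [NormedSpace ℝ F]

variable (K E F) in
/-- The pointwise application of a continuous family of linear maps to a continuous map. -/
def pointwiseApply : C(K, E →L[ℝ] F) →L[ℝ] C(K, E) →L[ℝ] C(K, F) :=
  LinearMap.mkContinuous₂
    (LinearMap.mk₂ ℝ (fun (L : C(K, E →L[ℝ] F)) (h : C(K, E)) =>
        (⟨fun t => L t (h t), by fun_prop⟩ : C(K, F)))
      (fun _ _ _ => by ext; simp) (fun _ _ _ => by ext; simp)
      (fun _ _ _ => by ext; simp) (fun _ _ _ => by ext; simp)) 1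
    (fun L h => by
      rw [ContinuousMap.norm_le _ (by positivity), one_mul]
      intro t
      exact ((L t).le_opNorm _).trans
        (mul_le_mul (L.norm_coe_le_norm t) (h.norm_coe_le_norm t) (norm_nonneg _) (norm_nonneg L)))

theorem norm_pointwiseApply_le (L : C(K, E →L[ℝ] F)) (h : C(K, E)) :
    ‖pointwiseApply K E F L h‖ ≤ ‖L‖ * ‖h‖ := by
  rw [ContinuousMap.norm_le _ (by positivity)]
  intro t
  exact ((L t).le_opNorm _).trans
    (mul_le_mul (L.norm_coe_le_norm t) (h.norm_coe_le_norm t) (norm_nonneg _) (norm_nonneg L))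

/-- Composition with a `C¹` map is differentiable on spaces of continuous maps. -/
theorem hasFDerivAt_postcomp {X : E → F} (hX : ContDiff ℝ 1 X) (γ : C(K, E)) :
    HasFDerivAt (fun γ : C(K, E) => (⟨X, hX.continuous⟩ : C(E, F)).comp γ)
      (pointwiseApply K E F
        ((⟨fderiv ℝ X, hX.continuous_fderiv (by simp)⟩ : C(E, E →L[ℝ] F)).comp γ)) γ := by
  set D : C(E, E →L[ℝ] F) := ⟨fderiv ℝ X, hX.continuous_fderiv (by simp)⟩
  rw [hasFDerivAt_iff_isLittleO_nhds_zero, Asymptotics.isLittleO_iff]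
  intro ε hε
  have hcont : ContinuousAt (fun η : C(K, E) => D.comp η) γ :=
    (ContinuousMap.continuous_postcomp D).continuousAt
  obtain ⟨δ, hδ, hball⟩ := (Metric.continuousAt_iff (α := C(K, E)) (β := C(K, E →L[ℝ] F))).1 hcont ε hε
  filter_upwards [Metric.ball_mem_nhds (0 : C(K, E)) hδ] with h hh
  have hh : ‖h‖ < δ := by simpa using hh
  rw [ContinuousMap.norm_le _ (by positivity)]
  intro t
  have hb : ∀ y ∈ Metric.ball (γ t) δ, ‖fderiv ℝ X y - fderiv ℝ X (γ t)‖ ≤ ε := by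
    intro y hy
    -- Translating the whole curve by a constant turns continuity of `D.comp` in the sup norm into
    -- an estimate at the single point `y`, with `δ` independent of `t`.
    have h1 : dist (γ + ContinuousMap.const K (y - γ t)) γ < δ := by
      rw [dist_eq_norm, add_sub_cancel_left, ContinuousMap.norm_lt_iff _ hδ]
      intro s
      simpa [dist_eq_norm] using hy
    have h2 := ((ContinuousMap.dist_apply_le_dist t).trans_lt (hball h1)).le
    simpa [D, dist_eq_norm] using h2
  have hmv := (convex_ball (γ t) δ).norm_image_sub_le_of_norm_fderiv_le'
    (f := X) (φ := fderiv ℝ X (γ t)) (C := ε) (x := γ t) (y := γ t + h t)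
    (fun y _ => (hX.differentiable (by simp)) y) hb (Metric.mem_ball_self hδ)
    (by simpa using (h.norm_coe_le_norm t).trans_lt hh)
  have : ‖X (γ t + h t) - X (γ t) - fderiv ℝ X (γ t) (h t)‖ ≤ ε * ‖h t‖ := by
    simpa using hmv
  exact this.trans (mul_le_mul_of_nonneg_left (h.norm_coe_le_norm t) hε.le)

end Nemytskii

universe u

/-- Composition with a smooth map is smooth on spaces of continuous maps. -/
theorem contDiff_postcomp {K : Type*} [TopologicalSpace K] [CompactSpace K]
    {E : Type u} [NormedAddCommGroup E] [NormedSpace ℝ E] (n : ℕ) :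
    ∀ {F : Type u} [NormedAddCommGroup F] [NormedSpace ℝ F] {X : E → F} (hX : ContDiff ℝ ∞ X),
      ContDiff ℝ n (fun γ : C(K, E) => (⟨X, hX.continuous⟩ : C(E, F)).comp γ) := by
  induction n with
  | zero =>
    intro F _ _ X hX
    exact contDiff_zero.2 (ContinuousMap.continuous_postcomp _)
  | succ n ih =>
    intro F _ _ X hX
    have h1 : ContDiff ℝ 1 X := hX.of_le (by exact_mod_cast le_top)
    push_cast
    rw [contDiff_succ_iff_hasFDerivAt]
    refine ⟨_, ?_, hasFDerivAt_postcomp h1⟩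
    -- The derivative is governed by composition with `fderiv ℝ X`, so the induction hypothesis is
    -- used with target `E →L[ℝ] F`. This is why the target is quantified inside the induction and
    -- shares a universe with `E`.
    exact (pointwiseApply K E F).contDiff.comp
      (ih (hX.fderiv_right (m := ∞) (by simp)))

/-! ### Primitives as a bounded operator on curves -/

section Flow

open unitInterval

variable {E : Type*} [NormedAddCommGroup E]

/-- The value at `s` of a continuous curve on the unit interval, extended to the real line. -/
abbrev curveExtend (h : C(I, E)) (s : ℝ) : E := h (Set.projIcc 0 1 zero_le_one s)

theorem continuous_curveExtend (h : C(I, E)) : Continuous (curveExtend h) :=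
  h.continuous.comp continuous_projIcc

variable [NormedSpace ℝ E]

theorem norm_integral_curveExtend_le (h : C(I, E)) (t : I) :
    ‖∫ s in (0 : ℝ)..t, curveExtend h s‖ ≤ ‖h‖ := by
  have := intervalIntegral.norm_integral_le_of_norm_le_const (a := 0) (b := (t : ℝ)) (C := ‖h‖)
    (f := curveExtend h) (fun s _ => h.norm_coe_le_norm _)
  refine this.trans ?_
  rw [sub_zero, abs_of_nonneg t.2.1]
  exact mul_le_of_le_one_right (norm_nonneg _) t.2.2

variable (E) in
/-- The operator sending a curve to its primitive vanishing at `0`. -/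
def primitiveCLM : C(I, E) →L[ℝ] C(I, E) :=
  LinearMap.mkContinuous
    { toFun := fun h => ⟨fun t => ∫ s in (0 : ℝ)..t, curveExtend h s,
        (intervalIntegral.continuous_primitive
          (fun a b => (continuous_curveExtend h).intervalIntegrable a b) 0).comp
          continuous_subtype_val⟩
      map_add' := fun h k => by
        ext t
        exact intervalIntegral.integral_add ((continuous_curveExtend h).intervalIntegrable _ _)
          ((continuous_curveExtend k).intervalIntegrable _ _)
      map_smul' := fun c h => by
        ext t
        exact intervalIntegral.integral_smul c _ } 1
    (fun h => by
      rw [one_mul, ContinuousMap.norm_le _ (norm_nonneg _)]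
      exact norm_integral_curveExtend_le h)

theorem primitiveCLM_apply (h : C(I, E)) (t : I) :
    primitiveCLM E h t = ∫ s in (0 : ℝ)..t, curveExtend h s := rfl

theorem norm_primitiveCLM_le (h : C(I, E)) : ‖primitiveCLM E h‖ ≤ ‖h‖ := by
  rw [ContinuousMap.norm_le _ (norm_nonneg _)]
  exact norm_integral_curveExtend_le h

/-- The primitive of a curve, extended to the real line, is differentiable inside the interval. -/
theorem hasDerivAt_primitiveCLM [CompleteSpace E] (h : C(I, E)) {s : ℝ} (hs : s ∈ Set.Ioo (0 : ℝ) 1) :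
    HasDerivAt (curveExtend (primitiveCLM E h)) (curveExtend h s) s := by
  have h1 : HasDerivAt (fun t : ℝ => ∫ r in (0 : ℝ)..t, curveExtend h r) (curveExtend h s) s :=
    intervalIntegral.integral_hasDerivAt_right
      ((continuous_curveExtend h).intervalIntegrable _ _)
      ((continuous_curveExtend h).stronglyMeasurableAtFilter _ _)
      (continuous_curveExtend h).continuousAt
  refine h1.congr_of_eventuallyEq ?_
  filter_upwards [isOpen_Ioo.mem_nhds hs] with r hr
  simp only [curveExtend, primitiveCLM_apply]
  rw [Set.projIcc_of_mem _ ⟨hr.1.le, hr.2.le⟩]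

/-- A curve with the prescribed derivative which vanishes at `0` is the primitive. -/
theorem eq_primitiveCLM [CompleteSpace E] {w h : C(I, E)} (h0 : w 0 = 0)
    (hw : ∀ s ∈ Set.Ioo (0 : ℝ) 1, HasDerivAt (curveExtend w) (curveExtend h s) s) :
    w = primitiveCLM E h := by
  ext t
  rw [primitiveCLM_apply, intervalIntegral.integral_eq_sub_of_hasDerivAt_of_le t.2.1
    (continuous_curveExtend w).continuousOn
    (fun s hs => hw s ⟨hs.1, hs.2.trans_le t.2.2⟩)
    ((continuous_curveExtend h).intervalIntegrable _ _)]
  simp only [curveExtend, Set.projIcc_val, Set.projIcc_left]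
  rw [show (⟨0, _⟩ : I) = 0 from rfl, h0, sub_zero]

end Flow
end


/-! ### Joint flows of commuting vector fields, smooth in all parameters -/

noncomputable section

universe u

/-- A map which is smooth near a point agrees near the point with a globally smooth map. -/
theorem exists_contDiff_eqOn {E F : Type*} [NormedAddCommGroup E] [NormedSpace ℝ E]
    [FiniteDimensional ℝ E] [NormedAddCommGroup F] [NormedSpace ℝ F] {U : Set E} (hU : IsOpen U)
    {f : E → F} (hf : ContDiffOn ℝ ∞ f U) {p : E} (hp : p ∈ U) :
    ∃ (g : E → F) (V : Set E), ContDiff ℝ ∞ g ∧ IsOpen V ∧ p ∈ V ∧ V ⊆ U ∧ Set.EqOn g f V := by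
  obtain ⟨r, hr, hball⟩ := Metric.isOpen_iff.1 hU p hp
  let φ : ContDiffBump p := ⟨r / 4, r / 2, by positivity, by linarith⟩
  refine ⟨fun x => φ x • f x, Metric.ball p (r / 4), ?_, Metric.isOpen_ball,
    Metric.mem_ball_self (by positivity),
    (Metric.ball_subset_ball (by linarith)).trans hball, ?_⟩
  · rw [contDiff_iff_contDiffAt]
    intro x
    by_cases hx : x ∈ U
    · exact φ.contDiff.contDiffAt.smul (hf.contDiffAt (hU.mem_nhds hx))
    · have hx' : x ∉ tsupport φ := by
        rw [φ.tsupport_eq]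
        intro h
        exact hx (hball (Metric.closedBall_subset_ball (by change r / 2 < r; linarith) h))
      have h0 := notMem_tsupport_iff_eventuallyEq.1 hx'
      refine (contDiffAt_const (c := (0 : F))).congr_of_eventuallyEq ?_
      filter_upwards [h0] with y hy
      simp [hy]
  · intro x hx
    have : φ x = 1 := φ.one_of_mem_closedBall (Metric.ball_subset_closedBall hx)
    simp [this]

open unitInterval

variable {E F A : Type u} [NormedAddCommGroup F] [NormedSpace ℝ F] [NormedAddCommGroup E] [NormedSpace ℝ E] [FiniteDimensional ℝ E]
  [NormedAddCommGroup A] [NormedSpace ℝ A]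

variable (E) in
/-- Constant curves. -/
def constCurve : E →L[ℝ] C(I, E) :=
  LinearMap.mkContinuous
    { toFun := fun x => ContinuousMap.const I x
      map_add' := fun _ _ => rfl
      map_smul' := fun _ _ => rfl } 1
    (fun x => by
      rw [one_mul, ContinuousMap.norm_le _ (norm_nonneg _)]
      intro t
      exact le_rfl)

omit [FiniteDimensional ℝ E] in
@[simp] theorem constCurve_apply (x : E) (t : I) : constCurve E x t = x := rfl

/-- Application of a curve of linear maps to a fixed vector; the linear maps are given as the
elements of a normed space `F` with a pairing `ev`. -/
def curveApply (ev : F →L[ℝ] A →L[ℝ] E) (L : C(I, F)) (a : A) : C(I, E) :=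
  ⟨fun t => ev (L t) a, by fun_prop⟩

omit [FiniteDimensional ℝ E] in
@[simp] theorem curveApply_apply (ev : F →L[ℝ] A →L[ℝ] E) (L : C(I, F)) (a : A) (t : I) :
    curveApply ev L a t = ev (L t) a := rfl

omit [FiniteDimensional ℝ E] in
theorem norm_curveApply_le (ev : F →L[ℝ] A →L[ℝ] E) (L : C(I, F)) (a : A) :
    ‖curveApply ev L a‖ ≤ ‖ev‖ * ‖L‖ * ‖a‖ := by
  rw [ContinuousMap.norm_le _ (by positivity)]
  intro t
  refine (ev.le_opNorm₂ (L t) a).trans ?_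
  have := L.norm_coe_le_norm t
  gcongr

omit [FiniteDimensional ℝ E] in
theorem isBoundedBilinearMap_curveApply (ev : F →L[ℝ] A →L[ℝ] E) :
    IsBoundedBilinearMap ℝ fun q : C(I, F) × A => curveApply ev q.1 q.2 where
  add_left _ _ _ := by ext; simp
  smul_left _ _ _ := by ext; simp
  add_right _ _ _ := by ext; simp
  smul_right _ _ _ := by ext; simp
  bound := ⟨‖ev‖ + 1, by positivity, fun L a => (norm_curveApply_le ev L a).trans (by
    gcongr
    exact le_add_of_nonneg_right zero_le_one)⟩

omit [FiniteDimensional ℝ E] in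
theorem curveApply_sub (ev : F →L[ℝ] A →L[ℝ] E) (L M : C(I, F)) (a : A) :
    curveApply ev (L - M) a = curveApply ev L a - curveApply ev M a := by
  ext; simp

omit [FiniteDimensional ℝ E] in
@[simp] theorem curveApply_zero (ev : F →L[ℝ] A →L[ℝ] E) (L : C(I, F)) :
    curveApply ev L 0 = 0 := by
  ext; simp

/-- `curveApply` as a linear map in the second variable. -/
def curveApplyCLM (ev : F →L[ℝ] A →L[ℝ] E) (L : C(I, F)) : A →L[ℝ] C(I, E) :=
  LinearMap.mkContinuous
    { toFun := curveApply ev L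
      map_add' := fun _ _ => by ext; simp
      map_smul' := fun _ _ => by ext; simp } (‖ev‖ * ‖L‖) (norm_curveApply_le ev L)

omit [FiniteDimensional ℝ E] in
@[simp] theorem curveApplyCLM_apply (ev : F →L[ℝ] A →L[ℝ] E) (L : C(I, F)) (a : A) :
    curveApplyCLM ev L a = curveApply ev L a := rfl

omit [FiniteDimensional ℝ E] [NormedSpace ℝ E] [NormedSpace ℝ F] in
theorem continuous_norm_postcomp (D : C(E, F)) : Continuous fun γ : C(I, E) => ‖D.comp γ‖ :=
  continuous_norm.comp (ContinuousMap.continuous_postcomp D)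

omit [FiniteDimensional ℝ E] in
/-- A curve `γ` solving `γ' = X(γ) a`, and a solution `w` of the equation of first variation in the
direction `b` which vanishes at `0`: if the vector fields commute then `w` is the primitive form of
`t X(γ) b`. -/
theorem variation_eq_primitiveCLM [CompleteSpace E] (ev : F →L[ℝ] A →L[ℝ] E) {Y : E → F}
    (hY : ContDiff ℝ 1 Y) (D : C(E, E →L[ℝ] F)) (hD : ∀ x, D x = fderiv ℝ Y x) {γ v : C(I, E)}
    (x : E) (a b : A)
    (hγ : γ = constCurve E x +
      primitiveCLM E (curveApply ev ((⟨Y, hY.continuous⟩ : C(E, F)).comp γ) a))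
    (hcomm : ∀ t, ev (fderiv ℝ Y (γ t) (ev (Y (γ t)) a)) b =
      ev (fderiv ℝ Y (γ t) (ev (Y (γ t)) b)) a)
    (hv : ∀ t : I, v t = (t : ℝ) • ev (Y (γ t)) b) :
    v = primitiveCLM E (curveApply ev ((⟨Y, hY.continuous⟩ : C(E, F)).comp γ) b +
      curveApply ev (pointwiseApply I E F (D.comp γ) v) a) := by
  set N : C(I, F) := (⟨Y, hY.continuous⟩ : C(E, F)).comp γ with hN
  have hγode : ∀ s ∈ Set.Ioo (0 : ℝ) 1,
      HasDerivAt (curveExtend γ) (ev (Y (curveExtend γ s)) a) s := by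
    intro s hs
    have h1 := (hasDerivAt_primitiveCLM (curveApply ev N a) hs).const_add x
    have h2 : curveExtend γ = fun r => x + curveExtend (primitiveCLM E (curveApply ev N a)) r := by
      funext r
      simp only [curveExtend]
      conv_lhs => rw [hγ]
      rfl
    have h3 : HasDerivAt (curveExtend γ) (curveExtend (curveApply ev N a) s) s := by
      rw [h2]
      exact h1
    exact h3
  apply eq_primitiveCLM
  · simp [hv]
  · intro s hs
    have h1 : HasDerivAt (fun r => ev (Y (curveExtend γ r)))
        (ev (fderiv ℝ Y (curveExtend γ s) (ev (Y (curveExtend γ s)) a))) s :=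
      ev.hasFDerivAt.comp_hasDerivAt s <|
        ((hY.differentiable (by simp)) _).hasFDerivAt.comp_hasDerivAt s (hγode s hs)
    have h2 := (hasDerivAt_id s).smul (h1.clm_apply (hasDerivAt_const s b))
    have h3 : curveExtend v =ᶠ[𝓝 s] fun r => id r • ev (Y (curveExtend γ r)) b := by
      filter_upwards [isOpen_Ioo.mem_nhds hs] with r hr
      simp only [curveExtend, hv]
      rw [Set.projIcc_of_mem _ ⟨hr.1.le, hr.2.le⟩]
      rfl
    refine (h2.congr_of_eventuallyEq h3).congr_deriv ?_
    have h5 : curveExtend (curveApply ev N b +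
        curveApply ev (pointwiseApply I E F (D.comp γ) v) a) s =
        ev (Y (curveExtend γ s)) b + ev (D (curveExtend γ s) (curveExtend v s)) a := rfl
    rw [h5, h3.self_of_nhds, hD]
    -- The product rule gives `X b + s DX(X a) b`, and the variation equation asks for `X b + s DX(X
    -- b) a`; commutation of the fields identifies the two.
    simp only [map_smul, smul_apply, id, map_zero, add_zero, one_smul]
    rw [hcomm, add_comm]

set_option synthInstance.maxHeartbeats 200000 in
/-- The flow of a family of commuting vector fields `X a` depending linearly on the parameter `a`:
the map `Ψ (x, a)` is the time one flow of `X a` starting from `x`. -/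
theorem exists_flow_of_pairing (ev : F →L[ℝ] A →L[ℝ] E) {U : Set E} (hU : IsOpen U) {X : E → F} (hX : ContDiffOn ℝ ∞ X U)
    {p : E} (hp : p ∈ U)
    (hcomm : ∀ x ∈ U, ∀ a b, ev (fderiv ℝ X x (ev (X x) a)) b = ev (fderiv ℝ X x (ev (X x) b)) a) [CompleteSpace A]:
    ∃ (V : Set (E × A)) (Ψ : E × A → E), IsOpen V ∧ (p, (0 : A)) ∈ V ∧ ContDiffOn ℝ ∞ Ψ V ∧
      (∀ z ∈ V, Ψ z ∈ U) ∧ (∀ x, (x, (0 : A)) ∈ V → Ψ (x, 0) = x) ∧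
      ∀ z ∈ V, ∀ b, fderiv ℝ Ψ z (0, b) = ev (X (Ψ z)) b := by
  -- The superposition operator needs a globally defined field, so `X` is replaced by a cut-off `Y`;
  -- the curves are later confined to the set `V₀` where both agree.
  obtain ⟨Y, V₀, hY, hV₀, hpV₀, hV₀U, hYX⟩ := exists_contDiff_eqOn hU hX hp
  have : CompleteSpace E := FiniteDimensional.complete ℝ E
  have hY1 : ContDiff ℝ 1 Y := hY.of_le (by exact_mod_cast le_top)
  set N : C(I, E) → C(I, F) := fun γ => (⟨Y, hY.continuous⟩ : C(E, F)).comp γ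
    with hN
  have hNs : ContDiff ℝ ∞ N := contDiff_infty.2 fun n => contDiff_postcomp n hY
  set D : C(E, E →L[ℝ] F) := ⟨fderiv ℝ Y, hY1.continuous_fderiv (by simp)⟩ with hD
  set N' : C(I, E) → C(I, E) →L[ℝ] C(I, F) := fun γ =>
    pointwiseApply I E (F) (D.comp γ) with hN'
  have hNd : ∀ γ, HasFDerivAt N (N' γ) γ := fun γ => hasFDerivAt_postcomp hY1 γ
  -- The zeros of `G` are the solutions of the integral equation `γ = x + ∫ Y(γ) a`. Inverting `Φ =
  -- (id, G)` below solves for `γ` smoothly in `(x, a)`.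
  set G : (E × A) × C(I, E) → C(I, E) := fun q =>
    q.2 - constCurve E q.1.1 - primitiveCLM E (curveApply ev (N q.2) q.1.2) with hG
  have hGs : ContDiff ℝ ∞ G := by
    refine (contDiff_snd.sub ((constCurve E).contDiff.comp contDiff_fst.fst)).sub
      ((primitiveCLM E).contDiff.comp ?_)
    exact (isBoundedBilinearMap_curveApply ev).contDiff.comp
      ((hNs.comp contDiff_snd).prodMk contDiff_fst.snd)
  have hGd : ∀ q z' h, fderiv ℝ G q (z', h) = h - constCurve E z'.1
      - primitiveCLM E (curveApply ev (N q.2) z'.2 + curveApply ev (N' q.2 h) q.1.2) := by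
    intro q z' h
    have h1 : HasFDerivAt (fun q : (E × A) × C(I, E) => N q.2)
        ((N' q.2).comp (ContinuousLinearMap.snd ℝ (E × A) C(I, E))) q :=
      HasFDerivAt.comp (g := N) (f := Prod.snd) q (hNd q.2) hasFDerivAt_snd
    have h2 : HasFDerivAt (fun q : (E × A) × C(I, E) => q.1.2)
        ((ContinuousLinearMap.snd ℝ E A).comp (ContinuousLinearMap.fst ℝ (E × A) C(I, E))) q :=
      HasFDerivAt.comp (g := Prod.snd) (f := Prod.fst) q hasFDerivAt_snd hasFDerivAt_fst
    have h3 : HasFDerivAt (fun q : (E × A) × C(I, E) => q.1.1)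
        ((ContinuousLinearMap.fst ℝ E A).comp (ContinuousLinearMap.fst ℝ (E × A) C(I, E))) q :=
      HasFDerivAt.comp (g := Prod.fst) (f := Prod.fst) q hasFDerivAt_fst hasFDerivAt_fst
    have h4 := HasFDerivAt.comp (g := fun q : C(I, F) × A => curveApply ev q.1 q.2)
      (f := fun q : (E × A) × C(I, E) => (N q.2, q.1.2)) q
      ((isBoundedBilinearMap_curveApply ev).hasFDerivAt (N q.2, q.1.2)) (h1.prodMk h2)
    have h5 := (hasFDerivAt_snd.sub ((constCurve E).hasFDerivAt.comp q h3)).sub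
      ((primitiveCLM E).hasFDerivAt.comp q h4)
    rw [show fderiv ℝ G q = _ from h5.fderiv]
    simp
  set Φ : (E × A) × C(I, E) → (E × A) × C(I, E) := fun q => (q.1, G q) with hΦ
  have hΦs : ContDiff ℝ ∞ Φ := contDiff_fst.prodMk hGs
  set q₀ : (E × A) × C(I, E) := ((p, 0), constCurve E p) with hq₀
  set T : (E × A) →L[ℝ] C(I, E) := (constCurve E).comp (ContinuousLinearMap.fst ℝ E A) +
    ((primitiveCLM E).comp (curveApplyCLM ev (N q₀.2))).comp (ContinuousLinearMap.snd ℝ E A) with hT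
  let Φ' : ((E × A) × C(I, E)) ≃L[ℝ] (E × A) × C(I, E) :=
    ContinuousLinearEquiv.equivOfInverse
      ((ContinuousLinearMap.fst ℝ (E × A) C(I, E)).prod
        (ContinuousLinearMap.snd ℝ (E × A) C(I, E) -
          T.comp (ContinuousLinearMap.fst ℝ (E × A) C(I, E))))
      ((ContinuousLinearMap.fst ℝ (E × A) C(I, E)).prod
        (ContinuousLinearMap.snd ℝ (E × A) C(I, E) +
          T.comp (ContinuousLinearMap.fst ℝ (E × A) C(I, E))))
      (fun q => by simp) (fun q => by simp)
  have hΦ' : HasFDerivAt Φ (Φ' : (E × A) × C(I, E) →L[ℝ] (E × A) × C(I, E)) q₀ := by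
    have h1 : HasFDerivAt Φ _ q₀ :=
      hasFDerivAt_fst.prodMk ((hGs.differentiable (by simp)) q₀).hasFDerivAt
    refine h1.congr_fderiv (ContinuousLinearMap.ext fun q => ?_)
    obtain ⟨z', h⟩ := q
    refine Prod.ext rfl (Eq.symm ?_)
    change h - T z' = fderiv ℝ G q₀ (z', h)
    rw [hGd]
    simp [hT, hq₀, sub_sub]
  obtain ⟨e, hq₀e, -, he, hes, -⟩ := exists_openPartialHomeomorph_of_contDiffOn isOpen_univ
    hΦs.contDiffOn (Set.mem_univ q₀) Φ' hΦ'
  have heq₀ : e q₀ = ((p, 0), 0) := by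
    rw [he]
    simp [hΦ, hG, hq₀]
  set j : E × A → (E × A) × C(I, E) := fun z => (z, 0) with hj
  have hjs : ContDiff ℝ ∞ j := contDiff_id.prodMk contDiff_const
  set V₁ : Set (E × A) := j ⁻¹' e.target with hV₁
  have hV₁o : IsOpen V₁ := e.open_target.preimage hjs.continuous
  set γ : E × A → C(I, E) := fun z => (e.symm (z, 0)).2 with hγ
  have hγs : ContDiffOn ℝ ∞ γ V₁ := (hes.comp hjs.contDiffOn (fun z hz => hz)).snd
  have hfst : ∀ z ∈ V₁, (e.symm (z, 0)).1 = z ∧ G (z, γ z) = 0 := by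
    intro z hz
    have h1 := e.right_inv hz
    rw [he] at h1
    have h2 : (e.symm (z, 0)).1 = z := congrArg Prod.fst h1
    have h3 : G (e.symm (z, 0)) = 0 := congrArg Prod.snd h1
    refine ⟨h2, ?_⟩
    rw [← h3]
    congr 1
    exact Prod.ext h2.symm rfl
  have hz₀ : (p, (0 : A)) ∈ V₁ := by
    change ((p, (0 : A)), (0 : C(I, E))) ∈ e.target
    rw [← heq₀]
    exact e.map_source hq₀e
  have hγ₀ : γ (p, 0) = constCurve E p := by
    have : e.symm ((p, (0 : A)), (0 : C(I, E))) = q₀ := by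
      rw [← heq₀, e.left_inv hq₀e]
    rw [hγ]
    simp [this, hq₀]
  set W : Set C(I, E) := {η | Set.MapsTo η Set.univ V₀} with hW
  have hWo : IsOpen W := ContinuousMap.isOpen_setOfPred_mapsTo isCompact_univ hV₀
  have hV₂ : IsOpen (V₁ ∩ γ ⁻¹' W) := hγs.continuousOn.isOpen_inter_preimage hV₁o hWo
  have hnc : ContinuousOn (fun z : E × A => ‖ev‖ * ‖D.comp (γ z)‖ * ‖z.2‖) V₁ := by
    exact (continuousOn_const.mul ((continuous_norm_postcomp D).comp_continuousOn
      hγs.continuousOn)).mul continuousOn_snd.norm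
  -- On this set the linearised integral equation has contraction constant less than one, so its
  -- solutions are unique; this identifies the derivative of the flow below.
  have hV₃ := hnc.isOpen_inter_preimage hV₁o (isOpen_Iio (a := (1 : ℝ)))
  refine ⟨(V₁ ∩ γ ⁻¹' W) ∩ (V₁ ∩ (fun z : E × A => ‖ev‖ * ‖D.comp (γ z)‖ * ‖z.2‖) ⁻¹' Set.Iio 1),
    fun z => γ z 1, hV₂.inter hV₃, ?_, ?_, ?_, ?_, ?_⟩
  · refine ⟨⟨hz₀, ?_⟩, hz₀, by simp⟩
    intro t _
    rw [hγ₀]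
    exact hpV₀
  · exact (ContinuousMap.evalCLM ℝ (1 : I) : C(I, E) →L[ℝ] E).contDiff.comp_contDiffOn
      (hγs.mono fun z hz => hz.1.1)
  · intro z hz
    exact hV₀U (hz.1.2 (Set.mem_univ 1))
  · intro x hx
    have h1 := (hfst _ hx.1.1).2
    simp only [hG] at h1
    have h2 := congrArg (fun η : C(I, E) => η 1) (sub_eq_zero.1 h1)
    simpa [sub_eq_zero] using h2
  · rintro ⟨x, a⟩ hz b
    set z : E × A := (x, a)
    have hzV : z ∈ V₁ := hz.1.1
    have hγd : HasFDerivAt γ (fderiv ℝ γ z) z :=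
      ((hγs.contDiffAt (hV₁o.mem_nhds hzV)).differentiableAt (by simp)).hasFDerivAt
    set w : C(I, E) := fderiv ℝ γ z (0, b) with hw
    have hev : fderiv ℝ (fun z => γ z 1) z (0, b) = w 1 := by
      have h1 := HasFDerivAt.comp (g := (ContinuousMap.evalCLM ℝ (1 : I) : C(I, E) →L[ℝ] E)) (f := γ) z
        (ContinuousMap.evalCLM ℝ (1 : I) : C(I, E) →L[ℝ] E).hasFDerivAt hγd
      change fderiv ℝ ((ContinuousMap.evalCLM ℝ (1 : I) : C(I, E) →L[ℝ] E) ∘ γ) z (0, b) = w 1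
      rw [h1.fderiv]
      rfl
    have hlin : w = primitiveCLM E (curveApply ev (N (γ z)) b + curveApply ev (N' (γ z) w) a) := by
      have h1 : HasFDerivAt (fun z => G (z, γ z)) _ z :=
        ((hGs.differentiable (by simp)) (z, γ z)).hasFDerivAt.comp z
          ((hasFDerivAt_id z).prodMk hγd)
      have h2 : (fun z => G (z, γ z)) =ᶠ[𝓝 z] fun _ => 0 := by
        filter_upwards [hV₁o.mem_nhds hzV] with y hy using (hfst y hy).2
      have h3 := h1.unique ((hasFDerivAt_const (0 : C(I, E)) z).congr_of_eventuallyEq h2)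
      have h4 := congrArg (fun L => L ((0 : E), b)) h3
      simp only [ContinuousLinearMap.comp_apply, ContinuousLinearMap.prod_apply,
        ContinuousLinearMap.id_apply, zero_apply, hGd, map_zero, sub_zero]
        at h4
      exact sub_eq_zero.1 h4
    have hγint : γ z = constCurve E x + primitiveCLM E (curveApply ev (N (γ z)) a) := by
      have h1 := (hfst z hzV).2
      simp only [hG] at h1
      rw [sub_sub, sub_eq_zero] at h1
      exact h1
    -- The variation in direction `b` should be `t X(γ) b`, because the fields commute. It satisfies
    -- the same linear equation as `w`, and the contraction estimate gives `w = v`; at `t = 1` this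
    -- is the claim.
    set v : C(I, E) := ⟨fun t => (t : ℝ) • ev (Y (γ z t)) b, by
      have := hY.continuous
      fun_prop⟩ with hv
    have hvlin : v = primitiveCLM E
        (curveApply ev (N (γ z)) b + curveApply ev (N' (γ z) v) a) := by
      refine variation_eq_primitiveCLM ev hY1 D (fun _ => rfl) x a b hγint (fun t => ?_)
        (fun _ => rfl)
      have hmem : γ z t ∈ V₀ := hz.1.2 (Set.mem_univ _)
      have h4 : Y =ᶠ[𝓝 (γ z t)] X := by
        filter_upwards [hV₀.mem_nhds hmem] with y hy using hYX hy
      rw [h4.fderiv_eq, hYX hmem]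
      exact hcomm _ (hV₀U hmem) a b
    have hdiff : w - v = primitiveCLM E (curveApply ev (N' (γ z) (w - v)) a) := by
      conv_lhs => rw [hlin, hvlin]
      rw [← map_sub, map_sub (N' (γ z)), curveApply_sub]
      congr 1
      abel
    have hle : ‖w - v‖ ≤ ‖ev‖ * ‖D.comp (γ z)‖ * ‖a‖ * ‖w - v‖ := by
      conv_lhs => rw [hdiff]
      refine ((norm_primitiveCLM_le _).trans (norm_curveApply_le _ _ _)).trans ?_
      have := norm_pointwiseApply_le (D.comp (γ z)) (w - v)
      calc _ ≤ ‖ev‖ * (‖D.comp (γ z)‖ * ‖w - v‖) * ‖a‖ := by gcongr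
        _ = _ := by ring
    have hlt : ‖ev‖ * ‖D.comp (γ z)‖ * ‖a‖ < 1 := hz.2.2
    have h0 : ‖w - v‖ = 0 := by
      nlinarith [norm_nonneg (w - v)]
    have hwv : w = v := sub_eq_zero.1 (norm_eq_zero.1 h0)
    rw [hev, hwv]
    have : γ z 1 ∈ V₀ := hz.1.2 (Set.mem_univ _)
    simp only [hv, ContinuousMap.coe_mk]
    rw [hYX this]
    simp

/-- The flow of a family of commuting vector fields `X · a` depending linearly on `a`: the map
`Ψ (x, a)` is the time one flow of `X · a` starting from `x`. -/
theorem exists_flow [CompleteSpace A] {U : Set E} (hU : IsOpen U) {X : E → A →L[ℝ] E}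
    (hX : ContDiffOn ℝ ∞ X U) {p : E} (hp : p ∈ U)
    (hcomm : ∀ x ∈ U, ∀ a b, fderiv ℝ X x (X x a) b = fderiv ℝ X x (X x b) a) :
    ∃ (V : Set (E × A)) (Ψ : E × A → E), IsOpen V ∧ (p, (0 : A)) ∈ V ∧ ContDiffOn ℝ ∞ Ψ V ∧
      (∀ z ∈ V, Ψ z ∈ U) ∧ (∀ x, (x, (0 : A)) ∈ V → Ψ (x, 0) = x) ∧
      ∀ z ∈ V, ∀ b, fderiv ℝ Ψ z (0, b) = X (Ψ z) b :=
  exists_flow_of_pairing (ContinuousLinearMap.id ℝ (A →L[ℝ] E)) hU hX hp hcomm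

end


noncomputable section

/-! ### Levi-Civita connections on open subsets of a normed space -/

set_option maxSynthPendingDepth 3

variable {E : Type*} [NormedAddCommGroup E] [NormedSpace ℝ E]

theorem minSmoothness_two_le : minSmoothness ℝ 2 ≤ (∞ : WithTop ℕ∞) := by
  rw [minSmoothness_of_isRCLikeNormedField]
  exact WithTop.coe_le_coe.2 le_top

/-- `Γ` is the Levi-Civita connection of the smooth pseudo-Riemannian metric `B` on the open
set `U`. -/
structure IsLeviCivita (U : Set E) (B : E → E →L[ℝ] E →L[ℝ] ℝ) (Γ : E → E →L[ℝ] E →L[ℝ] E) :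
    Prop where
  isOpen : IsOpen U
  smooth_metric : ContDiffOn ℝ ∞ B U
  smooth_conn : ContDiffOn ℝ ∞ Γ U
  symm : ∀ x ∈ U, ∀ u v, B x u v = B x v u
  nondegenerate : ∀ x ∈ U, ∀ u, (∀ v, B x u v = 0) → u = 0
  torsion_free : ∀ x ∈ U, ∀ u v, Γ x u v = Γ x v u
  compat : ∀ x ∈ U, ∀ w u v, fderiv ℝ B x w u v = B x (Γ x w u) v + B x u (Γ x w v)

/-- The curvature `[∇_u, ∇_v] z` of the connection `Γ` for constant vector fields. -/
def riem (Γ : E → E →L[ℝ] E →L[ℝ] E) (x u v z : E) : E :=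
  fderiv ℝ Γ x u v z - fderiv ℝ Γ x v u z + Γ x u (Γ x v z) - Γ x v (Γ x u z)

/-- The derivative in the direction `w` of the components of the curvature. -/
def riemDeriv (Γ : E → E →L[ℝ] E →L[ℝ] E) (x w u v z : E) : E :=
  fderiv ℝ (fderiv ℝ Γ) x w u v z - fderiv ℝ (fderiv ℝ Γ) x w v u z
    + (fderiv ℝ Γ x w u (Γ x v z) + Γ x u (fderiv ℝ Γ x w v z))
    - (fderiv ℝ Γ x w v (Γ x u z) + Γ x v (fderiv ℝ Γ x w u z))

/-- The covariant derivative of the curvature. -/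
def covRiem (Γ : E → E →L[ℝ] E →L[ℝ] E) (x w u v z : E) : E :=
  riemDeriv Γ x w u v z + Γ x w (riem Γ x u v z) - riem Γ x u v (Γ x w z)
    - riem Γ x (Γ x w u) v z - riem Γ x u (Γ x w v) z

theorem riem_swap (Γ : E → E →L[ℝ] E →L[ℝ] E) (x u v z : E) :
    riem Γ x v u z = -riem Γ x u v z := by
  simp only [riem]; abel

theorem riem_add_right (Γ : E → E →L[ℝ] E →L[ℝ] E) (x u v z z' : E) :
    riem Γ x u v (z + z') = riem Γ x u v z + riem Γ x u v z' := by
  simp only [riem, map_add]; abel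

theorem riem_smul_right (Γ : E → E →L[ℝ] E →L[ℝ] E) (x u v z : E) (c : ℝ) :
    riem Γ x u v (c • z) = c • riem Γ x u v z := by
  simp only [riem, map_smul, smul_sub, smul_add]

theorem riem_add_left (Γ : E → E →L[ℝ] E →L[ℝ] E) (x u u' v z : E) :
    riem Γ x (u + u') v z = riem Γ x u v z + riem Γ x u' v z := by
  simp only [riem, map_add, add_apply]; abel

theorem riem_smul_left (Γ : E → E →L[ℝ] E →L[ℝ] E) (x u v z : E) (c : ℝ) :
    riem Γ x (c • u) v z = c • riem Γ x u v z := by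
  simp only [riem, map_smul, smul_apply, smul_sub, smul_add]

theorem riem_add_middle (Γ : E → E →L[ℝ] E →L[ℝ] E) (x u v v' z : E) :
    riem Γ x u (v + v') z = riem Γ x u v z + riem Γ x u v' z := by
  simp only [riem, map_add, add_apply]; abel

theorem riem_smul_middle (Γ : E → E →L[ℝ] E →L[ℝ] E) (x u v z : E) (c : ℝ) :
    riem Γ x u (c • v) z = c • riem Γ x u v z := by
  simp only [riem, map_smul, smul_apply, smul_sub, smul_add]

namespace IsLeviCivita

variable {U : Set E} {B : E → E →L[ℝ] E →L[ℝ] ℝ} {Γ : E → E →L[ℝ] E →L[ℝ] E}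
  (h : IsLeviCivita U B Γ) {x : E}

include h

theorem contDiffAt_metric (hx : x ∈ U) : ContDiffAt ℝ ∞ B x :=
  h.smooth_metric.contDiffAt (h.isOpen.mem_nhds hx)

theorem contDiffAt_conn (hx : x ∈ U) : ContDiffAt ℝ ∞ Γ x :=
  h.smooth_conn.contDiffAt (h.isOpen.mem_nhds hx)

theorem hasFDerivAt_metric (hx : x ∈ U) : HasFDerivAt B (fderiv ℝ B x) x :=
  ((h.contDiffAt_metric hx).differentiableAt (by simp)).hasFDerivAt

theorem hasFDerivAt_conn (hx : x ∈ U) : HasFDerivAt Γ (fderiv ℝ Γ x) x :=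
  ((h.contDiffAt_conn hx).differentiableAt (by simp)).hasFDerivAt

theorem hasFDerivAt_fderiv_conn (hx : x ∈ U) :
    HasFDerivAt (fderiv ℝ Γ) (fderiv ℝ (fderiv ℝ Γ) x) x :=
  (((h.contDiffAt_conn hx).fderiv_right (m := ∞) (by simp)).differentiableAt
    (by simp)).hasFDerivAt

theorem hasFDerivAt_fderiv_metric (hx : x ∈ U) :
    HasFDerivAt (fderiv ℝ B) (fderiv ℝ (fderiv ℝ B) x) x :=
  (((h.contDiffAt_metric hx).fderiv_right (m := ∞) (by simp)).differentiableAt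
    (by simp)).hasFDerivAt

theorem fderiv_torsion_free (hx : x ∈ U) (w u v : E) :
    fderiv ℝ Γ x w u v = fderiv ℝ Γ x w v u := by
  have h1 : HasFDerivAt (fun y => Γ y u v) _ x :=
    ((h.hasFDerivAt_conn hx).clm_apply (hasFDerivAt_const u x)).clm_apply (hasFDerivAt_const v x)
  have h2 : HasFDerivAt (fun y => Γ y v u) _ x :=
    ((h.hasFDerivAt_conn hx).clm_apply (hasFDerivAt_const v x)).clm_apply (hasFDerivAt_const u x)
  have h3 : (fun y => Γ y u v) =ᶠ[𝓝 x] fun y => Γ y v u := by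
    filter_upwards [h.isOpen.mem_nhds hx] with y hy using h.torsion_free y hy u v
  have h4 := congrArg (fun L => L w) (h1.unique (h2.congr_of_eventuallyEq h3))
  simpa using h4

theorem fderiv_fderiv_conn_symm (hx : x ∈ U) (w u v z : E) :
    fderiv ℝ (fderiv ℝ Γ) x w u v z = fderiv ℝ (fderiv ℝ Γ) x u w v z := by
  have := (h.contDiffAt_conn hx).isSymmSndFDerivAt minSmoothness_two_le w u
  rw [this]

/-- The first Bianchi identity. -/
theorem riem_cyclic (hx : x ∈ U) (u v z : E) :
    riem Γ x u v z + riem Γ x v z u + riem Γ x z u v = 0 := by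
  simp only [riem]
  rw [h.fderiv_torsion_free hx u v z, h.fderiv_torsion_free hx v z u,
    h.fderiv_torsion_free hx z u v, h.torsion_free x hx v z, h.torsion_free x hx u z,
    h.torsion_free x hx v u]
  abel

/-- The second Bianchi identity. -/
theorem covRiem_cyclic (hx : x ∈ U) (w u v z : E) :
    covRiem Γ x w u v z + covRiem Γ x u v w z + covRiem Γ x v w u z = 0 := by
  simp only [covRiem, riemDeriv]
  rw [h.fderiv_fderiv_conn_symm hx u w v, h.fderiv_fderiv_conn_symm hx v w u,
    h.fderiv_fderiv_conn_symm hx v u w, h.torsion_free x hx v u, h.torsion_free x hx u w,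
    h.torsion_free x hx v w, riem_swap Γ x u (Γ x w v) z, riem_swap Γ x w (Γ x u v) z,
    riem_swap Γ x v (Γ x w u) z]
  simp only [riem, map_sub, map_add]
  abel

/-- The curvature with a varying last argument. -/
theorem hasFDerivAt_riem (hx : x ∈ U) (u v : E) {Z : E → E} {Z' : E →L[ℝ] E}
    (hZ : HasFDerivAt Z Z' x) :
    ∃ L : E →L[ℝ] E, HasFDerivAt (fun y => riem Γ y u v (Z y)) L x ∧
      ∀ w, L w = riemDeriv Γ x w u v (Z x) + riem Γ x u v (Z' w) := by
  have hG := h.hasFDerivAt_conn hx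
  have hD := h.hasFDerivAt_fderiv_conn hx
  have hu := hasFDerivAt_const (𝕜 := ℝ) u x
  have hv := hasFDerivAt_const (𝕜 := ℝ) v x
  have h1 := ((hD.clm_apply hu).clm_apply hv).clm_apply hZ
  have h2 := ((hD.clm_apply hv).clm_apply hu).clm_apply hZ
  have h3 := (hG.clm_apply hu).clm_apply ((hG.clm_apply hv).clm_apply hZ)
  have h4 := (hG.clm_apply hv).clm_apply ((hG.clm_apply hu).clm_apply hZ)
  refine ⟨_, ((h1.sub h2).add h3).sub h4, fun w => ?_⟩
  simp [riemDeriv, riem]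
  abel

/-- Differentiation of the scalar product of two vector fields. -/
theorem hasFDerivAt_inner (hx : x ∈ U) {Z V : E → E} {Z' V' : E →L[ℝ] E}
    (hZ : HasFDerivAt Z Z' x) (hV : HasFDerivAt V V' x) :
    ∃ L : E →L[ℝ] ℝ, HasFDerivAt (fun y => B y (Z y) (V y)) L x ∧
      ∀ w, L w = B x (Z' w + Γ x w (Z x)) (V x) + B x (Z x) (V' w + Γ x w (V x)) := by
  refine ⟨_, ((h.hasFDerivAt_metric hx).clm_apply hZ).clm_apply hV, fun w => ?_⟩
  simp [h.compat x hx]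
  ring

/-- Metric compatibility is differentiated once more. The mixed terms are symmetric in the two
directions, so symmetry of the second derivative of `B` leaves exactly the curvature in the two
slots. -/
theorem inner_riem_self (hx : x ∈ U) (u v z t : E) :
    B x (riem Γ x u v z) t + B x z (riem Γ x u v t) = 0 := by
  have key : ∀ u v : E, fderiv ℝ (fderiv ℝ B) x v u z t =
      (B x (fderiv ℝ Γ x v u z + Γ x v (Γ x u z)) t + B x (Γ x u z) (Γ x v t)) +
      (B x (Γ x v z) (Γ x u t) + B x z (fderiv ℝ Γ x v u t + Γ x v (Γ x u t))) := by
    intro u v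
    have hG := fun z => ((h.hasFDerivAt_conn hx).clm_apply
      (hasFDerivAt_const u x)).clm_apply (hasFDerivAt_const z x)
    obtain ⟨L1, hL1, hL1'⟩ := h.hasFDerivAt_inner hx (hG z) (hasFDerivAt_const t x)
    obtain ⟨L2, hL2, hL2'⟩ := h.hasFDerivAt_inner hx (hasFDerivAt_const z x) (hG t)
    have h1 := (((h.hasFDerivAt_fderiv_metric hx).clm_apply (hasFDerivAt_const u x)).clm_apply
      (hasFDerivAt_const z x)).clm_apply (hasFDerivAt_const t x)
    have h2 : (fun y => fderiv ℝ B y u z t) =ᶠ[𝓝 x]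
        fun y => B y (Γ y u z) t + B y z (Γ y u t) := by
      filter_upwards [h.isOpen.mem_nhds hx] with y hy using h.compat y hy u z t
    have h3 := congrArg (fun L => L v) (h1.unique ((hL1.add hL2).congr_of_eventuallyEq h2))
    simpa [hL1', hL2'] using h3
  have hs := (h.contDiffAt_metric hx).isSymmSndFDerivAt minSmoothness_two_le u v
  have h1 := key u v
  have h2 := key v u
  rw [hs] at h2
  simp only [riem, map_sub, map_add, sub_apply, add_apply] at h1 h2 ⊢
  linarith

/-- The curvature is symmetric under the exchange of pairs. -/
theorem inner_riem_pair (hx : x ∈ U) (u v z t : E) :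
    B x (riem Γ x u v z) t = B x (riem Γ x z t u) v := by
  have c := fun a b c d => congrArg (fun w => B x w d) (h.riem_cyclic hx a b c)
  simp only [map_add, add_apply, map_zero, zero_apply] at c
  have s : ∀ a b c d, B x (riem Γ x a b c) d = -B x (riem Γ x a b d) c := fun a b c d => by
    rw [h.symm x hx (riem Γ x a b d) c]
    linarith [h.inner_riem_self hx a b c d]
  have a : ∀ a b c d, B x (riem Γ x b a c) d = -B x (riem Γ x a b c) d := fun a b c d => by
    rw [riem_swap Γ x a b c]; simp
  -- The classical octahedron argument: the four cyclic identities are added up with the two skew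
  -- symmetries.
  linarith [c u v z t, c v z t u, c z t u v, c t u v z, s u v z t, s v z t u, s z t u v,
    s t u v z, a u v z t, a v z u t, a z u v t, a v z t u, a z t v u, a t v z u, a z t u v,
    a t u z v, a u z t v, a t u v z, a u v t z, a v t u z, s z u v t, s v t u z, s u z t v,
    s t v z u, s v z u t, s u v t z, s t u z v, s z t v u]

end IsLeviCivita

end


noncomputable section

set_option maxSynthPendingDepth 3

/-! ### Weyl type tensors and null frames -/

variable {E : Type*} [NormedAddCommGroup E] [NormedSpace ℝ E]

/-- The Hessian of `F` with respect to the connection `Γ`. -/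
def hessForm (Γ : E → E →L[ℝ] E →L[ℝ] E) (F : E → ℝ) (x : E) : E →L[ℝ] E →L[ℝ] ℝ :=
  fderiv ℝ (fderiv ℝ F) x - (ContinuousLinearMap.compL ℝ E E ℝ (fderiv ℝ F x)).comp (Γ x)

theorem hessForm_apply (Γ : E → E →L[ℝ] E →L[ℝ] E) (F : E → ℝ) (x u v : E) :
    hessForm Γ F x u v = fderiv ℝ (fderiv ℝ F) x u v - fderiv ℝ F x (Γ x u v) := by
  simp [hessForm]

/-- The Kulkarni-Nomizu product of two symmetric bilinear forms. -/
def kulkarniNomizu (P g : E → E → ℝ) (u v z t : E) : ℝ :=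
  P u z * g v t + P v t * g u z - P u t * g v z - P v z * g u t

/-- The `(0,4)`-curvature tensor minus the Kulkarni-Nomizu product of `P` and the metric. -/
def weylForm (B : E → E →L[ℝ] E →L[ℝ] ℝ) (Γ : E → E →L[ℝ] E →L[ℝ] E)
    (P : E → E →L[ℝ] E →L[ℝ] ℝ) (x u v z t : E) : ℝ :=
  -B x (riem Γ x u v z) t - kulkarniNomizu (fun a b => P x a b) (fun a b => B x a b) u v z t

/-- The covariant derivative of a bilinear form. -/
def covForm (Γ : E → E →L[ℝ] E →L[ℝ] E) (P : E → E →L[ℝ] E →L[ℝ] ℝ) (x w u v : E) : ℝ :=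
  fderiv ℝ P x w u v - P x (Γ x w u) v - P x u (Γ x w v)

/-- `n₁, n₂, m₁, m₂` is a basis of null vectors in which `n₁, n₂` are dual to `m₁, m₂`. -/
structure IsNullFrame (g : E →L[ℝ] E →L[ℝ] ℝ) (n₁ n₂ m₁ m₂ : E) : Prop where
  n₁n₁ : g n₁ n₁ = 0
  n₁n₂ : g n₁ n₂ = 0
  n₁m₁ : g n₁ m₁ = 1
  n₁m₂ : g n₁ m₂ = 0
  n₂n₂ : g n₂ n₂ = 0
  n₂m₁ : g n₂ m₁ = 0
  n₂m₂ : g n₂ m₂ = 1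
  m₁m₁ : g m₁ m₁ = 0
  m₁m₂ : g m₁ m₂ = 0
  m₂m₂ : g m₂ m₂ = 0
  expand : ∀ v, v = g v m₁ • n₁ + g v m₂ • n₂ + g v n₁ • m₁ + g v n₂ • m₂

/-- A tensor `W` vanishes on the bivectors `n₁ ∧ m₂`, `n₂ ∧ m₁` and `n₁ ∧ m₁ - n₂ ∧ m₂`. -/
structure VanishesOnAntiSelfDual (W : E → E → E → E → ℝ) (n₁ n₂ m₁ m₂ : E) : Prop where
  n₁m₂ : ∀ u v, W n₁ m₂ u v = 0
  n₂m₁ : ∀ u v, W n₂ m₁ u v = 0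
  diag : ∀ u v, W n₁ m₁ u v = W n₂ m₂ u v

theorem weylForm_add_right (B : E → E →L[ℝ] E →L[ℝ] ℝ) (Γ : E → E →L[ℝ] E →L[ℝ] E)
    (P : E → E →L[ℝ] E →L[ℝ] ℝ) (x u v z t t' : E) :
    weylForm B Γ P x u v z (t + t') = weylForm B Γ P x u v z t + weylForm B Γ P x u v z t' := by
  simp only [weylForm, kulkarniNomizu, map_add]; ring

theorem weylForm_smul_right (B : E → E →L[ℝ] E →L[ℝ] ℝ) (Γ : E → E →L[ℝ] E →L[ℝ] E)
    (P : E → E →L[ℝ] E →L[ℝ] ℝ) (x u v z t : E) (c : ℝ) :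
    weylForm B Γ P x u v z (c • t) = c * weylForm B Γ P x u v z t := by
  simp only [weylForm, kulkarniNomizu, map_smul, smul_eq_mul]; ring

theorem weylForm_add_third (B : E → E →L[ℝ] E →L[ℝ] ℝ) (Γ : E → E →L[ℝ] E →L[ℝ] E)
    (P : E → E →L[ℝ] E →L[ℝ] ℝ) (x u v z z' t : E) :
    weylForm B Γ P x u v (z + z') t = weylForm B Γ P x u v z t + weylForm B Γ P x u v z' t := by
  simp only [weylForm, kulkarniNomizu, map_add, riem_add_right, add_apply]; ring

theorem weylForm_smul_third (B : E → E →L[ℝ] E →L[ℝ] ℝ) (Γ : E → E →L[ℝ] E →L[ℝ] E)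
    (P : E → E →L[ℝ] E →L[ℝ] ℝ) (x u v z t : E) (c : ℝ) :
    weylForm B Γ P x u v (c • z) t = c * weylForm B Γ P x u v z t := by
  simp only [weylForm, kulkarniNomizu, map_smul, riem_smul_right, smul_apply, smul_eq_mul]; ring

theorem weylForm_swap (B : E → E →L[ℝ] E →L[ℝ] ℝ) (Γ : E → E →L[ℝ] E →L[ℝ] E)
    (P : E → E →L[ℝ] E →L[ℝ] ℝ) (x u v z t : E) :
    weylForm B Γ P x v u z t = -weylForm B Γ P x u v z t := by
  simp only [weylForm, kulkarniNomizu, riem_swap Γ x u v, map_neg, neg_apply]; ring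

namespace IsLeviCivita

variable {U : Set E} {B : E → E →L[ℝ] E →L[ℝ] ℝ} {Γ : E → E →L[ℝ] E →L[ℝ] E}
  (h : IsLeviCivita U B Γ) {x : E} {P : E → E →L[ℝ] E →L[ℝ] ℝ}

include h

theorem weylForm_pair (hx : x ∈ U) (hP : ∀ u v, P x u v = P x v u) (u v z t : E) :
    weylForm B Γ P x u v z t = weylForm B Γ P x z t u v := by
  simp only [weylForm, kulkarniNomizu, h.inner_riem_pair hx u v z t]
  rw [hP z u, hP t v, hP z v, hP t u, h.symm x hx t v, h.symm x hx z u, h.symm x hx t u,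
    h.symm x hx z v]
  ring

theorem weylForm_swap_right (hx : x ∈ U) (hP : ∀ u v, P x u v = P x v u) (u v z t : E) :
    weylForm B Γ P x u v t z = -weylForm B Γ P x u v z t := by
  rw [h.weylForm_pair hx hP, weylForm_swap, h.weylForm_pair hx hP]

/-- The derivative of a Weyl type tensor along vector fields. -/
theorem hasFDerivAt_weylForm (hx : x ∈ U) (hP : DifferentiableAt ℝ P x) (u v : E) {Z V : E → E}
    {Z' V' : E →L[ℝ] E} (hZ : HasFDerivAt Z Z' x) (hV : HasFDerivAt V V' x) :
    ∃ L : E →L[ℝ] ℝ, HasFDerivAt (fun y => weylForm B Γ P y u v (Z y) (V y)) L x ∧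
      ∀ w, L w = (-B x (covRiem Γ x w u v (Z x)) (V x)
          - kulkarniNomizu (covForm Γ P x w) (fun a b => B x a b) u v (Z x) (V x))
        + weylForm B Γ P x (Γ x w u) v (Z x) (V x) + weylForm B Γ P x u (Γ x w v) (Z x) (V x)
        + weylForm B Γ P x u v (Z' w + Γ x w (Z x)) (V x)
        + weylForm B Γ P x u v (Z x) (V' w + Γ x w (V x)) := by
  obtain ⟨R', hR, hR'⟩ := h.hasFDerivAt_riem hx u v hZ
  obtain ⟨L₀, hL₀, hL₀'⟩ := h.hasFDerivAt_inner hx hR hV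
  have hb : ∀ (a : E) {Y : E → E} {Y' : E →L[ℝ] E}, HasFDerivAt Y Y' x →
      ∃ L : E →L[ℝ] ℝ, HasFDerivAt (fun y => B y a (Y y)) L x ∧
        ∀ w, L w = B x (Γ x w a) (Y x) + B x a (Y' w + Γ x w (Y x)) := by
    intro a Y Y' hY
    obtain ⟨L, hL, hL'⟩ := h.hasFDerivAt_inner hx (hasFDerivAt_const a x) hY
    exact ⟨L, hL, fun w => by simp [hL']⟩
  have hp : ∀ (a : E) {Y : E → E} {Y' : E →L[ℝ] E}, HasFDerivAt Y Y' x →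
      ∃ L : E →L[ℝ] ℝ, HasFDerivAt (fun y => P y a (Y y)) L x ∧
        ∀ w, L w = covForm Γ P x w a (Y x) + P x (Γ x w a) (Y x)
          + P x a (Y' w + Γ x w (Y x)) := by
    intro a Y Y' hY
    refine ⟨_, (hP.hasFDerivAt.clm_apply (hasFDerivAt_const a x)).clm_apply hY, fun w => ?_⟩
    simp [covForm]
    ring
  obtain ⟨b₁, hb₁, hb₁'⟩ := hb u hZ
  obtain ⟨b₂, hb₂, hb₂'⟩ := hb v hZ
  obtain ⟨b₃, hb₃, hb₃'⟩ := hb u hV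
  obtain ⟨b₄, hb₄, hb₄'⟩ := hb v hV
  obtain ⟨p₁, hp₁, hp₁'⟩ := hp u hZ
  obtain ⟨p₂, hp₂, hp₂'⟩ := hp v hZ
  obtain ⟨p₃, hp₃, hp₃'⟩ := hp u hV
  obtain ⟨p₄, hp₄, hp₄'⟩ := hp v hV
  refine ⟨_, hL₀.neg.sub ((((hp₁.mul hb₄).add (hp₄.mul hb₁)).sub (hp₃.mul hb₂)).sub
    (hp₂.mul hb₃)), fun w => ?_⟩
  simp only [sub_apply, add_apply, neg_apply, smul_apply, smul_eq_mul, hL₀', hR', hb₁', hb₂', hb₃',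
    hb₄', hp₁', hp₂', hp₃', hp₄', weylForm, kulkarniNomizu, covRiem, map_add, map_sub,
    riem_add_right]
  ring

/-- The covariant derivative of a null frame preserves the anti-self-dual bivectors, and so a
tensor vanishing on them has a covariant derivative which vanishes on them. -/
theorem covDeriv_vanishes (hPd : ∀ y ∈ U, DifferentiableAt ℝ P y)
    (hP : ∀ y ∈ U, ∀ u v, P y u v = P y v u) {n₁ n₂ m₁ m₂ : E → E}
    (hn₁ : ∀ y ∈ U, DifferentiableAt ℝ n₁ y) (hn₂ : ∀ y ∈ U, DifferentiableAt ℝ n₂ y)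
    (hm₁ : ∀ y ∈ U, DifferentiableAt ℝ m₁ y) (hm₂ : ∀ y ∈ U, DifferentiableAt ℝ m₂ y)
    (hfr : ∀ y ∈ U, IsNullFrame (B y) (n₁ y) (n₂ y) (m₁ y) (m₂ y))
    (hW : ∀ y ∈ U, VanishesOnAntiSelfDual (weylForm B Γ P y) (n₁ y) (n₂ y) (m₁ y) (m₂ y))
    (hx : x ∈ U) (w u v : E) :
    let D : E → E → ℝ := fun z t => -B x (covRiem Γ x w u v z) t
          - kulkarniNomizu (covForm Γ P x w) (fun a b => B x a b) u v z t
    D (n₁ x) (m₂ x) = 0 ∧ D (n₂ x) (m₁ x) = 0 ∧ D (n₁ x) (m₁ x) = D (n₂ x) (m₂ x) := by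
  intro D
  have hW' : ∀ y ∈ U, ∀ a b, weylForm B Γ P y a b (n₁ y) (m₂ y) = 0 ∧
      weylForm B Γ P y a b (n₂ y) (m₁ y) = 0 ∧
      weylForm B Γ P y a b (n₁ y) (m₁ y) = weylForm B Γ P y a b (n₂ y) (m₂ y) := by
    intro y hy a b
    simp only [h.weylForm_pair hy (hP y hy) a b]
    -- Pair symmetry moves the frame vectors to the last two slots, the ones in which
    -- `hasFDerivAt_weylForm` allows varying vector fields.
    exact ⟨(hW y hy).n₁m₂ a b, (hW y hy).n₂m₁ a b, (hW y hy).diag a b⟩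
  have hU := h.isOpen.mem_nhds hx
  -- derivatives of the scalar products of the frame fields
  have hsc : ∀ {Y Y' : E → E} (c : ℝ), DifferentiableAt ℝ Y x → DifferentiableAt ℝ Y' x →
      (∀ y ∈ U, B y (Y y) (Y' y) = c) →
      B x (fderiv ℝ Y x w + Γ x w (Y x)) (Y' x) + B x (fderiv ℝ Y' x w + Γ x w (Y' x)) (Y x)
        = 0 := by
    intro Y Y' c hY hY' hc
    obtain ⟨L, hL, hL'⟩ := h.hasFDerivAt_inner hx hY.hasFDerivAt hY'.hasFDerivAt
    have h2 : (fun y => B y (Y y) (Y' y)) =ᶠ[𝓝 x] fun _ => c := by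
      filter_upwards [hU] with y hy using hc y hy
    have h3 := congrArg (fun L => L w)
      (hL.unique ((hasFDerivAt_const c x).congr_of_eventuallyEq h2))
    simp only [hL', zero_apply] at h3
    rw [h.symm x hx _ (Y x)]
    exact h3
  obtain ⟨L₁, hL₁, hL₁'⟩ := h.hasFDerivAt_weylForm hx (hPd x hx) u v (hn₁ x hx).hasFDerivAt
    (hm₂ x hx).hasFDerivAt
  obtain ⟨L₂, hL₂, hL₂'⟩ := h.hasFDerivAt_weylForm hx (hPd x hx) u v (hn₂ x hx).hasFDerivAt
    (hm₁ x hx).hasFDerivAt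
  obtain ⟨L₃, hL₃, hL₃'⟩ := h.hasFDerivAt_weylForm hx (hPd x hx) u v (hn₁ x hx).hasFDerivAt
    (hm₁ x hx).hasFDerivAt
  obtain ⟨L₄, hL₄, hL₄'⟩ := h.hasFDerivAt_weylForm hx (hPd x hx) u v (hn₂ x hx).hasFDerivAt
    (hm₂ x hx).hasFDerivAt
  have e₁ : L₁ w = 0 := by
    have h2 : (fun y => weylForm B Γ P y u v (n₁ y) (m₂ y)) =ᶠ[𝓝 x] fun _ => 0 := by
      filter_upwards [hU] with y hy using (hW' y hy u v).1
    simpa using congrArg (fun L => L w)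
      (hL₁.unique ((hasFDerivAt_const (0 : ℝ) x).congr_of_eventuallyEq h2))
  have e₂ : L₂ w = 0 := by
    have h2 : (fun y => weylForm B Γ P y u v (n₂ y) (m₁ y)) =ᶠ[𝓝 x] fun _ => 0 := by
      filter_upwards [hU] with y hy using (hW' y hy u v).2.1
    simpa using congrArg (fun L => L w)
      (hL₂.unique ((hasFDerivAt_const (0 : ℝ) x).congr_of_eventuallyEq h2))
  have e₃ : L₃ w = L₄ w := by
    have h2 : (fun y => weylForm B Γ P y u v (n₁ y) (m₁ y)) =ᶠ[𝓝 x]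
        fun y => weylForm B Γ P y u v (n₂ y) (m₂ y) := by
      filter_upwards [hU] with y hy using (hW' y hy u v).2.2
    exact congrArg (fun L => L w) (hL₃.unique (hL₄.congr_of_eventuallyEq h2))
  have s11 := hsc 0 (hn₁ x hx) (hn₁ x hx) (fun y hy => (hfr y hy).n₁n₁)
  have s12 := hsc 0 (hn₁ x hx) (hn₂ x hx) (fun y hy => (hfr y hy).n₁n₂)
  have s22 := hsc 0 (hn₂ x hx) (hn₂ x hx) (fun y hy => (hfr y hy).n₂n₂)
  have t11 := hsc 1 (hn₁ x hx) (hm₁ x hx) (fun y hy => (hfr y hy).n₁m₁)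
  have t12 := hsc 0 (hn₁ x hx) (hm₂ x hx) (fun y hy => (hfr y hy).n₁m₂)
  have t21 := hsc 0 (hn₂ x hx) (hm₁ x hx) (fun y hy => (hfr y hy).n₂m₁)
  have t22 := hsc 1 (hn₂ x hx) (hm₂ x hx) (fun y hy => (hfr y hy).n₂m₂)
  have r11 := hsc 0 (hm₁ x hx) (hm₁ x hx) (fun y hy => (hfr y hy).m₁m₁)
  have r12 := hsc 0 (hm₁ x hx) (hm₂ x hx) (fun y hy => (hfr y hy).m₁m₂)
  have r22 := hsc 0 (hm₂ x hx) (hm₂ x hx) (fun y hy => (hfr y hy).m₂m₂)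
  have sk := fun a b z => h.weylForm_swap_right hx (hP x hx) a b z z
  have sk' := h.weylForm_swap_right hx (hP x hx) u v
  rw [hL₁'] at e₁
  rw [hL₂'] at e₂
  rw [hL₃', hL₄'] at e₃
  rw [(hW' x hx _ _).1, (hW' x hx _ _).1] at e₁
  rw [(hW' x hx _ _).2.1, (hW' x hx _ _).2.1] at e₂
  rw [(hW' x hx (Γ x w u) v).2.2, (hW' x hx u (Γ x w v)).2.2] at e₃
  set A₁ := fderiv ℝ n₁ x w + Γ x w (n₁ x)
  set A₂ := fderiv ℝ n₂ x w + Γ x w (n₂ x)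
  set A₃ := fderiv ℝ m₁ x w + Γ x w (m₁ x)
  set A₄ := fderiv ℝ m₂ x w + Γ x w (m₂ x)
  -- The vectors `A₁, …, A₄` are the covariant derivatives of the frame in direction `w`. They are
  -- expanded in the frame, in either of the last two slots.
  have x₁ : ∀ A z, weylForm B Γ P x u v A z = B x A (m₁ x) * weylForm B Γ P x u v (n₁ x) z
      + B x A (m₂ x) * weylForm B Γ P x u v (n₂ x) z
      + B x A (n₁ x) * weylForm B Γ P x u v (m₁ x) z
      + B x A (n₂ x) * weylForm B Γ P x u v (m₂ x) z := by
    intro A z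
    conv_lhs => rw [(hfr x hx).expand A]
    simp only [weylForm_add_third, weylForm_smul_third]
  have x₂ : ∀ A z, weylForm B Γ P x u v z A = B x A (m₁ x) * weylForm B Γ P x u v z (n₁ x)
      + B x A (m₂ x) * weylForm B Γ P x u v z (n₂ x)
      + B x A (n₁ x) * weylForm B Γ P x u v z (m₁ x)
      + B x A (n₂ x) * weylForm B Γ P x u v z (m₂ x) := by
    intro A z
    conv_lhs => rw [(hfr x hx).expand A]
    simp only [weylForm_add_right, weylForm_smul_right]
  rw [x₁ A₁, x₂ A₄] at e₁
  rw [x₁ A₂, x₂ A₃] at e₂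
  rw [x₁ A₁, x₂ A₃, x₁ A₂, x₂ A₄] at e₃
  obtain ⟨v₁, v₂, v₃⟩ := hW' x hx u v
  have k11 : weylForm B Γ P x u v (n₁ x) (n₁ x) = 0 := by linarith [sk u v (n₁ x)]
  have k22 : weylForm B Γ P x u v (n₂ x) (n₂ x) = 0 := by linarith [sk u v (n₂ x)]
  have l11 : weylForm B Γ P x u v (m₁ x) (m₁ x) = 0 := by linarith [sk u v (m₁ x)]
  have l22 : weylForm B Γ P x u v (m₂ x) (m₂ x) = 0 := by linarith [sk u v (m₂ x)]
  -- Constancy of the scalar products makes the frame vary by a skew endomorphism. Such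
  -- endomorphisms preserve the span of the three anti-self-dual bivectors, so all correction terms
  -- in `e₁`, `e₂` and `e₃` are values of the Weyl form on that span.
  have z11 : B x A₁ (n₁ x) = 0 := by linarith
  have z22 : B x A₂ (n₂ x) = 0 := by linarith
  have z33 : B x A₃ (m₁ x) = 0 := by linarith
  have z44 : B x A₄ (m₂ x) = 0 := by linarith
  have q12 : B x A₂ (n₁ x) = -B x A₁ (n₂ x) := by linarith
  have q31 : B x A₃ (n₁ x) = -B x A₁ (m₁ x) := by linarith
  have q41 : B x A₄ (n₁ x) = -B x A₁ (m₂ x) := by linarith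
  have q32 : B x A₃ (n₂ x) = -B x A₂ (m₁ x) := by linarith
  have q42 : B x A₄ (n₂ x) = -B x A₂ (m₂ x) := by linarith
  have q43 : B x A₄ (m₁ x) = -B x A₃ (m₂ x) := by linarith
  have k12 := sk' (n₁ x) (n₂ x)
  have l12 := sk' (m₁ x) (m₂ x)
  have o1 : weylForm B Γ P x u v (m₂ x) (n₁ x) = 0 := by rw [sk', v₁, neg_zero]
  have o2 : weylForm B Γ P x u v (m₁ x) (n₂ x) = 0 := by rw [sk', v₂, neg_zero]
  rw [v₁, k11, l22, z11, z44, v₃, q41] at e₁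
  rw [v₂, k22, l11, z22, z33, v₃, q32] at e₂
  rw [v₁, v₂, v₃, k11, k22, l11, l22, z11, z33, z22, z44, q31, q32, q42, q12, q43, k12, l12] at e₃
  refine ⟨?_, ?_, ?_⟩ <;> simp only [D] <;> linarith

/-- The second Bianchi identity for a curvature tensor which agrees with a Kulkarni-Nomizu product
on the anti-self-dual bivectors. -/
theorem kulkarniNomizu_cyclic (hPd : ∀ y ∈ U, DifferentiableAt ℝ P y)
    (hP : ∀ y ∈ U, ∀ u v, P y u v = P y v u) {n₁ n₂ m₁ m₂ : E → E}
    (hn₁ : ∀ y ∈ U, DifferentiableAt ℝ n₁ y) (hn₂ : ∀ y ∈ U, DifferentiableAt ℝ n₂ y)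
    (hm₁ : ∀ y ∈ U, DifferentiableAt ℝ m₁ y) (hm₂ : ∀ y ∈ U, DifferentiableAt ℝ m₂ y)
    (hfr : ∀ y ∈ U, IsNullFrame (B y) (n₁ y) (n₂ y) (m₁ y) (m₂ y))
    (hW : ∀ y ∈ U, VanishesOnAntiSelfDual (weylForm B Γ P y) (n₁ y) (n₂ y) (m₁ y) (m₂ y))
    (hx : x ∈ U) (w u v : E) :
    let K : E → E → ℝ := fun z t =>
      kulkarniNomizu (covForm Γ P x w) (fun a b => B x a b) u v z t +
      kulkarniNomizu (covForm Γ P x u) (fun a b => B x a b) v w z t +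
      kulkarniNomizu (covForm Γ P x v) (fun a b => B x a b) w u z t
    K (n₁ x) (m₂ x) = 0 ∧ K (n₂ x) (m₁ x) = 0 ∧ K (n₁ x) (m₁ x) = K (n₂ x) (m₂ x) := by
  intro K
  have c := fun z t => congrArg (fun a => B x a t) (h.covRiem_cyclic hx w u v z)
  simp only [map_add, add_apply, map_zero, zero_apply] at c
  have d := fun w u v => h.covDeriv_vanishes hPd hP hn₁ hn₂ hm₁ hm₂ hfr hW hx w u v
  obtain ⟨a₁, a₂, a₃⟩ := d w u v
  obtain ⟨b₁, b₂, b₃⟩ := d u v w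
  obtain ⟨c₁, c₂, c₃⟩ := d v w u
  refine ⟨?_, ?_, ?_⟩ <;> simp only [K]
  · linarith [c (n₁ x) (m₂ x)]
  · linarith [c (n₂ x) (m₁ x)]
  · linarith [c (n₁ x) (m₁ x), c (n₂ x) (m₂ x)]

end IsLeviCivita

end


/-! ### The Cotton tensor and the Hessian of the potential -/

noncomputable section

set_option maxSynthPendingDepth 3

variable {E : Type*} [NormedAddCommGroup E] [NormedSpace ℝ E]

/-- The contraction of the Bianchi identity: the anti-self-dual part of the Cotton tensor of `T`
vanishes. -/
theorem IsNullFrame.cotton_eq_zero {g : E →L[ℝ] E →L[ℝ] ℝ} {n₁ n₂ m₁ m₂ : E}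
    (hfr : IsNullFrame g n₁ n₂ m₁ m₂) (hg : ∀ u v, g u v = g v u) {T : E → E → E → ℝ}
    (hT : ∀ w u v, T w u v = T w v u)
    (hK : ∀ w u v, let K : E → E → ℝ := fun z t =>
      kulkarniNomizu (T w) (fun a b => g a b) u v z t +
      kulkarniNomizu (T u) (fun a b => g a b) v w z t +
      kulkarniNomizu (T v) (fun a b => g a b) w u z t
      K n₁ m₂ = 0 ∧ K n₂ m₁ = 0 ∧ K n₁ m₁ = K n₂ m₂) :
    (∀ z ∈ ({n₁, n₂, m₁, m₂} : Set E), T n₁ m₂ z = T m₂ n₁ z ∧ T n₂ m₁ z = T m₁ n₂ z ∧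
      T n₁ m₁ z - T m₁ n₁ z = T n₂ m₂ z - T m₂ n₂ z) := by
  -- The four triples of distinct frame vectors give twelve linear equations, matching the twelve
  -- identities claimed.
  have a₁ := hK n₁ n₂ m₁
  have a₂ := hK n₁ n₂ m₂
  have a₃ := hK n₁ m₁ m₂
  have a₄ := hK n₂ m₁ m₂
  simp only [kulkarniNomizu, hg m₁ n₁, hg m₂ n₁, hg m₁ n₂, hg m₂ n₂, hg n₂ n₁, hg m₂ m₁,
    hfr.n₁n₁, hfr.n₁n₂, hfr.n₁m₁, hfr.n₁m₂, hfr.n₂n₂, hfr.n₂m₁, hfr.n₂m₂, hfr.m₁m₁, hfr.m₁m₂,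
    hfr.m₂m₂, mul_zero, mul_one, add_zero, sub_zero, zero_add, zero_sub] at a₁ a₂ a₃ a₄
  have s := fun w => (⟨hT w n₂ n₁, hT w m₁ n₁, hT w m₂ n₁, hT w m₁ n₂, hT w m₂ n₂, hT w m₂ m₁⟩ :
    _ ∧ _ ∧ _ ∧ _ ∧ _ ∧ _)
  obtain ⟨p₁, p₂, p₃, p₄, p₅, p₆⟩ := s n₁
  obtain ⟨q₁, q₂, q₃, q₄, q₅, q₆⟩ := s n₂
  obtain ⟨r₁, r₂, r₃, r₄, r₅, r₆⟩ := s m₁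
  obtain ⟨t₁, t₂, t₃, t₄, t₅, t₆⟩ := s m₂
  obtain ⟨a₁, b₁, c₁⟩ := a₁
  obtain ⟨a₂, b₂, c₂⟩ := a₂
  obtain ⟨a₃, b₃, c₃⟩ := a₃
  obtain ⟨a₄, b₄, c₄⟩ := a₄
  rintro z (rfl | rfl | rfl | rfl) <;> refine ⟨?_, ?_, ?_⟩ <;> linarith

/-- The Schouten type tensor `½ (ψ g + μ dF ⊗ dF - Hes_F)`. -/
def schoutenForm (B : E → E →L[ℝ] E →L[ℝ] ℝ) (Γ : E → E →L[ℝ] E →L[ℝ] E) (F ψ : E → ℝ) (μ : ℝ)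
    (x : E) : E →L[ℝ] E →L[ℝ] ℝ :=
  (1 / 2 : ℝ) • (ψ x • B x + μ • (fderiv ℝ F x).smulRight (fderiv ℝ F x) - hessForm Γ F x)

theorem schoutenForm_apply (B : E → E →L[ℝ] E →L[ℝ] ℝ) (Γ : E → E →L[ℝ] E →L[ℝ] E) (F ψ : E → ℝ)
    (μ : ℝ) (x u v : E) :
    schoutenForm B Γ F ψ μ x u v = (1 / 2 : ℝ) * (ψ x * B x u v
      + μ * (fderiv ℝ F x u * fderiv ℝ F x v) - hessForm Γ F x u v) := by
  simp [schoutenForm]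

namespace IsLeviCivita

variable {U : Set E} {B : E → E →L[ℝ] E →L[ℝ] ℝ} {Γ : E → E →L[ℝ] E →L[ℝ] E}
  (h : IsLeviCivita U B Γ) {x : E} {F ψ : E → ℝ} {μ : ℝ}

include h

theorem hessForm_symm (hF : ContDiffOn ℝ ∞ F U) (hx : x ∈ U) (u v : E) :
    hessForm Γ F x u v = hessForm Γ F x v u := by
  simp only [hessForm_apply]
  rw [h.torsion_free x hx u v,
    (hF.contDiffAt (h.isOpen.mem_nhds hx)).isSymmSndFDerivAt minSmoothness_two_le u v]

theorem schoutenForm_symm (hF : ContDiffOn ℝ ∞ F U) (hx : x ∈ U) (u v : E) :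
    schoutenForm B Γ F ψ μ x u v = schoutenForm B Γ F ψ μ x v u := by
  simp only [schoutenForm_apply]
  rw [h.symm x hx u v, h.hessForm_symm hF hx u v]
  ring

theorem hasFDerivAt_hessForm (hF : ContDiffOn ℝ ∞ F U) (hx : x ∈ U) :
    ∃ L : E →L[ℝ] E →L[ℝ] E →L[ℝ] ℝ, HasFDerivAt (hessForm Γ F) L x ∧
      ∀ w u v, L w u v = fderiv ℝ (fderiv ℝ (fderiv ℝ F)) x w u v
        - fderiv ℝ (fderiv ℝ F) x w (Γ x u v) - fderiv ℝ F x (fderiv ℝ Γ x w u v) := by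
  have hFx := hF.contDiffAt (h.isOpen.mem_nhds hx)
  have h1 : ContDiffAt ℝ ∞ (fderiv ℝ F) x := hFx.fderiv_right (by simp)
  have h2 : ContDiffAt ℝ ∞ (fderiv ℝ (fderiv ℝ F)) x := h1.fderiv_right (by simp)
  have d1 := (h1.differentiableAt (by simp)).hasFDerivAt
  have d2 := (h2.differentiableAt (by simp)).hasFDerivAt
  refine ⟨_, d2.sub (((ContinuousLinearMap.compL ℝ E E ℝ).hasFDerivAt.comp x d1).clm_comp
    (h.hasFDerivAt_conn hx)), fun w u v => ?_⟩
  simp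
  ring

/-- The Ricci identity for the differential of a function. -/
theorem covForm_hessForm_sub (hF : ContDiffOn ℝ ∞ F U) (hx : x ∈ U) (w u v : E) :
    covForm Γ (hessForm Γ F) x w u v - covForm Γ (hessForm Γ F) x u w v =
      -fderiv ℝ F x (riem Γ x w u v) := by
  obtain ⟨L, hL, hL'⟩ := h.hasFDerivAt_hessForm hF hx
  have hFx := hF.contDiffAt (h.isOpen.mem_nhds hx)
  have h1 : ContDiffAt ℝ ∞ (fderiv ℝ F) x := hFx.fderiv_right (by simp)
  have s1 := h1.isSymmSndFDerivAt minSmoothness_two_le w u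
  have s2 := hFx.isSymmSndFDerivAt minSmoothness_two_le
  simp only [covForm, hL.fderiv, hL', riem, hessForm_apply, map_sub, map_add]
  rw [s1, s2 w (Γ x u v), s2 u (Γ x w v), s2 _ w, s2 _ u, h.torsion_free x hx w u]
  ring

/-- The metric is parallel, so only `ψ` is differentiated in its summand, while `dF ⊗ dF` produces
the two terms linear in the Hessian. -/
theorem covForm_schoutenForm (hF : ContDiffOn ℝ ∞ F U) (hψ : DifferentiableAt ℝ ψ x) (hx : x ∈ U)
    (w u v : E) :
    2 * covForm Γ (schoutenForm B Γ F ψ μ) x w u v = fderiv ℝ ψ x w * B x u v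
      + μ * (hessForm Γ F x w u * fderiv ℝ F x v + fderiv ℝ F x u * hessForm Γ F x w v)
      - covForm Γ (hessForm Γ F) x w u v := by
  obtain ⟨L, hL, hL'⟩ := h.hasFDerivAt_hessForm hF hx
  have hFx := hF.contDiffAt (h.isOpen.mem_nhds hx)
  have h1 : ContDiffAt ℝ ∞ (fderiv ℝ F) x := hFx.fderiv_right (by simp)
  have d1 := (h1.differentiableAt (by simp)).hasFDerivAt
  have e1 := ((hψ.hasFDerivAt.mul ((h.hasFDerivAt_metric hx).clm_apply
    (hasFDerivAt_const u x) |>.clm_apply (hasFDerivAt_const v x))))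
  have e2 := ((d1.clm_apply (hasFDerivAt_const u x)).mul
    (d1.clm_apply (hasFDerivAt_const v x))).const_mul μ
  have e3 := (hL.clm_apply (hasFDerivAt_const u x)).clm_apply (hasFDerivAt_const v x)
  have e4 := ((e1.add e2).sub e3).const_mul (1 / 2 : ℝ)
  have hd : DifferentiableAt ℝ (schoutenForm B Γ F ψ μ) x := by
    have a1 := hψ.smul (h.hasFDerivAt_metric hx).differentiableAt
    have a2 : DifferentiableAt ℝ (fun y => (fderiv ℝ F y).smulRight (fderiv ℝ F y)) x :=
      (((ContinuousLinearMap.smulRightL ℝ E (E →L[ℝ] ℝ)).hasFDerivAt.comp x d1).clm_apply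
        d1).differentiableAt
    exact ((a1.add (a2.const_smul μ)).sub hL.differentiableAt).const_smul (1 / 2 : ℝ)
  have e5 := (hd.hasFDerivAt.clm_apply (hasFDerivAt_const u x)).clm_apply (hasFDerivAt_const v x)
  have e6 : (fun y => schoutenForm B Γ F ψ μ y u v) = fun y => (1 / 2 : ℝ) * (ψ y * B y u v
      + μ * (fderiv ℝ F y u * fderiv ℝ F y v) - hessForm Γ F y u v) := by
    funext y
    exact schoutenForm_apply B Γ F ψ μ y u v
  rw [e6] at e5
  have e7 := congrArg (fun L => L w) (e5.unique e4)
  simp at e7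
  simp only [covForm, e7, schoutenForm_apply, hL.fderiv, h.compat x hx]
  simp only [hessForm_apply]
  ring

theorem differentiableAt_schoutenForm (hF : ContDiffOn ℝ ∞ F U) (hψ : DifferentiableAt ℝ ψ x)
    (hx : x ∈ U) : DifferentiableAt ℝ (schoutenForm B Γ F ψ μ) x := by
  obtain ⟨L, hL, -⟩ := h.hasFDerivAt_hessForm hF hx
  have hFx := hF.contDiffAt (h.isOpen.mem_nhds hx)
  have h1 : ContDiffAt ℝ ∞ (fderiv ℝ F) x := hFx.fderiv_right (by simp)
  have d1 := (h1.differentiableAt (by simp)).hasFDerivAt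
  have a1 := hψ.smul (h.hasFDerivAt_metric hx).differentiableAt
  have a2 : DifferentiableAt ℝ (fun y => (fderiv ℝ F y).smulRight (fderiv ℝ F y)) x :=
    (((ContinuousLinearMap.smulRightL ℝ E (E →L[ℝ] ℝ)).hasFDerivAt.comp x d1).clm_apply
      d1).differentiableAt
  exact ((a1.add (a2.const_smul μ)).sub hL.differentiableAt).const_smul (1 / 2 : ℝ)

/-- The Hessian is the covariant derivative of the gradient. -/
theorem inner_cov_grad (hF : ContDiffOn ℝ ∞ F U) {n : E → E} (hn : DifferentiableAt ℝ n x)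
    (hgrad : ∀ y ∈ U, ∀ v, B y (n y) v = fderiv ℝ F y v) (hx : x ∈ U) (w v : E) :
    B x (fderiv ℝ n x w + Γ x w (n x)) v = hessForm Γ F x w v := by
  have hFx := hF.contDiffAt (h.isOpen.mem_nhds hx)
  have h1 : ContDiffAt ℝ ∞ (fderiv ℝ F) x := hFx.fderiv_right (by simp)
  have d1 := (h1.differentiableAt (by simp)).hasFDerivAt.clm_apply (hasFDerivAt_const v x)
  obtain ⟨L, hL, hL'⟩ := h.hasFDerivAt_inner hx hn.hasFDerivAt (hasFDerivAt_const v x)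
  have h2 : (fun y => B y (n y) v) =ᶠ[𝓝 x] fun y => fderiv ℝ F y v := by
    filter_upwards [h.isOpen.mem_nhds hx] with y hy using hgrad y hy v
  have h3 := congrArg (fun L => L w) (hL.unique (d1.congr_of_eventuallyEq h2))
  simp [hL', hgrad x hx] at h3
  rw [hessForm_apply]
  simp only [map_add, add_apply]
  linarith

/-- If the gradient is null then it is in the kernel of the Hessian. -/
theorem hessForm_grad_eq_zero (hF : ContDiffOn ℝ ∞ F U) {n : E → E} (hn : DifferentiableAt ℝ n x)
    (hgrad : ∀ y ∈ U, ∀ v, B y (n y) v = fderiv ℝ F y v) (hnull : ∀ y ∈ U, B y (n y) (n y) = 0)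
    (hx : x ∈ U) (w : E) : hessForm Γ F x w (n x) = 0 := by
  obtain ⟨L, hL, hL'⟩ := h.hasFDerivAt_inner hx hn.hasFDerivAt hn.hasFDerivAt
  have h2 : (fun y => B y (n y) (n y)) =ᶠ[𝓝 x] fun _ => 0 := by
    filter_upwards [h.isOpen.mem_nhds hx] with y hy using hnull y hy
  have h3 := congrArg (fun L => L w)
    (hL.unique ((hasFDerivAt_const (0 : ℝ) x).congr_of_eventuallyEq h2))
  simp only [hL', zero_apply] at h3
  rw [h.symm x hx (n x), h.inner_cov_grad hF hn hgrad hx] at h3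
  linarith

end IsLeviCivita

/-- The data of a self-dual generalized quasi-Einstein metric with null gradient on an open set, in
terms of a null frame which contains the gradient. -/
structure IsIsotropicSelfDual (U : Set E) (B : E → E →L[ℝ] E →L[ℝ] ℝ)
    (Γ : E → E →L[ℝ] E →L[ℝ] E) (F lam ψ : E → ℝ) (μ : ℝ) (n₁ n₂ m₁ m₂ : E → E) : Prop extends
    IsLeviCivita U B Γ where
  smooth_potential : ContDiffOn ℝ ∞ F U
  smooth_lam : ContDiffOn ℝ ∞ lam U
  smooth_ψ : ContDiffOn ℝ ∞ ψ U
  smooth_n₁ : ContDiffOn ℝ ∞ n₁ U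
  smooth_n₂ : ContDiffOn ℝ ∞ n₂ U
  smooth_m₁ : ContDiffOn ℝ ∞ m₁ U
  smooth_m₂ : ContDiffOn ℝ ∞ m₂ U
  frame : ∀ y ∈ U, IsNullFrame (B y) (n₁ y) (n₂ y) (m₁ y) (m₂ y)
  grad : ∀ y ∈ U, ∀ v, B y (n₁ y) v = fderiv ℝ F y v
  trace : ∀ y ∈ U, 3 * ψ y = lam y + hessForm Γ F y (n₁ y) (m₁ y) + hessForm Γ F y (n₂ y) (m₂ y)
  selfDual : ∀ y ∈ U, VanishesOnAntiSelfDual (weylForm B Γ (schoutenForm B Γ F ψ μ) y)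
    (n₁ y) (n₂ y) (m₁ y) (m₂ y)

namespace IsIsotropicSelfDual

variable {U : Set E} {B : E → E →L[ℝ] E →L[ℝ] ℝ} {Γ : E → E →L[ℝ] E →L[ℝ] E} {F lam ψ : E → ℝ}
  {μ : ℝ} {n₁ n₂ m₁ m₂ : E → E} (h : IsIsotropicSelfDual U B Γ F lam ψ μ n₁ n₂ m₁ m₂) {x : E}

include h

theorem differentiableAt_of_contDiffOn {G : Type*} [NormedAddCommGroup G] [NormedSpace ℝ G]
    {f : E → G} (hf : ContDiffOn ℝ ∞ f U) (hx : x ∈ U) : DifferentiableAt ℝ f x :=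
  (hf.contDiffAt (h.isOpen.mem_nhds hx)).differentiableAt (by simp)

theorem hessForm_n₁ (hx : x ∈ U) (w : E) : hessForm Γ F x w (n₁ x) = 0 :=
  h.toIsLeviCivita.hessForm_grad_eq_zero h.smooth_potential
    (h.differentiableAt_of_contDiffOn h.smooth_n₁ hx) h.grad (fun y hy => (h.frame y hy).n₁n₁) hx w

-- The antisymmetrised covariant derivative of the Schouten tensor is evaluated on the
-- anti-self-dual bivectors in two ways: it vanishes by the Bianchi identity, and the Ricci identity
-- rewrites it algebraically in `dψ`, `μ` and the Hessian. The comparison is a linear system in the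
-- frame components, in which `n₂` enters through `(μ + ½) H(n₂, ·)`.
set_option linter.unusedSimpArgs false in
set_option maxHeartbeats 800000 in
theorem fderiv_ψ_and_hessForm (hμ : μ ≠ -(1 / 2)) (hx : x ∈ U) :
    (∀ w, fderiv ℝ ψ x w = -ψ x * fderiv ℝ F x w) ∧ ∀ w, hessForm Γ F x w (n₂ x) = 0 := by
  have hLC := h.toIsLeviCivita
  have hF := h.smooth_potential
  have hP : ∀ y ∈ U, ∀ u v, schoutenForm B Γ F ψ μ y u v = schoutenForm B Γ F ψ μ y v u :=
    fun y hy u v => hLC.schoutenForm_symm hF hy u v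
  have hPd : ∀ y ∈ U, DifferentiableAt ℝ (schoutenForm B Γ F ψ μ) y := fun y hy =>
    hLC.differentiableAt_schoutenForm hF (h.differentiableAt_of_contDiffOn h.smooth_ψ hy) hy
  have hK := hLC.kulkarniNomizu_cyclic hPd hP
    (fun y hy => h.differentiableAt_of_contDiffOn h.smooth_n₁ hy)
    (fun y hy => h.differentiableAt_of_contDiffOn h.smooth_n₂ hy)
    (fun y hy => h.differentiableAt_of_contDiffOn h.smooth_m₁ hy)
    (fun y hy => h.differentiableAt_of_contDiffOn h.smooth_m₂ hy) h.frame h.selfDual hx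
  have hψ := h.differentiableAt_of_contDiffOn h.smooth_ψ hx
  have hcov := hLC.covForm_schoutenForm (μ := μ) hF hψ hx
  have hH := hLC.hessForm_symm hF hx
  have hric := hLC.covForm_hessForm_sub hF hx
  have hcovs : ∀ w u v, covForm Γ (schoutenForm B Γ F ψ μ) x w u v =
      covForm Γ (schoutenForm B Γ F ψ μ) x w v u := by
    intro w u v
    have h1 := congrArg (fun L : E →L[ℝ] ℝ => L w) (Filter.EventuallyEq.fderiv_eq
      (show (fun y => schoutenForm B Γ F ψ μ y u v) =ᶠ[𝓝 x]
        fun y => schoutenForm B Γ F ψ μ y v u by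
        filter_upwards [h.isOpen.mem_nhds hx] with y hy using hP y hy u v))
    have h2 : ∀ a b, fderiv ℝ (fun y => schoutenForm B Γ F ψ μ y a b) x w =
        fderiv ℝ (schoutenForm B Γ F ψ μ) x w a b := by
      intro a b
      rw [(((hPd x hx).hasFDerivAt.clm_apply (hasFDerivAt_const a x)).clm_apply
        (hasFDerivAt_const b x)).fderiv]
      simp
    simp only [h2] at h1
    simp only [covForm, h1, hP x hx (Γ x w u) v, hP x hx u (Γ x w v)]
    ring
  have hfr := h.frame x hx
  have hg := hLC.symm x hx
  have hC := hfr.cotton_eq_zero hg hcovs hK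
  have hW := h.selfDual x hx
  -- The Ricci identity contributes `dF(R(u,v)z)`, which skew symmetry turns into the curvature
  -- applied to `n₁`. That is then split into its Weyl part and its Kulkarni-Nomizu part.
  have key : ∀ u v z, 2 * (covForm Γ (schoutenForm B Γ F ψ μ) x u v z
      - covForm Γ (schoutenForm B Γ F ψ μ) x v u z) =
      fderiv ℝ ψ x u * B x v z - fderiv ℝ ψ x v * B x u z
      + μ * (fderiv ℝ F x v * hessForm Γ F x u z - fderiv ℝ F x u * hessForm Γ F x v z)
      + (weylForm B Γ (schoutenForm B Γ F ψ μ) x u v (n₁ x) z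
        + kulkarniNomizu (fun a b => schoutenForm B Γ F ψ μ x a b) (fun a b => B x a b)
          u v (n₁ x) z) := by
    intro u v z
    have h1 := hLC.inner_riem_self hx u v (n₁ x) z
    have h2 := h.grad x hx (riem Γ x u v z)
    have h3 := hric u v z
    have h4 := hcov u v z
    have h5 := hcov v u z
    rw [hH v u] at h5
    simp only [weylForm]
    linarith
  have d₁ : fderiv ℝ F x (n₁ x) = 0 := by rw [← h.grad x hx, hfr.n₁n₁]
  have d₂ : fderiv ℝ F x (n₂ x) = 0 := by rw [← h.grad x hx, hfr.n₁n₂]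
  have d₃ : fderiv ℝ F x (m₁ x) = 1 := by rw [← h.grad x hx, hfr.n₁m₁]
  have d₄ : fderiv ℝ F x (m₂ x) = 0 := by rw [← h.grad x hx, hfr.n₁m₂]
  have hn := h.hessForm_n₁ hx
  have hn' : ∀ w, hessForm Γ F x (n₁ x) w = 0 := fun w => by rw [hH, hn]
  have kn₁ := fun z => key (n₁ x) (m₂ x) z
  have kn₂ := fun z => key (n₂ x) (m₁ x) z
  have kd₁ := fun z => key (n₁ x) (m₁ x) z
  have kd₂ := fun z => key (n₂ x) (m₂ x) z
  simp only [hW.n₁m₂, hW.n₂m₁, hW.diag, kulkarniNomizu, schoutenForm_apply, d₁, d₂, d₃, d₄, hn,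
    hn', hfr.n₁n₁, hfr.n₁n₂, hfr.n₁m₁, hfr.n₁m₂, hfr.n₂n₂, hfr.n₂m₁, hfr.n₂m₂, hfr.m₁m₁, hfr.m₁m₂,
    hfr.m₂m₂, hg (m₁ x) (n₁ x), hg (m₂ x) (n₁ x), hg (m₁ x) (n₂ x), hg (m₂ x) (n₂ x),
    hg (n₂ x) (n₁ x), hg (m₂ x) (m₁ x)] at kn₁ kn₂ kd₁ kd₂
  have c₁ := hC (n₁ x) (by simp)
  have c₂ := hC (n₂ x) (by simp)
  have c₃ := hC (m₁ x) (by simp)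
  have c₄ := hC (m₂ x) (by simp)
  have k₁₃ := kn₁ (m₁ x)
  have k₁₂ := kn₁ (n₂ x)
  have k₂₁ := kn₂ (n₁ x)
  have k₂₂ := kn₂ (n₂ x)
  have k₂₃ := kn₂ (m₁ x)
  have k₂₄ := kn₂ (m₂ x)
  have ka₃ := kd₁ (m₁ x)
  have kb₃ := kd₂ (m₁ x)
  have ka₁ := kd₁ (n₁ x)
  have kb₁ := kd₂ (n₁ x)
  simp only [hn, hn', hfr.n₁n₁, hfr.n₁n₂, hfr.n₁m₁, hfr.n₁m₂, hfr.n₂n₂, hfr.n₂m₁, hfr.n₂m₂,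
    hfr.m₁m₁, hfr.m₁m₂, hfr.m₂m₂, hg (m₁ x) (n₁ x), hg (m₂ x) (n₁ x), hg (m₁ x) (n₂ x),
    hg (m₂ x) (n₂ x), hg (n₂ x) (n₁ x), hg (m₂ x) (m₁ x), hH (m₁ x) (n₂ x), hH (m₂ x) (n₂ x),
    hH (m₂ x) (m₁ x), d₁, d₂, d₃, d₄]
    at k₁₂ k₁₃ k₂₁ k₂₂ k₂₃ k₂₄ ka₃ kb₃ ka₁ kb₁
  have p₁ : fderiv ℝ ψ x (n₁ x) = 0 := by linarith
  have p₂ : fderiv ℝ ψ x (n₂ x) = 0 := by linarith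
  have p₄ : fderiv ℝ ψ x (m₂ x) = 0 := by linarith
  have p₃ : fderiv ℝ ψ x (m₁ x) = -ψ x := by linarith
  -- The coefficient has two sources: `μ` from differentiating `dF ⊗ dF`, and `½` from the Hessian
  -- inside `P` in the curvature term.
  have hκ : μ + 1 / 2 ≠ 0 := fun h0 => hμ (by linarith)
  have q₂ : hessForm Γ F x (n₂ x) (n₂ x) = 0 :=
    (mul_eq_zero.1 (by linarith : (μ + 1 / 2) * hessForm Γ F x (n₂ x) (n₂ x) = 0)).resolve_left hκ
  have q₃ : hessForm Γ F x (n₂ x) (m₁ x) = 0 :=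
    (mul_eq_zero.1 (by linarith : (μ + 1 / 2) * hessForm Γ F x (n₂ x) (m₁ x) = 0)).resolve_left hκ
  have q₄ : hessForm Γ F x (n₂ x) (m₂ x) = 0 :=
    (mul_eq_zero.1 (by linarith : (μ + 1 / 2) * hessForm Γ F x (n₂ x) (m₂ x) = 0)).resolve_left hκ
  constructor
  · intro w
    rw [hfr.expand w]
    simp only [map_add, map_smul, smul_eq_mul, p₁, p₂, p₃, p₄, d₁, d₂, d₃, d₄]
    ring
  · intro w
    rw [hH, hfr.expand w]
    simp only [map_add, map_smul, smul_eq_mul, q₂, q₃, q₄, hn]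
    ring

/-- The Hessian terms in `trace` vanish once `n₁` and `n₂` are known to be in its kernel. -/
theorem three_mul_ψ (hμ : μ ≠ -(1 / 2)) (hx : x ∈ U) : 3 * ψ x = lam x := by
  have hH := h.toIsLeviCivita.hessForm_symm h.smooth_potential hx
  rw [h.trace x hx, hH (n₁ x), h.hessForm_n₁ hx, hH (n₂ x), (h.fderiv_ψ_and_hessForm hμ hx).2]
  ring

/-- Since `λ = 3ψ`, this is the equation for `dψ`. It says that `λ e^F` is locally constant, and it
excludes nonzero constant `λ`. -/
theorem fderiv_lam (hμ : μ ≠ -(1 / 2)) (hx : x ∈ U) (w : E) :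
    fderiv ℝ lam x w = -lam x * fderiv ℝ F x w := by
  have h1 : lam =ᶠ[𝓝 x] fun y => 3 * ψ y := by
    filter_upwards [h.isOpen.mem_nhds hx] with y hy using (h.three_mul_ψ hμ hy).symm
  rw [h1.fderiv_eq, fderiv_const_mul (h.differentiableAt_of_contDiffOn h.smooth_ψ hx),
    ← h.three_mul_ψ hμ hx]
  simp [(h.fderiv_ψ_and_hessForm hμ hx).1]
  ring

/-- The plane field spanned by `n₁` and `n₂` is parallel. -/
theorem parallel (hμ : μ ≠ -(1 / 2)) (hx : x ∈ U) (w : E) :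
    (B x (fderiv ℝ n₁ x w + Γ x w (n₁ x)) (n₁ x) = 0 ∧
      B x (fderiv ℝ n₁ x w + Γ x w (n₁ x)) (n₂ x) = 0) ∧
    B x (fderiv ℝ n₂ x w + Γ x w (n₂ x)) (n₁ x) = 0 ∧
      B x (fderiv ℝ n₂ x w + Γ x w (n₂ x)) (n₂ x) = 0 := by
  have hn := h.differentiableAt_of_contDiffOn h.smooth_n₁ hx
  have hn2 := h.differentiableAt_of_contDiffOn h.smooth_n₂ hx
  have a := h.toIsLeviCivita.inner_cov_grad h.smooth_potential hn h.grad hx w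
  have a₂ : B x (fderiv ℝ n₁ x w + Γ x w (n₁ x)) (n₂ x) = 0 := by
    rw [a, (h.fderiv_ψ_and_hessForm hμ hx).2]
  have sc : ∀ {Y : E → E}, DifferentiableAt ℝ Y x → (∀ y ∈ U, B y (n₂ y) (Y y) = 0) →
      B x (fderiv ℝ n₂ x w + Γ x w (n₂ x)) (Y x) +
        B x (n₂ x) (fderiv ℝ Y x w + Γ x w (Y x)) = 0 := by
    intro Y hY hc
    obtain ⟨L, hL, hL'⟩ := h.toIsLeviCivita.hasFDerivAt_inner hx hn2.hasFDerivAt hY.hasFDerivAt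
    have h2 : (fun y => B y (n₂ y) (Y y)) =ᶠ[𝓝 x] fun _ => 0 := by
      filter_upwards [h.isOpen.mem_nhds hx] with y hy using hc y hy
    have h3 := congrArg (fun L => L w)
      (hL.unique ((hasFDerivAt_const (0 : ℝ) x).congr_of_eventuallyEq h2))
    simpa only [hL', zero_apply] using h3
  have b₁ := sc hn (fun y hy => by rw [h.symm y hy, (h.frame y hy).n₁n₂])
  have b₂ := sc hn2 (fun y hy => (h.frame y hy).n₂n₂)
  rw [h.symm x hx (n₂ x), a₂] at b₁
  rw [h.symm x hx (n₂ x)] at b₂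
  refine ⟨⟨by rw [a, h.hessForm_n₁ hx], a₂⟩, by linarith, by linarith⟩

end IsIsotropicSelfDual

end


/-! ### Curvature along the parallel plane field, and flow-out of a slice -/

noncomputable section

set_option maxSynthPendingDepth 3

theorem weylForm_add_left {E : Type*} [NormedAddCommGroup E] [NormedSpace ℝ E]
    (B : E → E →L[ℝ] E →L[ℝ] ℝ) (Γ : E → E →L[ℝ] E →L[ℝ] E)
    (P : E → E →L[ℝ] E →L[ℝ] ℝ) (x u u' v z t : E) :
    weylForm B Γ P x (u + u') v z t = weylForm B Γ P x u v z t + weylForm B Γ P x u' v z t := by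
  simp only [weylForm, kulkarniNomizu, map_add, riem_add_left, add_apply]; ring

theorem weylForm_smul_left {E : Type*} [NormedAddCommGroup E] [NormedSpace ℝ E]
    (B : E → E →L[ℝ] E →L[ℝ] ℝ) (Γ : E → E →L[ℝ] E →L[ℝ] E)
    (P : E → E →L[ℝ] E →L[ℝ] ℝ) (x u v z t : E) (c : ℝ) :
    weylForm B Γ P x (c • u) v z t = c * weylForm B Γ P x u v z t := by
  simp only [weylForm, kulkarniNomizu, map_smul, riem_smul_left, smul_apply, smul_eq_mul]; ring

theorem weylForm_add_middle {E : Type*} [NormedAddCommGroup E] [NormedSpace ℝ E]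
    (B : E → E →L[ℝ] E →L[ℝ] ℝ) (Γ : E → E →L[ℝ] E →L[ℝ] E)
    (P : E → E →L[ℝ] E →L[ℝ] ℝ) (x u v v' z t : E) :
    weylForm B Γ P x u (v + v') z t = weylForm B Γ P x u v z t + weylForm B Γ P x u v' z t := by
  simp only [weylForm, kulkarniNomizu, map_add, riem_add_middle, add_apply]; ring

theorem weylForm_smul_middle {E : Type*} [NormedAddCommGroup E] [NormedSpace ℝ E]
    (B : E → E →L[ℝ] E →L[ℝ] ℝ) (Γ : E → E →L[ℝ] E →L[ℝ] E)
    (P : E → E →L[ℝ] E →L[ℝ] ℝ) (x u v z t : E) (c : ℝ) :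
    weylForm B Γ P x u (c • v) z t = c * weylForm B Γ P x u v z t := by
  simp only [weylForm, kulkarniNomizu, map_smul, riem_smul_middle, smul_apply, smul_eq_mul]; ring

/-- The null plane spanned by `n₁, n₂` is its own orthogonal complement. Membership in the plane
field is therefore expressed throughout by orthogonality to `n₁` and `n₂`. -/
theorem IsNullFrame.expand_plane {E : Type*} [NormedAddCommGroup E] [NormedSpace ℝ E]
    {g : E →L[ℝ] E →L[ℝ] ℝ} {n₁ n₂ m₁ m₂ : E} (hfr : IsNullFrame g n₁ n₂ m₁ m₂) {d : E}
    (h₁ : g d n₁ = 0) (h₂ : g d n₂ = 0) : d = g d m₁ • n₁ + g d m₂ • n₂ := by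
  conv_lhs => rw [hfr.expand d]
  simp [h₁, h₂]

theorem IsNullFrame.inner_plane {E : Type*} [NormedAddCommGroup E] [NormedSpace ℝ E]
    {g : E →L[ℝ] E →L[ℝ] ℝ} {n₁ n₂ m₁ m₂ : E} (hfr : IsNullFrame g n₁ n₂ m₁ m₂)
    (hg : ∀ u v, g u v = g v u) {d d' : E} (h₁ : g d n₁ = 0) (h₂ : g d n₂ = 0) (h₁' : g d' n₁ = 0)
    (h₂' : g d' n₂ = 0) : g d d' = 0 := by
  rw [hfr.expand_plane h₁ h₂]
  simp [hg _ d', h₁', h₂']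

namespace IsIsotropicSelfDual

variable {E : Type*} [NormedAddCommGroup E] [NormedSpace ℝ E]
  {U : Set E} {B : E → E →L[ℝ] E →L[ℝ] ℝ} {Γ : E → E →L[ℝ] E →L[ℝ] E} {F lam ψ : E → ℝ}
  {μ : ℝ} {n₁ n₂ m₁ m₂ : E → E} (h : IsIsotropicSelfDual U B Γ F lam ψ μ n₁ n₂ m₁ m₂) {x : E}

include h

/-- The covariant derivatives of a vector field in the plane field remain in the plane field. -/
theorem cov_mem_plane (hμ : μ ≠ -(1 / 2)) {Z : E → E} {V : Set E} (hV : IsOpen V) (hVU : V ⊆ U)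
    (hx : x ∈ V) (hZ : DifferentiableAt ℝ Z x)
    (hZ₁ : ∀ y ∈ V, B y (Z y) (n₁ y) = 0) (hZ₂ : ∀ y ∈ V, B y (Z y) (n₂ y) = 0) (w : E) :
    B x (fderiv ℝ Z x w + Γ x w (Z x)) (n₁ x) = 0 ∧
      B x (fderiv ℝ Z x w + Γ x w (Z x)) (n₂ x) = 0 := by
  have hxU := hVU hx
  have sc : ∀ {Y : E → E}, DifferentiableAt ℝ Y x → (∀ y ∈ V, B y (Z y) (Y y) = 0) →
      B x (fderiv ℝ Z x w + Γ x w (Z x)) (Y x) +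
        B x (Z x) (fderiv ℝ Y x w + Γ x w (Y x)) = 0 := by
    intro Y hY hc
    obtain ⟨L, hL, hL'⟩ := h.toIsLeviCivita.hasFDerivAt_inner hxU hZ.hasFDerivAt hY.hasFDerivAt
    have h2 : (fun y => B y (Z y) (Y y)) =ᶠ[𝓝 x] fun _ => 0 := by
      filter_upwards [hV.mem_nhds hx] with y hy using hc y hy
    have h3 := congrArg (fun L => L w)
      (hL.unique ((hasFDerivAt_const (0 : ℝ) x).congr_of_eventuallyEq h2))
    simpa only [hL', zero_apply] using h3
  have b₁ := sc (h.differentiableAt_of_contDiffOn h.smooth_n₁ hxU) hZ₁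
  have b₂ := sc (h.differentiableAt_of_contDiffOn h.smooth_n₂ hxU) hZ₂
  obtain ⟨⟨p₁, p₂⟩, p₃, p₄⟩ := h.parallel hμ hxU w
  rw [(h.frame x hxU).inner_plane (h.symm x hxU) (hZ₁ x hx) (hZ₂ x hx) p₁ p₂, add_zero] at b₁
  rw [(h.frame x hxU).inner_plane (h.symm x hxU) (hZ₁ x hx) (hZ₂ x hx) p₃ p₄, add_zero] at b₂
  exact ⟨b₁, b₂⟩

/-- The plane field is parallel, so the curvature maps `n₁` into it, and the plane is null.
Concretely, `∇ n₁` takes values in the plane, so does its covariant derivative, and antisymmetrising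
two directions gives the curvature. -/
theorem inner_riem_n₁_n₂ (hμ : μ ≠ -(1 / 2)) (hx : x ∈ U) (u v : E) :
    B x (riem Γ x u v (n₁ x)) (n₂ x) = 0 := by
  have hUo := h.isOpen
  have c1 := h.smooth_n₁.contDiffAt (hUo.mem_nhds hx)
  have d1 : ContDiffAt ℝ ∞ (fderiv ℝ n₁) x := c1.fderiv_right (by simp)
  have hd := (d1.differentiableAt (by simp)).hasFDerivAt
  have hcov : ∀ a, HasFDerivAt (fun y => fderiv ℝ n₁ y a + Γ y a (n₁ y)) _ x := fun a =>
    (hd.clm_apply (hasFDerivAt_const a x)).add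
      (((h.hasFDerivAt_conn hx).clm_apply (hasFDerivAt_const a x)).clm_apply
        (c1.differentiableAt (by simp)).hasFDerivAt)
  have key : ∀ a b, B x (fderiv ℝ (fun y => fderiv ℝ n₁ y a + Γ y a (n₁ y)) x b
      + Γ x b (fderiv ℝ n₁ x a + Γ x a (n₁ x))) (n₂ x) = 0 := fun a b =>
    (h.cov_mem_plane hμ hUo subset_rfl hx (hcov a).differentiableAt
      (fun y hy => (h.parallel hμ hy a).1.1) (fun y hy => (h.parallel hμ hy a).1.2) b).2
  have k1 := key v u
  have k2 := key u v
  rw [(hcov _).fderiv] at k1 k2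
  simp at k1 k2
  have hs := c1.isSymmSndFDerivAt minSmoothness_two_le u v
  rw [hs] at k1
  simp only [riem, map_sub, map_add, sub_apply, add_apply]
  linarith

theorem fderiv_plane (hx : x ∈ U) {d : E} (h₁ : B x d (n₁ x) = 0) : fderiv ℝ F x d = 0 := by
  rw [← h.grad x hx, h.symm x hx, h₁]

/-- The curvature on the plane field. -/
theorem inner_riem_plane (hμ : μ ≠ -(1 / 2)) (hx : x ∈ U) {d v d' v' : E}
    (hd₁ : B x d (n₁ x) = 0) (hd₂ : B x d (n₂ x) = 0) (hd₁' : B x d' (n₁ x) = 0)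
    (hd₂' : B x d' (n₂ x) = 0) (hv : B x d v = 0) (hv' : B x d' v' = 0) :
    B x (riem Γ x d v d') v' = ψ x * (B x d v' * B x v d') := by
  have hLC := h.toIsLeviCivita
  have hfr := h.frame x hx
  have hg := h.symm x hx
  have hP := fun u v => hLC.schoutenForm_symm (ψ := ψ) (μ := μ) h.smooth_potential hx u v
  have hW := h.selfDual x hx
  have hH : ∀ {d : E}, B x d (n₁ x) = 0 → B x d (n₂ x) = 0 → ∀ w, hessForm Γ F x w d = 0 := by
    intro d h₁ h₂ w
    rw [hfr.expand_plane h₁ h₂]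
    simp [h.hessForm_n₁ hx, (h.fderiv_ψ_and_hessForm hμ hx).2]
  have hPd : ∀ {d : E}, B x d (n₁ x) = 0 → B x d (n₂ x) = 0 → ∀ w,
      schoutenForm B Γ F ψ μ x w d = 1 / 2 * (ψ x * B x w d) := by
    intro d h₁ h₂ w
    rw [schoutenForm_apply, hH h₁ h₂, h.fderiv_plane hx h₁]
    ring
  -- Modulo anti-self-dual bivectors, `d ∧ v` with `d` in the plane and `v` orthogonal to `d` is a
  -- multiple of `n₁ ∧ n₂`: orthogonality cancels the remaining multiple of `n₂ ∧ m₂`.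
  have red : ∀ {d v : E}, B x d (n₁ x) = 0 → B x d (n₂ x) = 0 → B x d v = 0 → ∃ c : ℝ, ∀ z t,
      weylForm B Γ (schoutenForm B Γ F ψ μ) x d v z t =
        c * weylForm B Γ (schoutenForm B Γ F ψ μ) x (n₁ x) (n₂ x) z t := by
    intro d v h₁ h₂ hdv
    refine ⟨B x d (m₁ x) * B x v (m₂ x) - B x d (m₂ x) * B x v (m₁ x), fun z t => ?_⟩
    have e1 := hfr.expand_plane h₁ h₂
    have e2 := hfr.expand v
    have e3 : B x d (m₁ x) * B x v (n₁ x) + B x d (m₂ x) * B x v (n₂ x) = 0 := by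
      have := hdv
      rw [e1] at this
      simp only [map_add, map_smul, add_apply, smul_apply, smul_eq_mul, hg (n₁ x) v,
        hg (n₂ x) v] at this
      exact this
    have s11 : ∀ a, weylForm B Γ (schoutenForm B Γ F ψ μ) x a a z t = 0 := fun a => by
      linarith [weylForm_swap B Γ (schoutenForm B Γ F ψ μ) x a a z t]
    have s21 := weylForm_swap B Γ (schoutenForm B Γ F ψ μ) x (n₁ x) (n₂ x) z t
    conv_lhs => rw [e1, e2]
    simp only [weylForm_add_left, weylForm_smul_left, weylForm_add_middle, weylForm_smul_middle,
      hW.n₁m₂, hW.n₂m₁, hW.diag, s11, s21]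
    linear_combination weylForm B Γ (schoutenForm B Γ F ψ μ) x (n₂ x) (m₂ x) z t * e3
  obtain ⟨c, hc⟩ := red hd₁ hd₂ hv
  obtain ⟨c', hc'⟩ := red hd₁' hd₂' hv'
  -- After two reductions only the component on `n₁ ∧ n₂`, `n₁ ∧ n₂` is left, and it vanishes since
  -- the plane is parallel and null. The curvature is then minus the Kulkarni-Nomizu product, where
  -- `H` and `dF` disappear on plane vectors and only `ψ` survives.
  have w0 : weylForm B Γ (schoutenForm B Γ F ψ μ) x d v d' v' = 0 := by
    rw [hc, hLC.weylForm_pair hx hP, hc']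
    simp only [weylForm, h.inner_riem_n₁_n₂ hμ hx, kulkarniNomizu, hfr.n₁n₁, hfr.n₁n₂, hfr.n₂n₂,
      hg (n₂ x) (n₁ x)]
    ring
  simp only [weylForm, kulkarniNomizu] at w0
  rw [hP d v', hPd hd₁ hd₂, hPd hd₁' hd₂', hPd hd₁' hd₂',
    hfr.inner_plane hg hd₁ hd₂ hd₁' hd₂', hg v' d] at w0
  linarith

end IsIsotropicSelfDual

/-- The flow-out of a slice along commuting vector fields. -/
theorem exists_slice_flow {E A : Type} [NormedAddCommGroup E] [NormedSpace ℝ E]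
    [FiniteDimensional ℝ E] [NormedAddCommGroup A] [NormedSpace ℝ A] [CompleteSpace A]
    {V : Set E} (hV : IsOpen V) {X : E → A →L[ℝ] E} (hX : ContDiffOn ℝ ∞ X V) {p : E} (hp : p ∈ V)
    (hcomm : ∀ x ∈ V, ∀ a b, fderiv ℝ X x (X x a) b = fderiv ℝ X x (X x b) a)
    (κ : (A × A) ≃L[ℝ] E) (hκ : ∀ a, κ (0, a) = X p a) :
    ∃ e : OpenPartialHomeomorph (A × A) E, (0, 0) ∈ e.source ∧ e (0, 0) = p ∧ e.target ⊆ V ∧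
      ContDiffOn ℝ ∞ e e.source ∧ ContDiffOn ℝ ∞ e.symm e.target ∧
      (∀ w, (w, (0 : A)) ∈ e.source → e (w, 0) = p + κ (w, 0)) ∧
      (∀ z ∈ e.source, ∀ b, fderiv ℝ e z (0, b) = X (e z) b) := by
  obtain ⟨O, Ψ, hO, hpO, hΨ, hΨV, hΨ0, hΨX⟩ := exists_flow hV hX hp hcomm
  have : CompleteSpace E := FiniteDimensional.complete ℝ E
  -- The slice runs in the directions `κ (w, 0)` and the flow starts in the directions `X p a = κ
  -- (0, a)`, so the derivative of the flow-out at the origin is `κ` itself, hence invertible.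
  let j : A × A → E × A := fun z => (p + κ (z.1, 0), z.2)
  have hj : ContDiff ℝ ∞ j := by
    refine ContDiff.prodMk (contDiff_const.add (κ.contDiff.comp ?_)) contDiff_snd
    exact contDiff_fst.prodMk contDiff_const
  have hjd : ∀ z, HasFDerivAt j (((κ : (A × A) →L[ℝ] E).comp
      ((ContinuousLinearMap.fst ℝ A A).prod 0)).prod (ContinuousLinearMap.snd ℝ A A)) z := by
    intro z
    refine HasFDerivAt.prodMk (HasFDerivAt.const_add p ?_) hasFDerivAt_snd
    exact κ.hasFDerivAt.comp z (hasFDerivAt_fst.prodMk (hasFDerivAt_const (0 : A) z))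
  have hO' : IsOpen (j ⁻¹' O) := hO.preimage hj.continuous
  have hΨd : ∀ y ∈ O, HasFDerivAt Ψ (fderiv ℝ Ψ y) y := fun y hy =>
    ((hΨ.contDiffAt (hO.mem_nhds hy)).differentiableAt (by simp)).hasFDerivAt
  have hj0 : j (0, 0) = (p, 0) := by
    change (p + κ (0, 0), (0 : A)) = _
    rw [show ((0 : A), (0 : A)) = 0 from rfl, map_zero, add_zero]
  have h0 : ((0 : A), (0 : A)) ∈ j ⁻¹' O := by
    change j (0, 0) ∈ O
    rwa [hj0]
  have hfst : ∀ v, fderiv ℝ Ψ (p, 0) (v, 0) = v := by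
    intro v
    have h1 := HasFDerivAt.comp (g := Ψ) (f := fun x => (id x, (0 : A))) p (hΨd _ hpO)
      ((hasFDerivAt_id p).prodMk (hasFDerivAt_const (0 : A) p))
    have h2 : (Ψ ∘ fun x => (id x, (0 : A))) =ᶠ[𝓝 p] id := by
      have : ∀ᶠ x in 𝓝 p, (x, (0 : A)) ∈ O :=
        (by fun_prop : Continuous fun x : E => (x, (0 : A))).continuousAt.eventually
          (hO.mem_nhds hpO)
      filter_upwards [this] with x hx using hΨ0 x hx
    have h3 := congrArg (fun L => L v) (h1.unique ((hasFDerivAt_id p).congr_of_eventuallyEq h2))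
    simpa using h3
  have hder : HasFDerivAt (Ψ ∘ j) (κ : (A × A) →L[ℝ] E) (0, 0) := by
    have h1 : HasFDerivAt Ψ (fderiv ℝ Ψ (p, 0)) (j (0, 0)) := by
      rw [hj0]
      exact hΨd _ hpO
    refine (h1.comp (0, 0) (hjd _)).congr_fderiv (ContinuousLinearMap.ext fun z => ?_)
    obtain ⟨w, a⟩ := z
    change fderiv ℝ Ψ (p, 0) (κ (w, 0), a) = κ (w, a)
    have h2 : (κ (w, 0), a) = (κ (w, (0 : A)), (0 : A)) + (0, a) := by simp
    have h3 : ((w, a) : A × A) = (w, 0) + (0, a) := by simp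
    rw [h2, map_add, hfst, hΨX _ hpO, hΨ0 p hpO, h3, map_add, hκ]
  have hsm : ContDiffOn ℝ ∞ (Ψ ∘ j) (j ⁻¹' O) := hΨ.comp hj.contDiffOn fun z hz => hz
  obtain ⟨e, he0, heO, hee, hes, -⟩ :=
    exists_openPartialHomeomorph_of_contDiffOn hO' hsm h0 κ hder
  have hfun : (e : A × A → E) = Ψ ∘ j := funext hee
  refine ⟨e, he0, ?_, ?_, ?_, hes, ?_, ?_⟩
  · rw [hfun, Function.comp_apply, hj0, hΨ0 p hpO]
  · intro y hy
    rw [← e.right_inv hy, hee]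
    exact hΨV _ (heO (e.map_target hy))
  · rw [hfun]
    exact hsm.mono heO
  · intro w hw
    rw [hee]
    exact hΨ0 _ (heO hw)
  · intro z hz b
    rw [hfun, ((hΨd _ (heO hz)).comp z (hjd z)).fderiv]
    change fderiv ℝ Ψ (j z) (κ ((0 : A), (0 : A)), b) = _
    rw [show ((0 : A), (0 : A)) = 0 from rfl, map_zero, hΨX _ (heO hz)]
    rfl

end


/-! ### Integrability of the plane field and Walker coordinates -/

noncomputable section

set_option maxSynthPendingDepth 3

/-- The linear map `a ↦ a₀ v + a₁ w`. -/
def pairMap {E : Type*} [NormedAddCommGroup E] [NormedSpace ℝ E] (v w : E) : Coord 2 →L[ℝ] E :=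
  (EuclideanSpace.proj 0 : Coord 2 →L[ℝ] ℝ).smulRight v +
    (EuclideanSpace.proj 1 : Coord 2 →L[ℝ] ℝ).smulRight w

@[simp] theorem pairMap_apply {E : Type*} [NormedAddCommGroup E] [NormedSpace ℝ E] (v w : E)
    (a : Coord 2) : pairMap v w a = a 0 • v + a 1 • w := by
  simp [pairMap]

theorem contDiffOn_pairMap {E G : Type*} [NormedAddCommGroup E] [NormedSpace ℝ E]
    [NormedAddCommGroup G] [NormedSpace ℝ G] {U : Set G} {v w : G → E} (hv : ContDiffOn ℝ ∞ v U)
    (hw : ContDiffOn ℝ ∞ w U) : ContDiffOn ℝ ∞ (fun x => pairMap (v x) (w x)) U :=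
  ((ContinuousLinearMap.smulRightL ℝ (Coord 2) E
    (EuclideanSpace.proj 0 : Coord 2 →L[ℝ] ℝ)).contDiff.comp_contDiffOn hv).add
  ((ContinuousLinearMap.smulRightL ℝ (Coord 2) E
    (EuclideanSpace.proj 1 : Coord 2 →L[ℝ] ℝ)).contDiff.comp_contDiffOn hw)

/-- The pair of numbers `φ v, χ v`. -/
def pairFun {E : Type*} [NormedAddCommGroup E] [NormedSpace ℝ E] (φ χ : E →L[ℝ] ℝ) :
    E →L[ℝ] Coord 2 :=
  φ.smulRight (EuclideanSpace.single 0 (1 : ℝ)) + χ.smulRight (EuclideanSpace.single 1 (1 : ℝ))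

@[simp] theorem pairFun_apply_zero {E : Type*} [NormedAddCommGroup E] [NormedSpace ℝ E]
    (φ χ : E →L[ℝ] ℝ) (v : E) : pairFun φ χ v 0 = φ v := by
  simp [pairFun]

@[simp] theorem pairFun_apply_one {E : Type*} [NormedAddCommGroup E] [NormedSpace ℝ E]
    (φ χ : E →L[ℝ] ℝ) (v : E) : pairFun φ χ v 1 = χ v := by
  simp [pairFun]

/-- The linear coordinates given by a null frame: `(w, a) ↦ w₀ m₁ + w₁ m₂ + a₀ n₁ + a₁ n₂`. -/
def IsNullFrame.equiv {E : Type*} [NormedAddCommGroup E] [NormedSpace ℝ E]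
    {g : E →L[ℝ] E →L[ℝ] ℝ} {n₁ n₂ m₁ m₂ : E} (hfr : IsNullFrame g n₁ n₂ m₁ m₂)
    (hg : ∀ u v, g u v = g v u) : (Coord 2 × Coord 2) ≃L[ℝ] E :=
  ContinuousLinearEquiv.equivOfInverse
    ((pairMap m₁ m₂).coprod (pairMap n₁ n₂))
    ((pairFun (g n₁) (g n₂)).prod (pairFun (g m₁) (g m₂)))
    (fun z => by
      obtain ⟨w, a⟩ := z
      refine Prod.ext ?_ ?_ <;> ext i <;> fin_cases i <;>
        simp [hg m₁ n₁, hg m₂ n₁, hg m₁ n₂, hg m₂ n₂, hg n₂ n₁, hg m₂ m₁, hfr.n₁n₁, hfr.n₁n₂,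
          hfr.n₁m₁, hfr.n₁m₂, hfr.n₂n₂, hfr.n₂m₁, hfr.n₂m₂, hfr.m₁m₁, hfr.m₁m₂, hfr.m₂m₂])
    (fun v => by
      conv_rhs => rw [hfr.expand v]
      simp [hg v]
      abel)

@[simp] theorem IsNullFrame.equiv_apply {E : Type*} [NormedAddCommGroup E] [NormedSpace ℝ E]
    {g : E →L[ℝ] E →L[ℝ] ℝ} {n₁ n₂ m₁ m₂ : E} (hfr : IsNullFrame g n₁ n₂ m₁ m₂)
    (hg : ∀ u v, g u v = g v u) (w a : Coord 2) :
    hfr.equiv hg (w, a) = pairMap m₁ m₂ w + pairMap n₁ n₂ a := rfl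

namespace IsIsotropicSelfDual

variable {E : Type} [NormedAddCommGroup E] [NormedSpace ℝ E] [FiniteDimensional ℝ E]
  {U : Set E} {B : E → E →L[ℝ] E →L[ℝ] ℝ} {Γ : E → E →L[ℝ] E →L[ℝ] E} {F lam ψ : E → ℝ}
  {μ : ℝ} {n₁ n₂ m₁ m₂ : E → E} (h : IsIsotropicSelfDual U B Γ F lam ψ μ n₁ n₂ m₁ m₂) {x : E}

include h

omit [FiniteDimensional ℝ E] in
/-- The plane field is spanned, near a point, by commuting vector fields. -/
theorem exists_commuting_fields (hμ : μ ≠ -(1 / 2)) (hx : x ∈ U) :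
    ∃ (V : Set E) (X : E → Coord 2 →L[ℝ] E), IsOpen V ∧ x ∈ V ∧ V ⊆ U ∧ ContDiffOn ℝ ∞ X V ∧
      (∀ y ∈ V, ∀ a b, fderiv ℝ X y (X y a) b = fderiv ℝ X y (X y b) a) ∧
      (∀ a, X x a = pairMap (n₁ x) (n₂ x) a) ∧
      (∀ y ∈ V, ∀ d, B y d (n₁ y) = 0 → B y d (n₂ y) = 0 → ∃ b, X y b = d) := by
  set N : E → Coord 2 →L[ℝ] E := fun y => pairMap (n₁ y) (n₂ y) with hN
  have hNs : ContDiffOn ℝ ∞ N U := contDiffOn_pairMap h.smooth_n₁ h.smooth_n₂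
  -- A fixed linear projection which is an isomorphism on the plane at `x`. The frame `N` of the
  -- plane field is renormalised to `X = N Q⁻¹`, so that `q ∘ X` is the identity at every point.
  set q : E →L[ℝ] Coord 2 := pairFun (B x (m₁ x)) (B x (m₂ x)) with hq
  set Q : E → Coord 2 →L[ℝ] Coord 2 := fun y => q.comp (N y) with hQ
  have hQs : ContDiffOn ℝ ∞ Q U := contDiffOn_const.clm_comp hNs
  have hQx : Q x = 1 := by
    have hfr := h.frame x hx
    have hg := h.symm x hx
    ext a i
    fin_cases i <;> simp [hQ, hq, hN, hg (m₁ x), hg (m₂ x), hfr.n₁m₁, hfr.n₁m₂, hfr.n₂m₁, hfr.n₂m₂]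
  set V : Set E := U ∩ Q ⁻¹' {T | IsUnit T} with hV
  have hVo : IsOpen V := hQs.continuousOn.isOpen_inter_preimage h.isOpen Units.isOpen
  have hxV : x ∈ V := ⟨hx, by simp [hQx]⟩
  have hVU : V ⊆ U := Set.inter_subset_left
  set X : E → Coord 2 →L[ℝ] E := fun y => (N y).comp (Ring.inverse (Q y)) with hX
  have hXs : ContDiffOn ℝ ∞ X V := by
    refine (hNs.mono hVU).clm_comp fun y hy => ?_
    have h1 : ContDiffAt ℝ ∞ Ring.inverse (Q y) := by
      obtain ⟨T, hT⟩ := hy.2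
      rw [← hT]
      exact contDiffAt_ringInverse ℝ T
    exact (h1.comp_contDiffWithinAt y ((hQs y hy.1).mono hVU))
  have hD : ∀ y ∈ U, ∀ a, B y (N y a) (n₁ y) = 0 ∧ B y (N y a) (n₂ y) = 0 := by
    intro y hy a
    have hfr := h.frame y hy
    simp [hN, hfr.n₁n₁, hfr.n₁n₂, hfr.n₂n₂, h.symm y hy (n₂ y) (n₁ y)]
  have hqX : ∀ y ∈ V, ∀ a, q (X y a) = a := by
    intro y hy a
    have h1 := Ring.mul_inverse_cancel (Q y) hy.2
    exact congrArg (fun T : Coord 2 →L[ℝ] Coord 2 => T a) h1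
  have hXN : ∀ y ∈ V, ∀ c, X y (Q y c) = N y c := by
    intro y hy c
    have h1 := Ring.inverse_mul_cancel (Q y) hy.2
    have h2 := congrArg (fun T : Coord 2 →L[ℝ] Coord 2 => N y (T c)) h1
    exact h2
  have hspan : ∀ y ∈ U, ∀ d, B y d (n₁ y) = 0 → B y d (n₂ y) = 0 → ∃ c, N y c = d := by
    intro y hy d h1 h2
    refine ⟨!₂[B y d (m₁ y), B y d (m₂ y)], ?_⟩
    conv_rhs => rw [(h.frame y hy).expand_plane h1 h2]
    simp [hN]
  refine ⟨V, X, hVo, hxV, hVU, hXs, ?_, ?_, ?_⟩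
  · intro y hy a b
    have hXd := (hXs.contDiffAt (hVo.mem_nhds hy)).differentiableAt (by simp)
    have hXb : ∀ b, HasFDerivAt (fun y => X y b) _ y := fun b =>
      hXd.hasFDerivAt.clm_apply (hasFDerivAt_const b y)
    have hcov : ∀ b w, B y (fderiv ℝ X y w b + Γ y w (X y b)) (n₁ y) = 0 ∧
        B y (fderiv ℝ X y w b + Γ y w (X y b)) (n₂ y) = 0 := by
      intro b w
      have h1 := h.cov_mem_plane hμ hVo hVU hy (hXb b).differentiableAt
        (fun z hz => (hD z (hVU hz) _).1) (fun z hz => (hD z (hVU hz) _).2) w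
      rw [(hXb b).fderiv] at h1
      simpa using h1
    have hq0 : ∀ b w, q (fderiv ℝ X y w b) = 0 := by
      intro b w
      have h1 := q.hasFDerivAt.comp y (hXb b)
      have h2 : (q ∘ fun y => X y b) =ᶠ[𝓝 y] fun _ => b := by
        filter_upwards [hVo.mem_nhds hy] with z hz using hqX z hz b
      have h3 := congrArg (fun L => L w)
        (h1.unique ((hasFDerivAt_const b y).congr_of_eventuallyEq h2))
      simpa using h3
    -- The bracket `d` lies in the plane, being a difference of covariant derivatives of plane
    -- fields, and `q` kills it because `q ∘ X` is constant; `q` is injective on the plane.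
    set d := fderiv ℝ X y (X y a) b - fderiv ℝ X y (X y b) a with hd
    have hd' : d = (fderiv ℝ X y (X y a) b + Γ y (X y a) (X y b)) -
        (fderiv ℝ X y (X y b) a + Γ y (X y b) (X y a)) := by
      rw [hd, h.torsion_free y (hVU hy) (X y a) (X y b)]
      abel
    obtain ⟨c, hc⟩ := hspan y (hVU hy) d
      (by rw [hd']; simp only [map_sub, sub_apply, (hcov _ _).1, sub_zero])
      (by rw [hd']; simp only [map_sub, sub_apply, (hcov _ _).2, sub_zero])
    have h3 : Q y c = 0 := by
      change q (N y c) = 0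
      rw [hc, hd, map_sub, hq0, hq0, sub_zero]
    have h4 := hXN y hy c
    rw [h3, map_zero, hc] at h4
    exact sub_eq_zero.1 h4.symm
  · intro a
    have := hXN x hxV a
    rwa [hQx] at this
  · intro y hy d h1 h2
    obtain ⟨c, hc⟩ := hspan y (hVU hy) d h1 h2
    exact ⟨Q y c, by rw [hXN y hy, hc]⟩

/-- The Frobenius theorem for the plane field: near a point there is a submersion onto the plane
which is constant on the leaves, with prescribed values on a slice. -/
theorem exists_leaf_coordinates (hμ : μ ≠ -(1 / 2)) (hx : x ∈ U) :
    ∃ (T : Set E) (u : E → Coord 2), IsOpen T ∧ x ∈ T ∧ T ⊆ U ∧ ContDiffOn ℝ ∞ u T ∧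
      (∀ᶠ w in 𝓝 (0 : Coord 2), u (x + pairMap (m₁ x) (m₂ x) w) = w) ∧
      ∀ y ∈ T, ∀ d, B y d (n₁ y) = 0 → B y d (n₂ y) = 0 → fderiv ℝ u y d = 0 := by
  obtain ⟨V, X, hV, hxV, hVU, hX, hcomm, hXx, hXD⟩ := h.exists_commuting_fields hμ hx
  obtain ⟨e, he0, he0x, heV, hes, hes', hew, heX⟩ := exists_slice_flow hV hX hxV hcomm
    ((h.frame x hx).equiv (h.symm x hx)) (fun a => by
      rw [IsNullFrame.equiv_apply, map_zero, zero_add, hXx])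
  refine ⟨e.target, fun y => (e.symm y).1, e.open_target, ?_, heV.trans hVU, hes'.fst, ?_, ?_⟩
  · rw [← he0x]
    exact e.map_source he0
  · have h1 : ∀ᶠ w in 𝓝 (0 : Coord 2), (w, (0 : Coord 2)) ∈ e.source :=
      (by fun_prop : Continuous fun w : Coord 2 => (w, (0 : Coord 2))).continuousAt.eventually
        (e.open_source.mem_nhds he0)
    filter_upwards [h1] with w hw
    have h2 := hew w hw
    rw [IsNullFrame.equiv_apply, map_zero, add_zero] at h2
    rw [← h2, e.left_inv hw]
  · intro y hy d h1 h2
    -- In flow coordinates a plane vector is the image of `(0, b)`, on which the first coordinate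
    -- has derivative zero.
    obtain ⟨b, rfl⟩ := hXD y (heV hy) d h1 h2
    set z := e.symm y with hz
    have hzs : z ∈ e.source := e.map_target hy
    have hez : e z = y := e.right_inv hy
    have hu : HasFDerivAt (fun y => (e.symm y).1) (fderiv ℝ (fun y => (e.symm y).1) (e z)) (e z) := by
      rw [hez]
      exact ((hes'.fst.contDiffAt (e.open_target.mem_nhds hy)).differentiableAt
        (by simp)).hasFDerivAt
    have hed := ((hes.contDiffAt (e.open_source.mem_nhds hzs)).differentiableAt
      (by simp)).hasFDerivAt
    have h3 : ((fun y => (e.symm y).1) ∘ e) =ᶠ[𝓝 z] Prod.fst := by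
      filter_upwards [e.open_source.mem_nhds hzs] with t ht
      simp [e.left_inv ht]
    have h4 := congrArg (fun L => L ((0 : Coord 2), b))
      ((hu.comp z hed).unique (hasFDerivAt_fst.congr_of_eventuallyEq h3))
    simp only [ContinuousLinearMap.comp_apply, heX z hzs, hez] at h4
    simpa using h4

/-- Coordinates `(w, a)` adapted to the plane field: the fibre coordinate fields span it and are
dual to the base coordinates. -/
theorem exists_walker_coordinates (hμ : μ ≠ -(1 / 2)) (hx : x ∈ U) :
    ∃ e : OpenPartialHomeomorph (Coord 2 × Coord 2) E, (0, 0) ∈ e.source ∧ e (0, 0) = x ∧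
      e.target ⊆ U ∧ ContDiffOn ℝ ∞ e e.source ∧ ContDiffOn ℝ ∞ e.symm e.target ∧
      ∀ z ∈ e.source, ∀ b, (∀ v, B (e z) (fderiv ℝ e z (0, b)) (fderiv ℝ e z v) = inner ℝ v.1 b) ∧
        B (e z) (fderiv ℝ e z (0, b)) (n₁ (e z)) = 0 ∧
        B (e z) (fderiv ℝ e z (0, b)) (n₂ (e z)) = 0 := by
  obtain ⟨T, u, hT, hxT, hTU, hu, hux, huD⟩ := h.exists_leaf_coordinates hμ hx
  have hu' : ContDiffOn ℝ ∞ (fderiv ℝ u) T := hu.fderiv_of_isOpen hT (by simp)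
  have hud : ∀ y ∈ T, HasFDerivAt u (fderiv ℝ u y) y := fun y hy =>
    ((hu.contDiffAt (hT.mem_nhds hy)).differentiableAt (by simp)).hasFDerivAt
  -- the gradients of the leaf coordinates
  set Y : E → Coord 2 →L[ℝ] E := fun y =>
    ContinuousLinearMap.smulRightL ℝ (Coord 2) E (innerSL ℝ (fderiv ℝ u y (m₁ y))) (n₁ y) +
    ContinuousLinearMap.smulRightL ℝ (Coord 2) E (innerSL ℝ (fderiv ℝ u y (m₂ y))) (n₂ y) with hY
  have hYapp : ∀ y b, Y y b = inner ℝ (fderiv ℝ u y (m₁ y)) b • n₁ y +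
      inner ℝ (fderiv ℝ u y (m₂ y)) b • n₂ y := fun y b => by simp [hY]
  have hYs : ContDiffOn ℝ ∞ Y T := by
    have a1 := hu'.clm_apply (h.smooth_m₁.mono hTU)
    have a2 := hu'.clm_apply (h.smooth_m₂.mono hTU)
    have b1 := (innerSL ℝ (E := Coord 2)).contDiff (n := ∞).comp_contDiffOn a1
    have b2 := (innerSL ℝ (E := Coord 2)).contDiff (n := ∞).comp_contDiffOn a2
    exact (((ContinuousLinearMap.smulRightL ℝ (Coord 2) E).contDiff.comp_contDiffOn b1).clm_apply
      (h.smooth_n₁.mono hTU)).add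
      (((ContinuousLinearMap.smulRightL ℝ (Coord 2) E).contDiff.comp_contDiffOn b2).clm_apply
      (h.smooth_n₂.mono hTU))
  have hYD : ∀ y ∈ T, ∀ b, B y (Y y b) (n₁ y) = 0 ∧ B y (Y y b) (n₂ y) = 0 := by
    intro y hy b
    have hfr := h.frame y (hTU hy)
    simp [hYapp, hfr.n₁n₁, hfr.n₁n₂, hfr.n₂n₂, h.symm y (hTU hy) (n₂ y) (n₁ y)]
  have hgrad : ∀ y ∈ T, ∀ b v, B y (Y y b) v = inner ℝ (fderiv ℝ u y v) b := by
    intro y hy b v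
    have hfr := h.frame y (hTU hy)
    have z1 := huD y hy (n₁ y) hfr.n₁n₁ hfr.n₁n₂
    have z2 := huD y hy (n₂ y) (by rw [h.symm y (hTU hy), hfr.n₁n₂]) hfr.n₂n₂
    conv_rhs => rw [hfr.expand v]
    simp only [hYapp, map_add, map_smul, add_apply, smul_apply, z1, z2, smul_zero, zero_add,
      inner_add_left, inner_smul_left, smul_eq_mul, h.symm y (hTU hy) (n₁ y),
      h.symm y (hTU hy) (n₂ y)]
    simp
    ring
  have hcomm : ∀ y ∈ T, ∀ a b, fderiv ℝ Y y (Y y a) b = fderiv ℝ Y y (Y y b) a := by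
    intro y hy a b
    have hyU := hTU hy
    have hYd := (hYs.contDiffAt (hT.mem_nhds hy)).differentiableAt (by simp)
    have hYb : ∀ b, HasFDerivAt (fun y => Y y b) _ y := fun b =>
      hYd.hasFDerivAt.clm_apply (hasFDerivAt_const b y)
    have hu2 := ((hu'.contDiffAt (hT.mem_nhds hy)).differentiableAt (by simp)).hasFDerivAt
    have hcov : ∀ b w, B y (fderiv ℝ Y y w b + Γ y w (Y y b)) (n₁ y) = 0 ∧
        B y (fderiv ℝ Y y w b + Γ y w (Y y b)) (n₂ y) = 0 := by
      intro b w
      have h1 := h.cov_mem_plane hμ hT hTU hy (hYb b).differentiableAt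
        (fun z hz => (hYD z hz _).1) (fun z hz => (hYD z hz _).2) w
      rw [(hYb b).fderiv] at h1
      simpa using h1
    have hess : ∀ b w v, B y (fderiv ℝ Y y w b + Γ y w (Y y b)) v =
        inner ℝ (fderiv ℝ (fderiv ℝ u) y w v - fderiv ℝ u y (Γ y w v)) b := by
      intro b w v
      obtain ⟨L, hL, hL'⟩ := h.toIsLeviCivita.hasFDerivAt_inner hyU (hYb b) (hasFDerivAt_const v y)
      have h2 : (fun y => B y (Y y b) v) =ᶠ[𝓝 y] fun y => inner ℝ (fderiv ℝ u y v) b := by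
        filter_upwards [hT.mem_nhds hy] with z hz using hgrad z hz b v
      have h3 := (hu2.clm_apply (hasFDerivAt_const v y)).inner ℝ (hasFDerivAt_const b y)
      have h4 := congrArg (fun L => L w) (hL.unique (h3.congr_of_eventuallyEq h2))
      simp [hL', hgrad y hy] at h4
      rw [inner_sub_left]
      simp only [map_add, add_apply]
      linarith
    have hsymm : ∀ w v, fderiv ℝ (fderiv ℝ u) y w v - fderiv ℝ u y (Γ y w v) =
        fderiv ℝ (fderiv ℝ u) y v w - fderiv ℝ u y (Γ y v w) := by
      intro w v
      rw [(hu.contDiffAt (hT.mem_nhds hy)).isSymmSndFDerivAt minSmoothness_two_le w v,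
        h.torsion_free y hyU w v]
    -- By symmetry of the Hessian of a leaf coordinate, `⟨∇_{Y a} Y b, v⟩ = ⟨∇_v Y b, Y a⟩`. Both
    -- vectors on the right lie in the null plane, so the gradient fields are parallel along the
    -- leaves and in particular commute.
    have zero : ∀ a b, fderiv ℝ Y y (Y y a) b + Γ y (Y y a) (Y y b) = 0 := by
      intro a b
      refine h.nondegenerate y hyU _ fun v => ?_
      rw [hess, hsymm, ← hess]
      exact (h.frame y hyU).inner_plane (h.symm y hyU) (hcov b v).1 (hcov b v).2 (hYD y hy a).1
        (hYD y hy a).2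
    have z1 := zero a b
    have z2 := zero b a
    rw [h.torsion_free y hyU] at z2
    exact add_right_cancel (z1.trans z2.symm)
  -- On the slice `u` is the coordinate `w`, so `du` sends `m₁, m₂` at `x` to the standard basis.
  have hYx : ∀ b, Y x b = pairMap (n₁ x) (n₂ x) b := by
    have h1 : HasFDerivAt (fun w : Coord 2 => x + pairMap (m₁ x) (m₂ x) w)
        (pairMap (m₁ x) (m₂ x)) 0 := (pairMap (m₁ x) (m₂ x)).hasFDerivAt.const_add x
    have h2 : HasFDerivAt u (fderiv ℝ u x) (x + pairMap (m₁ x) (m₂ x) 0) := by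
      rw [map_zero, add_zero]
      exact hud x hxT
    have h3 := (h2.comp (0 : Coord 2) h1).unique ((hasFDerivAt_id (0 : Coord 2)).congr_of_eventuallyEq
      (show (u ∘ fun w : Coord 2 => x + pairMap (m₁ x) (m₂ x) w) =ᶠ[𝓝 0] id from hux))
    have h4 := congrArg (fun L => L (EuclideanSpace.single 0 (1 : ℝ))) h3
    have h5 := congrArg (fun L => L (EuclideanSpace.single 1 (1 : ℝ))) h3
    simp at h4 h5
    intro b
    simp [hYapp, h4, h5, EuclideanSpace.inner_single_left]
  obtain ⟨e, he0, he0x, heT, hes, hes', hew, heY⟩ := exists_slice_flow hT hYs hxT hcomm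
    ((h.frame x hx).equiv (h.symm x hx)) (fun a => by
      rw [IsNullFrame.equiv_apply, map_zero, zero_add, hYx])
  have hed : ∀ z ∈ e.source, HasFDerivAt e (fderiv ℝ e z) z := fun z hz =>
    ((hes.contDiffAt (e.open_source.mem_nhds hz)).differentiableAt (by simp)).hasFDerivAt
  have hslice : ∀ᶠ w in 𝓝 (0 : Coord 2), (w, (0 : Coord 2)) ∈ e.source ∧ u (e (w, 0)) = w := by
    have h1 : ∀ᶠ w in 𝓝 (0 : Coord 2), (w, (0 : Coord 2)) ∈ e.source :=
      (by fun_prop : Continuous fun w : Coord 2 => (w, (0 : Coord 2))).continuousAt.eventually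
        (e.open_source.mem_nhds he0)
    filter_upwards [h1, hux] with w hw hw'
    have h2 := hew w hw
    rw [IsNullFrame.equiv_apply, map_zero, add_zero] at h2
    exact ⟨hw, by rw [h2, hw']⟩
  obtain ⟨r₁, hr₁, hball₁⟩ := Metric.eventually_nhds_iff_ball.1 hslice
  obtain ⟨r₂, hr₂, hball₂⟩ := Metric.isOpen_iff.1 e.open_source _ he0
  set r := min r₁ r₂ with hr
  have hrpos : 0 < r := lt_min hr₁ hr₂
  -- On a product of balls each fibre is convex and meets the zero section. The function `u ∘ e` is
  -- constant on fibres, so it equals the base coordinate everywhere on `S`.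
  set S : Set (Coord 2 × Coord 2) := Metric.ball 0 r ×ˢ Metric.ball 0 r with hS
  have hSo : IsOpen S := Metric.isOpen_ball.prod Metric.isOpen_ball
  have hSe : S ⊆ e.source := by
    refine fun z hz => hball₂ ?_
    rw [← ball_prod_same]
    exact ⟨Metric.ball_subset_ball (min_le_right _ _) hz.1,
      Metric.ball_subset_ball (min_le_right _ _) hz.2⟩
  have hue : ∀ z ∈ S, u (e z) = z.1 := by
    rintro ⟨w, a⟩ ⟨hw, ha⟩
    have hd : ∀ c ∈ Metric.ball (0 : Coord 2) r,
        HasFDerivAt (fun c => u (e (w, c))) (0 : Coord 2 →L[ℝ] Coord 2) c := by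
      intro c hc
      have hz : (w, c) ∈ e.source := hSe ⟨hw, hc⟩
      have h1 := ((hud _ (heT (e.map_source hz))).comp (w, c) (hed _ hz)).comp c
        ((hasFDerivAt_const w c).prodMk (hasFDerivAt_id c))
      refine h1.congr_fderiv (ContinuousLinearMap.ext fun b => ?_)
      simp only [ContinuousLinearMap.comp_apply, ContinuousLinearMap.prod_apply, zero_apply,
        ContinuousLinearMap.id_apply, heY _ hz]
      exact huD _ (heT (e.map_source hz)) _ (hYD _ (heT (e.map_source hz)) b).1
        (hYD _ (heT (e.map_source hz)) b).2
    have h2 := (convex_ball (0 : Coord 2) r).is_const_of_fderivWithin_eq_zero (𝕜 := ℝ)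
      (f := fun c => u (e (w, c))) (fun c hc => (hd c hc).differentiableAt.differentiableWithinAt)
      (fun c hc => (hd c hc).hasFDerivWithinAt.fderivWithin
        (Metric.isOpen_ball.uniqueDiffWithinAt hc)) ha (Metric.mem_ball_self hrpos)
    exact h2.trans (hball₁ w (Metric.ball_subset_ball (min_le_left _ _) hw)).2
  refine ⟨e.restrOpen S hSo, ⟨he0, Metric.mem_ball_self hrpos, Metric.mem_ball_self hrpos⟩, he0x,
    fun y hy => hTU (heT hy.1), hes.mono fun z hz => hz.1, hes'.mono fun y hy => hy.1, ?_⟩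
  rintro z ⟨hz, hzS⟩ b
  have hzT : e z ∈ T := heT (e.map_source hz)
  change (∀ v, B (e z) (fderiv ℝ e z (0, b)) (fderiv ℝ e z v) = inner ℝ v.1 b) ∧
    B (e z) (fderiv ℝ e z (0, b)) (n₁ (e z)) = 0 ∧ B (e z) (fderiv ℝ e z (0, b)) (n₂ (e z)) = 0
  rw [heY z hz]
  refine ⟨fun v => ?_, hYD _ hzT b⟩
  rw [hgrad _ hzT]
  have h1 := (hud _ hzT).comp z (hed z hz)
  have h2 : (u ∘ e) =ᶠ[𝓝 z] Prod.fst := by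
    filter_upwards [hSo.mem_nhds hzS] with t ht using hue t ht
  have h3 := congrArg (fun L => L v) (h1.unique (hasFDerivAt_fst.congr_of_eventuallyEq h2))
  have h4 : fderiv ℝ u (e z) (fderiv ℝ e z v) = v.1 := h3
  rw [h4]

end IsIsotropicSelfDual

end


noncomputable section

set_option maxSynthPendingDepth 3

/-! ### Metrics and connections given by components -/

variable {n : ℕ}

/-- The `i`-th vector of the standard basis. -/
abbrev coordVec (i : Fin n) : Coord n := EuclideanSpace.single i (1 : ℝ)

/-- The bilinear form with a given matrix. -/
def matrixForm (A : Matrix (Fin n) (Fin n) ℝ) : Coord n →L[ℝ] Coord n →L[ℝ] ℝ :=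
  ∑ i, ∑ j, A i j • (EuclideanSpace.proj (𝕜 := ℝ) i : Coord n →L[ℝ] ℝ).smulRight
    (EuclideanSpace.proj (𝕜 := ℝ) j : Coord n →L[ℝ] ℝ)

theorem matrixForm_apply (A : Matrix (Fin n) (Fin n) ℝ) (u v : Coord n) :
    matrixForm A u v = ∑ i, ∑ j, A i j * (u i * v j) := by
  simp [matrixForm]

@[simp] theorem matrixForm_coordVec (A : Matrix (Fin n) (Fin n) ℝ) (i j : Fin n) :
    matrixForm A (coordVec i) (coordVec j) = A i j := by
  simp [matrixForm_apply]

/-- The bilinear map given by Christoffel symbols. -/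
def connForm (Γ : ConnectionCoeffs n) (x : Coord n) : Coord n →L[ℝ] Coord n →L[ℝ] Coord n :=
  ∑ i, ∑ j, ∑ k, Γ i j k x • (EuclideanSpace.proj (𝕜 := ℝ) i : Coord n →L[ℝ] ℝ).smulRight
    ((EuclideanSpace.proj (𝕜 := ℝ) j : Coord n →L[ℝ] ℝ).smulRight (coordVec k))

@[simp] theorem connForm_coordVec (Γ : ConnectionCoeffs n) (x : Coord n) (i j k : Fin n) :
    connForm Γ x (coordVec i) (coordVec j) k = Γ i j k x := by
  simp [connForm, Pi.single_apply]

theorem contDiffOn_matrixForm {E : Type*} [NormedAddCommGroup E] [NormedSpace ℝ E]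
    {G : E → Matrix (Fin n) (Fin n) ℝ} {U : Set E}
    (hG : ∀ i j, ContDiffOn ℝ ∞ (fun x => G x i j) U) :
    ContDiffOn ℝ ∞ (fun x => matrixForm (G x)) U :=
  ContDiffOn.sum fun i _ => ContDiffOn.sum fun j _ => (hG i j).smul contDiffOn_const

theorem contDiffOn_connForm {Γ : ConnectionCoeffs n} {U : Set (Coord n)}
    (hΓ : ∀ i j k, ContDiffOn ℝ ∞ (Γ i j k) U) : ContDiffOn ℝ ∞ (connForm Γ) U :=
  ContDiffOn.sum fun i _ => ContDiffOn.sum fun j _ => ContDiffOn.sum fun k _ =>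
    (hΓ i j k).smul contDiffOn_const

theorem eq_sum_coordVec (u : Coord n) : u = ∑ i, u i • coordVec i := by
  ext j
  simp [Pi.single_apply]

theorem linear_ext_coordVec {F : Type*} [NormedAddCommGroup F] [NormedSpace ℝ F]
    {L L' : Coord n →L[ℝ] F} (h : ∀ i, L (coordVec i) = L' (coordVec i)) : L = L' := by
  ext u
  rw [eq_sum_coordVec u, map_sum, map_sum]
  exact Finset.sum_congr rfl fun i _ => by rw [map_smul, map_smul, h]

theorem bilin_ext_coordVec {F : Type*} [NormedAddCommGroup F] [NormedSpace ℝ F]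
    {L L' : Coord n →L[ℝ] Coord n →L[ℝ] F}
    (h : ∀ i j, L (coordVec i) (coordVec j) = L' (coordVec i) (coordVec j)) : L = L' :=
  linear_ext_coordVec fun i => linear_ext_coordVec (h i)

theorem bilin_apply_eq_sum (L : Coord n →L[ℝ] Coord n →L[ℝ] ℝ) (u v : Coord n) :
    L u v = ∑ i, ∑ j, u i * v j * L (coordVec i) (coordVec j) := by
  have hu : L u = ∑ i, u i • L (coordVec i) := by
    conv_lhs => rw [eq_sum_coordVec u, map_sum]
    simp
  have hv : ∀ l : Coord n →L[ℝ] ℝ, l v = ∑ j, v j * l (coordVec j) := fun l => by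
    conv_lhs => rw [eq_sum_coordVec v, map_sum]
    simp
  rw [hu]
  simp only [FunLike.coe_sum, Finset.sum_apply, smul_apply, hv (L _), smul_eq_mul, Finset.mul_sum,
    mul_assoc]

theorem fderiv_apply_eq_sum (F : Coord n → ℝ) (x u : Coord n) :
    fderiv ℝ F x u = ∑ i, u i * partialDeriv i F x := by
  conv_lhs => rw [eq_sum_coordVec u, map_sum]
  simp [partialDeriv]

theorem partialDeriv_congr {F H : Coord n → ℝ} {U : Set (Coord n)} (hU : IsOpen U)
    (hFH : ∀ x ∈ U, F x = H x) {x : Coord n} (hx : x ∈ U) (i : Fin n) :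
    partialDeriv i F x = partialDeriv i H x := by
  rw [partialDeriv, partialDeriv, Filter.EventuallyEq.fderiv_eq]
  filter_upwards [hU.mem_nhds hx] with y hy using hFH y hy

theorem fderiv_bilin_coord {E F : Type*} [NormedAddCommGroup E] [NormedSpace ℝ E]
    [NormedAddCommGroup F] [NormedSpace ℝ F]
    {L : E → F →L[ℝ] F →L[ℝ] Coord n} {x : E}
    (hL : DifferentiableAt ℝ L x) (w : E) (u v : F) (k : Fin n) :
    fderiv ℝ L x w u v k = fderiv ℝ (fun y => L y u v k) x w := by
  have h := ((EuclideanSpace.proj (𝕜 := ℝ) k : Coord n →L[ℝ] ℝ).hasFDerivAt.comp x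
    ((hL.hasFDerivAt.clm_apply (hasFDerivAt_const u x)).clm_apply (hasFDerivAt_const v x)))
  have h' : HasFDerivAt (fun y => L y u v k) _ x := h
  rw [h'.fderiv]
  simp

theorem fderiv_bilin_apply {E F : Type*} [NormedAddCommGroup E] [NormedSpace ℝ E]
    [NormedAddCommGroup F] [NormedSpace ℝ F]
    {L : E → F →L[ℝ] F →L[ℝ] ℝ} {x : E}
    (hL : DifferentiableAt ℝ L x) (w : E) (u v : F) :
    fderiv ℝ L x w u v = fderiv ℝ (fun y => L y u v) x w := by
  have h := (hL.hasFDerivAt.clm_apply (hasFDerivAt_const u x)).clm_apply (hasFDerivAt_const v x)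
  rw [h.fderiv]
  simp

/-- The minus sign reconciles the two conventions: `riem` is the commutator of covariant
derivatives, and `curvature` its opposite. -/
theorem riem_coordVec {Γ : ConnectionCoeffs n} {x : Coord n}
    (hΓ : DifferentiableAt ℝ (connForm Γ) x) (i j k l : Fin n) :
    riem (connForm Γ) x (coordVec i) (coordVec j) (coordVec k) l = -curvature Γ i j k l x := by
  have h2 : ∀ i j k, connForm Γ x (coordVec i) (connForm Γ x (coordVec j) (coordVec k)) l
      = ∑ m, Γ i m l x * Γ j k m x := by
    intro i j k
    conv_lhs => rw [eq_sum_coordVec (connForm Γ x (coordVec j) (coordVec k)), map_sum]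
    simp only [connForm_coordVec, map_smul, WithLp.ofLp_sum, Finset.sum_apply, PiLp.smul_apply,
      smul_eq_mul, mul_comm]
  rw [curvature, neg_neg, Finset.sum_sub_distrib, ← h2, ← h2]
  simp only [riem, PiLp.add_apply, PiLp.sub_apply, fderiv_bilin_coord hΓ, connForm_coordVec]
  simp only [partialDeriv]
  ring

theorem hessForm_coordVec {Γ : ConnectionCoeffs n} {F : Coord n → ℝ} {x : Coord n}
    (hF : DifferentiableAt ℝ (fderiv ℝ F) x) (i j : Fin n) :
    hessForm (connForm Γ) F x (coordVec i) (coordVec j) = hessian Γ F i j x := by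
  rw [hessForm_apply, hessian, fderiv_apply_eq_sum]
  have h := (hF.hasFDerivAt.clm_apply (hasFDerivAt_const (coordVec j) x))
  have h' : HasFDerivAt (partialDeriv j F) _ x := h
  simp only [connForm_coordVec]
  congr 1
  rw [partialDeriv, h'.fderiv]
  simp

theorem curvatureTensor_eq {G : Coord n → Matrix (Fin n) (Fin n) ℝ} {x : Coord n}
    (hΓ : DifferentiableAt ℝ (connForm (christoffel G)) x) (i j k l : Fin n) :
    curvatureTensor G i j k l x =
      -matrixForm (G x) (riem (connForm (christoffel G)) x (coordVec i) (coordVec j) (coordVec k))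
        (coordVec l) := by
  rw [curvatureTensor, matrixForm_apply, ← Finset.sum_neg_distrib]
  refine Finset.sum_congr rfl fun m _ => ?_
  simp [riem_coordVec hΓ, PiLp.single_apply, mul_comm]

/-! ### The Levi-Civita connection of a matrix of components -/

theorem contDiffOn_matrix_det {E : Type*} [NormedAddCommGroup E] [NormedSpace ℝ E]
    {G : E → Matrix (Fin n) (Fin n) ℝ} {U : Set E}
    (hG : ∀ i j, ContDiffOn ℝ ∞ (fun x => G x i j) U) :
    ContDiffOn ℝ ∞ (fun x => (G x).det) U := by
  simp only [Matrix.det_apply']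
  exact ContDiffOn.sum fun σ _ => contDiffOn_const.mul (contDiffOn_prod fun i _ => hG _ _)

theorem contDiffOn_matrix_inv {E : Type*} [NormedAddCommGroup E] [NormedSpace ℝ E]
    {G : E → Matrix (Fin n) (Fin n) ℝ} {U : Set E}
    (hG : ∀ i j, ContDiffOn ℝ ∞ (fun x => G x i j) U) (hdet : ∀ x ∈ U, (G x).det ≠ 0)
    (i j : Fin n) : ContDiffOn ℝ ∞ (fun x => (G x)⁻¹ i j) U := by
  simp only [Matrix.inv_def, Ring.inverse_eq_inv', Matrix.smul_apply, smul_eq_mul,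
    Matrix.adjugate_apply]
  refine ((contDiffOn_matrix_det hG).inv hdet).mul (contDiffOn_matrix_det fun k l => ?_)
  simp only [Matrix.updateRow_apply]
  split_ifs
  exacts [contDiffOn_const, hG k l]

theorem contDiffOn_partialDeriv {F : Coord n → ℝ} {U : Set (Coord n)} (hU : IsOpen U)
    (hF : ContDiffOn ℝ ∞ F U) (i : Fin n) : ContDiffOn ℝ ∞ (partialDeriv i F) U :=
  (hF.fderiv_of_isOpen hU (m := ∞) (by simp)).clm_apply contDiffOn_const

theorem contDiffOn_christoffel {G : Coord n → Matrix (Fin n) (Fin n) ℝ} {U : Set (Coord n)}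
    (hU : IsOpen U) (hG : ∀ i j, ContDiffOn ℝ ∞ (fun x => G x i j) U)
    (hdet : ∀ x ∈ U, (G x).det ≠ 0) (i j k : Fin n) : ContDiffOn ℝ ∞ (christoffel G i j k) U := by
  refine contDiffOn_const.mul (ContDiffOn.sum fun l _ => (contDiffOn_matrix_inv hG hdet k l).mul ?_)
  exact ((contDiffOn_partialDeriv hU (hG j l) i).add (contDiffOn_partialDeriv hU (hG i l) j)).sub
    (contDiffOn_partialDeriv hU (hG i j) l)

theorem christoffel_lower {G : Coord n → Matrix (Fin n) (Fin n) ℝ} {x : Coord n}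
    (hdet : (G x).det ≠ 0) (i j m : Fin n) :
    ∑ k, G x m k * christoffel G i j k x = (1 / 2 : ℝ) *
      (partialDeriv i (fun y => G y j m) x + partialDeriv j (fun y => G y i m) x
        - partialDeriv m (fun y => G y i j) x) := by
  have h : ∑ k, G x m k * christoffel G i j k x = (1 / 2 : ℝ) * (G x).mulVec ((G x)⁻¹.mulVec
      fun l => partialDeriv i (fun y => G y j l) x + partialDeriv j (fun y => G y i l) x
        - partialDeriv l (fun y => G y i j) x) m := by
    simp only [christoffel, Matrix.mulVec, dotProduct, Finset.mul_sum]
    refine Finset.sum_congr rfl fun k _ => Finset.sum_congr rfl fun l _ => by ring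
  rw [h, Matrix.mulVec_mulVec, Matrix.mul_nonsing_inv _ (isUnit_iff_ne_zero.2 hdet),
    Matrix.one_mulVec]

theorem det_ne_zero_of_nondegenerate {A : Matrix (Fin n) (Fin n) ℝ}
    (h : ∀ u, (∀ v, matrixForm A u v = 0) → u = 0) : A.det ≠ 0 := by
  intro h0
  obtain ⟨v, hv, hv0⟩ := Matrix.exists_vecMul_eq_zero_iff.2 h0
  refine hv (WithLp.toLp_injective 2 (h (WithLp.toLp 2 v) fun w => ?_))
  rw [matrixForm_apply, Finset.sum_comm]
  refine Finset.sum_eq_zero fun j _ => ?_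
  have := congrFun hv0 j
  simp only [Matrix.vecMul, dotProduct, Pi.zero_apply] at this
  have e : ∀ i, A i j * (v i * w j) = v i * A i j * w j := fun i => by ring
  simp only [e, ← Finset.sum_mul, this, zero_mul]

/-- This is the bridge from the component formulas to the coordinate-free calculus. Symmetry of `G`
gives absence of torsion, and the Koszul formula gives compatibility. -/
theorem isLeviCivita_christoffel {G : Coord n → Matrix (Fin n) (Fin n) ℝ} {U : Set (Coord n)}
    (hU : IsOpen U) (hG : ∀ i j, ContDiffOn ℝ ∞ (fun x => G x i j) U)
    (hsymm : ∀ x ∈ U, ∀ i j, G x i j = G x j i)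
    (hnd : ∀ x ∈ U, ∀ u, (∀ v, matrixForm (G x) u v = 0) → u = 0) :
    IsLeviCivita U (fun x => matrixForm (G x)) (connForm (christoffel G)) := by
  have hdet : ∀ x ∈ U, (G x).det ≠ 0 := fun x hx => det_ne_zero_of_nondegenerate (hnd x hx)
  have hp : ∀ x ∈ U, ∀ i j k, partialDeriv k (fun y => G y i j) x = partialDeriv k (fun y => G y j i) x :=
    fun x hx i j k => partialDeriv_congr hU (fun y hy => hsymm y hy i j) hx k
  refine ⟨hU, contDiffOn_matrixForm hG, contDiffOn_connForm (contDiffOn_christoffel hU hG hdet),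
    fun x hx u v => ?_, hnd, fun x hx u v => ?_, fun x hx w u v => ?_⟩
  · rw [matrixForm_apply, matrixForm_apply, Finset.sum_comm]
    refine Finset.sum_congr rfl fun i _ => Finset.sum_congr rfl fun j _ => ?_
    rw [hsymm x hx, mul_comm (u j)]
  · have : connForm (christoffel G) x = (connForm (christoffel G) x).flip := by
      refine bilin_ext_coordVec fun i j => ?_
      ext k
      rw [ContinuousLinearMap.flip_apply, connForm_coordVec, connForm_coordVec, christoffel,
        christoffel]
      congr 1
      refine Finset.sum_congr rfl fun l _ => ?_
      rw [hp x hx i j]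
      ring
    conv_lhs => rw [this]
    rfl
  · have hd : DifferentiableAt ℝ (fun x => matrixForm (G x)) x :=
      ((contDiffOn_matrixForm hG).contDiffAt (hU.mem_nhds hx)).differentiableAt (by simp)
    set Γ := connForm (christoffel G) x with hΓ
    set D := fderiv ℝ (fun x => matrixForm (G x)) x
    set A := matrixForm (G x) with hA
    have low : ∀ k i j, A (Γ (coordVec k) (coordVec i)) (coordVec j) = (1 / 2 : ℝ) *
        (partialDeriv k (fun y => G y i j) x + partialDeriv i (fun y => G y k j) x
          - partialDeriv j (fun y => G y k i) x) := by
      intro k i j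
      rw [← christoffel_lower (hdet x hx), hA, matrixForm_apply]
      refine Finset.sum_congr rfl fun m _ => ?_
      rw [hsymm x hx]
      simp [PiLp.single_apply, hΓ]
    have hAs : ∀ u v, A u v = A v u := by
      intro u v
      rw [hA, matrixForm_apply, matrixForm_apply, Finset.sum_comm]
      refine Finset.sum_congr rfl fun i _ => Finset.sum_congr rfl fun j _ => ?_
      rw [hsymm x hx, mul_comm (u j)]
    have e₁ : ∀ k i j, D (coordVec k) (coordVec i) (coordVec j) =
        A (Γ (coordVec k) (coordVec i)) (coordVec j) + A (coordVec i) (Γ (coordVec k) (coordVec j)) := by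
      intro k i j
      rw [hAs (coordVec i), low, low, fderiv_bilin_apply hd]
      simp only [matrixForm_coordVec, hp x hx j i]
      simp only [partialDeriv]
      ring
    -- Compatibility is trilinear, so it is extended from basis vectors to all vectors one slot at a
    -- time.
    have e₂ : ∀ k i, D (coordVec k) (coordVec i) = A (Γ (coordVec k) (coordVec i))
        + (A (coordVec i)).comp (Γ (coordVec k)) := fun k i => linear_ext_coordVec fun j => e₁ k i j
    have e₃ : ∀ k, (D (coordVec k)).flip v = (A.flip v).comp (Γ (coordVec k))
        + A.flip (Γ (coordVec k) v) := fun k => linear_ext_coordVec fun i => by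
      simpa using congrArg (fun L => L v) (e₂ k i)
    have e₄ : (D.flip u).flip v = (A.flip v).comp (Γ.flip u) + (A u).comp (Γ.flip v) :=
      linear_ext_coordVec fun k => by simpa using congrArg (fun L => L u) (e₃ k)
    simpa using congrArg (fun L => L w) e₄

end


noncomputable section

set_option maxSynthPendingDepth 3

/-! ### Invariance of the curvature under isometries -/

variable {E E' : Type*} [NormedAddCommGroup E] [NormedSpace ℝ E]
  [NormedAddCommGroup E'] [NormedSpace ℝ E'] {U : Set E} {V : Set E'}
  {B : E → E →L[ℝ] E →L[ℝ] ℝ} {Γ : E → E →L[ℝ] E →L[ℝ] E}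
  {B' : E' → E' →L[ℝ] E' →L[ℝ] ℝ} {Γ' : E' → E' →L[ℝ] E' →L[ℝ] E'} {Ψ : E' → E}

/-- The transformation law of the Levi-Civita connection. -/
theorem IsLeviCivita.map_conn (h : IsLeviCivita U B Γ) (h' : IsLeviCivita V B' Γ')
    (hΨ : ContDiffOn ℝ ∞ Ψ V) (hVU : Set.MapsTo Ψ V U)
    (hB : ∀ z ∈ V, ∀ u v, B' z u v = B (Ψ z) (fderiv ℝ Ψ z u) (fderiv ℝ Ψ z v))
    (hsurj : ∀ z ∈ V, Function.Surjective (fderiv ℝ Ψ z)) {z : E'} (hz : z ∈ V) (u v : E') :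
    fderiv ℝ Ψ z (Γ' z u v) = fderiv ℝ (fderiv ℝ Ψ) z u v
      + Γ (Ψ z) (fderiv ℝ Ψ z u) (fderiv ℝ Ψ z v) := by
  set J := fderiv ℝ Ψ with hJ
  have hΨz := hΨ.contDiffAt (h'.isOpen.mem_nhds hz)
  have hJd : HasFDerivAt J (fderiv ℝ J z) z :=
    ((hΨz.fderiv_right (m := ∞) (by simp)).differentiableAt (by simp)).hasFDerivAt
  have hΨd : HasFDerivAt Ψ (J z) z := (hΨz.differentiableAt (by simp)).hasFDerivAt
  have hsy := h.symm _ (hVU hz)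
  -- The difference between the pulled back and the actual connection. It is symmetric in its
  -- arguments and skew with respect to the metric, hence zero by the argument that proves
  -- uniqueness of the Levi-Civita connection.
  set S : E' → E' → E := fun u v => J z (Γ' z u v) - fderiv ℝ J z u v - Γ (Ψ z) (J z u) (J z v)
    with hS
  have S_symm : ∀ u v, S u v = S v u := fun u v => by
    simp only [hS]
    rw [h'.torsion_free z hz, h.torsion_free _ (hVU hz), hJ, hΨz.isSymmSndFDerivAt minSmoothness_two_le]
  have S_skew : ∀ w u v, B (Ψ z) (S w u) (J z v) + B (Ψ z) (J z u) (S w v) = 0 := by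
    intro w u v
    have e₁ := ((h'.hasFDerivAt_metric hz).clm_apply (hasFDerivAt_const u z)).clm_apply
      (hasFDerivAt_const v z)
    have e₂ := (((h.hasFDerivAt_metric (hVU hz)).comp z hΨd).clm_apply
      (hJd.clm_apply (hasFDerivAt_const u z))).clm_apply (hJd.clm_apply (hasFDerivAt_const v z))
    have e₃ := e₁.unique (e₂.congr_of_eventuallyEq (by
      filter_upwards [h'.isOpen.mem_nhds hz] with y hy using hB y hy u v))
    have e₄ := congrArg (fun L => L w) e₃
    simp at e₄
    rw [h'.compat z hz, h.compat _ (hVU hz), hB z hz, hB z hz] at e₄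
    simp only [hS, map_sub, sub_apply]
    linarith
  have T_zero : ∀ w u v, B (Ψ z) (S w u) (J z v) = 0 := by
    intro w u v
    have s := fun w u v => S_skew w u v
    have a₁ := s w u v
    have a₂ := s u v w
    have a₃ := s v w u
    rw [hsy (J z _)] at a₁ a₂ a₃
    rw [S_symm v w] at a₃
    rw [S_symm u w] at a₂
    rw [S_symm v u] at a₃
    linarith
  have := h.nondegenerate _ (hVU hz) (S u v) fun t => by
    obtain ⟨t, rfl⟩ := hsurj z hz t
    exact T_zero u v t
  simp only [hS, sub_sub, sub_eq_zero] at this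
  exact this

/-- Differentiating the transformation law of the connection and antisymmetrising removes the second
and third derivatives of `Ψ`, by their symmetry. The null frame calculus can thus stay in the
original chart while the curvature is read off in Walker coordinates. -/
theorem IsLeviCivita.map_riem (h : IsLeviCivita U B Γ) (h' : IsLeviCivita V B' Γ')
    (hΨ : ContDiffOn ℝ ∞ Ψ V) (hVU : Set.MapsTo Ψ V U)
    (hB : ∀ z ∈ V, ∀ u v, B' z u v = B (Ψ z) (fderiv ℝ Ψ z u) (fderiv ℝ Ψ z v))
    (hsurj : ∀ z ∈ V, Function.Surjective (fderiv ℝ Ψ z)) {z : E'} (hz : z ∈ V) (u v w : E') :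
    fderiv ℝ Ψ z (riem Γ' z u v w)
      = riem Γ (Ψ z) (fderiv ℝ Ψ z u) (fderiv ℝ Ψ z v) (fderiv ℝ Ψ z w) := by
  have key := fun {z} (hz : z ∈ V) (u v : E') => h.map_conn h' hΨ hVU hB hsurj hz u v
  set J := fderiv ℝ Ψ with hJ
  have hΨz := hΨ.contDiffAt (h'.isOpen.mem_nhds hz)
  have hJs := hΨz.fderiv_right (m := ∞) (by simp)
  have hJd : HasFDerivAt J (fderiv ℝ J z) z := (hJs.differentiableAt (by simp)).hasFDerivAt
  have hJJd : HasFDerivAt (fderiv ℝ J) (fderiv ℝ (fderiv ℝ J) z) z :=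
    ((hJs.fderiv_right (m := ∞) (by simp)).differentiableAt (by simp)).hasFDerivAt
  have hΨd : HasFDerivAt Ψ (J z) z := (hΨz.differentiableAt (by simp)).hasFDerivAt
  have symm₂ : ∀ u v, fderiv ℝ J z u v = fderiv ℝ J z v u :=
    hΨz.isSymmSndFDerivAt minSmoothness_two_le
  have symm₃ : ∀ u v, fderiv ℝ (fderiv ℝ J) z u v = fderiv ℝ (fderiv ℝ J) z v u :=
    hJs.isSymmSndFDerivAt minSmoothness_two_le
  have D : ∀ u v, fderiv ℝ J z u (Γ' z v w) + J z (fderiv ℝ Γ' z u v w)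
      = fderiv ℝ (fderiv ℝ J) z u v w + (fderiv ℝ Γ (Ψ z) (J z u) (J z v) (J z w)
        + Γ (Ψ z) (fderiv ℝ J z u v) (J z w) + Γ (Ψ z) (J z v) (fderiv ℝ J z u w)) := by
    intro u v
    have e₁ := hJd.clm_apply (((h'.hasFDerivAt_conn hz).clm_apply (hasFDerivAt_const v z)).clm_apply
      (hasFDerivAt_const w z))
    have e₂ := ((hJJd.clm_apply (hasFDerivAt_const v z)).clm_apply (hasFDerivAt_const w z)).add
      ((((h.hasFDerivAt_conn (hVU hz)).comp z hΨd).clm_apply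
      (hJd.clm_apply (hasFDerivAt_const v z))).clm_apply (hJd.clm_apply (hasFDerivAt_const w z)))
    have e₃ := e₁.unique (e₂.congr_of_eventuallyEq (by
      filter_upwards [h'.isOpen.mem_nhds hz] with y hy using key hy v w))
    have e₄ := congrArg (fun L => L u) e₃
    simp at e₄
    rw [add_comm (fderiv ℝ J z u _), e₄]
    abel
  have d₁ := D u v
  have d₂ := D v u
  rw [← eq_sub_iff_add_eq'] at d₁ d₂
  simp only [riem, map_add, map_sub, key hz, d₁, d₂, symm₂ v u, symm₃ v u]
  abel

end


noncomputable section

set_option maxSynthPendingDepth 3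

/-! ### Existence of null frames -/

section

variable {E : Type*} [NormedAddCommGroup E] [NormedSpace ℝ E]

/-- The Gram relations make four vectors linearly independent, hence a basis in dimension four. A
vector minus its expansion is orthogonal to that basis, so it vanishes by nondegeneracy. -/
theorem IsNullFrame.of_relations {g : E →L[ℝ] E →L[ℝ] ℝ} (hdim : Module.finrank ℝ E = 4)
    (hg : ∀ u v, g u v = g v u) (hnd : ∀ u, (∀ v, g u v = 0) → u = 0) {n₁ n₂ m₁ m₂ : E}
    (n₁n₁ : g n₁ n₁ = 0) (n₁n₂ : g n₁ n₂ = 0) (n₁m₁ : g n₁ m₁ = 1) (n₁m₂ : g n₁ m₂ = 0)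
    (n₂n₂ : g n₂ n₂ = 0) (n₂m₁ : g n₂ m₁ = 0) (n₂m₂ : g n₂ m₂ = 1) (m₁m₁ : g m₁ m₁ = 0)
    (m₁m₂ : g m₁ m₂ = 0) (m₂m₂ : g m₂ m₂ = 0) : IsNullFrame g n₁ n₂ m₁ m₂ := by
  refine ⟨n₁n₁, n₁n₂, n₁m₁, n₁m₂, n₂n₂, n₂m₁, n₂m₂, m₁m₁, m₁m₂, m₂m₂, fun v => ?_⟩
  have hli : LinearIndependent ℝ ![n₁, n₂, m₁, m₂] := by
    rw [Fintype.linearIndependent_iff]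
    intro c hc
    simp only [Fin.sum_univ_four, Matrix.cons_val] at hc
    have h := fun w => congrArg (g w) hc
    have h₁ := h m₁
    have h₂ := h m₂
    have h₃ := h n₁
    have h₄ := h n₂
    simp only [map_add, map_smul, map_zero, hg m₁ n₁, hg m₁ n₂, hg m₂ n₁, hg m₂ n₂, hg m₂ m₁,
      hg n₂ n₁, n₁n₁, n₁n₂, n₁m₁, n₁m₂, n₂n₂, n₂m₁, n₂m₂, m₁m₁, m₁m₂, m₂m₂, smul_eq_mul, mul_zero,
      mul_one, add_zero, zero_add] at h₁ h₂ h₃ h₄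
    intro i
    fin_cases i <;> assumption
  have hspan := hli.span_eq_top_of_card_eq_finrank (by simp [hdim])
  refine sub_eq_zero.1 (hnd _ fun w => ?_)
  have hw : w ∈ Submodule.span ℝ (Set.range ![n₁, n₂, m₁, m₂]) := hspan ▸ Submodule.mem_top
  induction hw using Submodule.span_induction with
  | mem w hw =>
    obtain ⟨i, rfl⟩ := hw
    fin_cases i <;>
    simp [hg m₁ n₁, hg m₁ n₂, hg m₂ n₁, hg m₂ n₂, hg m₂ m₁,
      hg n₂ n₁, n₁n₁, n₁n₂, n₁m₁, n₁m₂, n₂n₂, n₂m₁, n₂m₂, m₁m₁, m₁m₂, m₂m₂]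
  | zero => simp
  | add u v _ _ hu hv => rw [map_add, hu, hv, add_zero]
  | smul c u _ hu => rw [map_smul, hu, smul_zero]

/-- Exchanging `n₂` with `m₂` keeps the gradient and reverses the orientation, so one of the two
null planes through `n₁` always lies on the required side. -/
theorem IsNullFrame.swap {g : E →L[ℝ] E →L[ℝ] ℝ} (hg : ∀ u v, g u v = g v u) {n₁ n₂ m₁ m₂ : E}
    (h : IsNullFrame g n₁ n₂ m₁ m₂) : IsNullFrame g n₁ m₂ m₁ n₂ where
  n₁n₁ := h.n₁n₁
  n₁n₂ := h.n₁m₂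
  n₁m₁ := h.n₁m₁
  n₁m₂ := h.n₁n₂
  n₂n₂ := h.m₂m₂
  n₂m₁ := (hg _ _).trans h.m₁m₂
  n₂m₂ := (hg _ _).trans h.n₂m₂
  m₁m₁ := h.m₁m₁
  m₁m₂ := (hg _ _).trans h.n₂m₁
  m₂m₂ := h.n₂n₂
  expand v := (h.expand v).trans (by abel)

variable {U : Set E} {B : E → E →L[ℝ] E →L[ℝ] ℝ} {n : E → E}

theorem exists_smooth_dual_null (hU : IsOpen U) (hB : ContDiffOn ℝ ∞ B U)
    (hsymm : ∀ y ∈ U, ∀ u v, B y u v = B y v u) (hn : ContDiffOn ℝ ∞ n U)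
    (hnull : ∀ y ∈ U, B y (n y) (n y) = 0) {x : E} (hx : x ∈ U) {c : E} (hc : B x (n x) c ≠ 0) :
    ∃ (T : Set E) (m : E → E), IsOpen T ∧ x ∈ T ∧ T ⊆ U ∧ ContDiffOn ℝ ∞ m T ∧
      ∀ y ∈ T, B y (n y) (m y) = 1 ∧ B y (m y) (m y) = 0 := by
  have hk : ContDiffOn ℝ ∞ (fun y => B y (n y) c) U := (hB.clm_apply hn).clm_apply contDiffOn_const
  have hcc : ContDiffOn ℝ ∞ (fun y => B y c c) U :=
    (hB.clm_apply contDiffOn_const).clm_apply contDiffOn_const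
  refine ⟨U ∩ (fun y => B y (n y) c) ⁻¹' {0}ᶜ,
    -- The constant vector `c` is scaled to have product one with `n`, then made null by subtracting
    -- a multiple of `n`, which does not change that product.
    fun y => (B y (n y) c)⁻¹ • c - (1 / 2 * B y c c * ((B y (n y) c)⁻¹) ^ 2) • n y,
    hk.continuousOn.isOpen_inter_preimage hU isOpen_compl_singleton, ⟨hx, hc⟩,
    Set.inter_subset_left, ?_, ?_⟩
  · have hki := (hk.mono Set.inter_subset_left).inv (s := U ∩ (fun y => B y (n y) c) ⁻¹' {0}ᶜ)
      fun y hy => hy.2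
    exact (hki.smul contDiffOn_const).sub (((contDiffOn_const.mul (hcc.mono Set.inter_subset_left)).mul
      (hki.pow 2)).smul (hn.mono Set.inter_subset_left))
  · rintro y ⟨hy, hy0⟩
    have hy0 : B y (n y) c ≠ 0 := hy0
    simp only [map_sub, map_smul, sub_apply, smul_apply, smul_eq_mul, hnull y hy,
      hsymm y hy c (n y)]
    constructor
    · field_simp; ring
    · field_simp; ring

/-- A null vector field extends near a point to a smooth null frame. -/
theorem exists_smooth_nullFrame (hdim : Module.finrank ℝ E = 4) (hU : IsOpen U)
    (hB : ContDiffOn ℝ ∞ B U) (hsymm : ∀ y ∈ U, ∀ u v, B y u v = B y v u)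
    (hnd : ∀ y ∈ U, ∀ u, (∀ v, B y u v = 0) → u = 0) (hn : ContDiffOn ℝ ∞ n U)
    (hnull : ∀ y ∈ U, B y (n y) (n y) = 0) {x : E} (hx : x ∈ U) (hnx : n x ≠ 0)
    {q r : E} (hq : B x q (n x) = 0) (hqq : 0 < B x q q) (hr : B x r (n x) = 0)
    (hrr : B x r r < 0) :
    ∃ (T : Set E) (n₂ m₁ m₂ : E → E), IsOpen T ∧ x ∈ T ∧ T ⊆ U ∧ ContDiffOn ℝ ∞ n₂ T ∧
      ContDiffOn ℝ ∞ m₁ T ∧ ContDiffOn ℝ ∞ m₂ T ∧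
      ∀ y ∈ T, IsNullFrame (B y) (n y) (n₂ y) (m₁ y) (m₂ y) := by
  obtain ⟨c, hc⟩ : ∃ c, B x (n x) c ≠ 0 := by
    by_contra! h
    exact hnx (hnd x hx _ h)
  obtain ⟨T₁, m, hT₁, hxT₁, hT₁U, hm, hmr⟩ := exists_smooth_dual_null hU hB hsymm hn hnull hx hc
  have hB₁ := hB.mono hT₁U
  have hn₁ := hn.mono hT₁U
  have pair : ∀ {T : Set E} {u v : E → E}, T ⊆ T₁ → ContDiffOn ℝ ∞ u T → ContDiffOn ℝ ∞ v T →
      ContDiffOn ℝ ∞ (fun y => B y (u y) (v y)) T := fun hT hu hv =>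
    ((hB₁.mono hT).clm_apply hu).clm_apply hv
  -- The projection onto the orthogonal complement of the hyperbolic plane spanned by `n` and `m`.
  set P : E → E → E := fun c y => c - B y c (m y) • n y - B y c (n y) • m y with hP
  have hPs : ∀ c, ContDiffOn ℝ ∞ (P c) T₁ := fun c =>
    (contDiffOn_const.sub ((pair subset_rfl contDiffOn_const hm).smul hn₁)).sub
      ((pair subset_rfl contDiffOn_const hn₁).smul hm)
  have hPn : ∀ c, ∀ y ∈ T₁, B y (n y) (P c y) = 0 := fun c y hy => by
    simp only [hP, map_sub, map_smul, smul_eq_mul, hnull y (hT₁U hy), (hmr y hy).1,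
      hsymm y (hT₁U hy) (n y) c]
    ring
  have hPm : ∀ c, ∀ y ∈ T₁, B y (m y) (P c y) = 0 := fun c y hy => by
    simp only [hP, map_sub, map_smul, smul_eq_mul, (hmr y hy).2, hsymm y (hT₁U hy) (m y) (n y),
      (hmr y hy).1, hsymm y (hT₁U hy) (m y) c]
    ring
  have hPP : ∀ c, B x c (n x) = 0 → B x (P c x) (P c x) = B x c c := fun c hc => by
    simp only [hP, map_sub, map_smul, smul_eq_mul, hnull x hx, (hmr x hxT₁).2, sub_apply, smul_apply,
      hsymm x hx (m x) (n x), (hmr x hxT₁).1, hsymm x hx (m x) c, hsymm x hx (n x) c, hc]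
    ring
  set α : E → ℝ := fun y => B y (P q y) (P q y) with hα
  have hαs : ContDiffOn ℝ ∞ α T₁ := pair subset_rfl (hPs q) (hPs q)
  set T₂ := T₁ ∩ α ⁻¹' Set.Ioi 0 with hT₂
  have hT₂o : IsOpen T₂ := hαs.continuousOn.isOpen_inter_preimage hT₁ isOpen_Ioi
  have hT₂₁ : T₂ ⊆ T₁ := Set.inter_subset_left
  have hxT₂ : x ∈ T₂ := ⟨hxT₁, by simpa [hα, hPP q hq] using hqq⟩
  have hα0 : ∀ y ∈ T₂, 0 < α y := fun y hy => hy.2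
  -- A Gram-Schmidt step: `P q` is positive and `b` is orthogonal to it and still negative at `x`.
  set b : E → E := fun y => P r y - (B y (P q y) (P r y) * (α y)⁻¹) • P q y with hb
  have hbs : ContDiffOn ℝ ∞ b T₂ := ((hPs r).mono hT₂₁).sub
    (((pair hT₂₁ ((hPs q).mono hT₂₁) ((hPs r).mono hT₂₁)).mul
      ((hαs.mono hT₂₁).inv fun y hy => (hα0 y hy).ne')).smul ((hPs q).mono hT₂₁))
  have hab : ∀ y ∈ T₂, B y (P q y) (b y) = 0 := fun y hy => by
    have := (hα0 y hy).ne'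
    simp only [hb, map_sub, map_smul, smul_eq_mul]
    change B y (P q y) (P r y) - B y (P q y) (P r y) * (α y)⁻¹ * α y = 0
    field_simp
    ring
  have hbn : ∀ y ∈ T₂, B y (n y) (b y) = 0 := fun y hy => by
    simp [hb, hPn _ y (hT₂₁ hy)]
  have hbm : ∀ y ∈ T₂, B y (m y) (b y) = 0 := fun y hy => by
    simp [hb, hPm _ y (hT₂₁ hy)]
  set γ : E → ℝ := fun y => B y (b y) (b y) with hγ
  have hγs : ContDiffOn ℝ ∞ γ T₂ := pair hT₂₁ hbs hbs
  have hγx : γ x < 0 := by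
    have h₁ : γ x = B x (P r x) (b x) := by
      have e : b x = P r x - (B x (P q x) (P r x) * (α x)⁻¹) • P q x := rfl
      exact (congrArg (B x (b x)) e).trans (by
        rw [map_sub, map_smul, hsymm x hx (b x) (P q x), hab x hxT₂, smul_zero, sub_zero,
          hsymm x hx])
    have h₂ : γ x = B x r r - (B x (P q x) (P r x)) ^ 2 * (α x)⁻¹ := by
      rw [h₁]
      simp only [hb, map_sub, map_smul, smul_eq_mul, hPP r hr, hsymm x hx (P r x) (P q x)]
      ring
    rw [h₂]
    have := mul_nonneg (sq_nonneg (B x (P q x) (P r x))) (inv_nonneg.2 (hα0 x hxT₂).le)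
    linarith
  set T := T₂ ∩ γ ⁻¹' Set.Iio 0 with hT
  have hTo : IsOpen T := hγs.continuousOn.isOpen_inter_preimage hT₂o isOpen_Iio
  have hTT₂ : T ⊆ T₂ := Set.inter_subset_left
  have hTT₁ : T ⊆ T₁ := hTT₂.trans hT₂₁
  have hγ0 : ∀ y ∈ T, γ y < 0 := fun y hy => hy.2
  -- With this scaling `b + s P q` and `b - s P q` are null and have scalar product `2γ`, which
  -- explains the factor `(2 * γ y)⁻¹` in the dual vector.
  set s : E → ℝ := fun y => √(-γ y * (α y)⁻¹) with hs
  have harg : ∀ y ∈ T, 0 < -γ y * (α y)⁻¹ := fun y hy =>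
    mul_pos (neg_pos.2 (hγ0 y hy)) (inv_pos.2 (hα0 y (hTT₂ hy)))
  have hss : ContDiffOn ℝ ∞ s T := ContDiffOn.sqrt ((hγs.mono hTT₂).neg.mul
    ((hαs.mono hTT₁).inv fun y hy => (hα0 y (hTT₂ hy)).ne')) fun y hy => (harg y hy).ne'
  have hs2 : ∀ y ∈ T, s y * s y * α y = -γ y := fun y hy => by
    have := (hα0 y (hTT₂ hy)).ne'
    rw [hs]
    simp only
    rw [Real.mul_self_sqrt (harg y hy).le]
    field_simp
  have has := (hPs q).mono hTT₁
  refine ⟨T, fun y => b y + s y • P q y, m, fun y => (2 * γ y)⁻¹ • (b y - s y • P q y), hTo,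
    ⟨hxT₂, hγx⟩, hTT₁.trans hT₁U, (hbs.mono hTT₂).add (hss.smul has), hm.mono hTT₁,
    ((contDiffOn_const.mul (hγs.mono hTT₂)).inv fun y hy => mul_ne_zero two_ne_zero (hγ0 y hy).ne).smul
      ((hbs.mono hTT₂).sub (hss.smul has)), fun y hy => ?_⟩
  have hyU := hT₁U (hTT₁ hy)
  have hs' := hsymm y hyU
  have hγy := (hγ0 y hy).ne
  have r₁ := hPn q y (hTT₁ hy)
  have r₂ := hPm q y (hTT₁ hy)
  have r₃ := hbn y (hTT₂ hy)
  have r₄ := hbm y (hTT₂ hy)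
  have r₅ := hab y (hTT₂ hy)
  have r₆ : B y (P q y) (P q y) = α y := rfl
  have r₇ : B y (b y) (b y) = γ y := rfl
  have r₈ := hs2 y hy
  refine IsNullFrame.of_relations hdim hs' (hnd y hyU) (hnull y hyU) ?_ (hmr y (hTT₁ hy)).1 ?_ ?_ ?_
    ?_ (hmr y (hTT₁ hy)).2 ?_ ?_
  all_goals simp only [map_add, map_sub, map_smul, add_apply, sub_apply, smul_apply, smul_eq_mul,
    hs' (P q y) (m y), hs' (b y) (m y), hs' (b y) (P q y), r₁, r₂, r₃, r₄, r₅, r₆, r₇]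
  · ring
  · ring
  · linear_combination r₈
  · ring
  · field_simp
    linear_combination -r₈
  · ring
  · linear_combination ((2 * γ y)⁻¹) ^ 2 * r₈

end

/-- In an orthogonal basis of signature `(2,2)` there are vectors of both signs orthogonal to a
given vector. -/
theorem exists_orthogonal_of_neutral {E : Type*} [NormedAddCommGroup E] [NormedSpace ℝ E]
    {g : E →L[ℝ] E →L[ℝ] ℝ} {w : Fin 4 → E}
    (hw : ∀ i j, g (w i) (w j) = if i = j then (![-1, -1, 1, 1] : Fin 4 → ℝ) i else 0) (n : E) :
    (∃ q, g q n = 0 ∧ 0 < g q q) ∧ ∃ r, g r n = 0 ∧ g r r < 0 := by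
  have aux : ∀ i j : Fin 4, i ≠ j → ∀ ε : ℝ, ε ≠ 0 → g (w i) (w i) = ε → g (w j) (w j) = ε →
      ∃ q, g q n = 0 ∧ 0 < ε * g q q := by
    intro i j hij ε hε hi hj
    have hij' : g (w i) (w j) = 0 := by rw [hw, if_neg hij]
    have hji' : g (w j) (w i) = 0 := by rw [hw, if_neg hij.symm]
    by_cases h : g (w i) n = 0
    · exact ⟨w i, h, by rw [hi]; exact mul_self_pos.2 hε⟩
    · refine ⟨g (w j) n • w i - g (w i) n • w j, by simp; ring, ?_⟩
      simp only [map_sub, map_smul, sub_apply, smul_apply, smul_eq_mul, hi, hj, hij', hji']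
      have : 0 < g (w i) n ^ 2 := by positivity
      have h3 : 0 < ε ^ 2 := by positivity
      nlinarith [mul_pos this h3, mul_nonneg (sq_nonneg (g (w j) n)) h3.le]
  constructor
  · obtain ⟨q, h₁, h₂⟩ := aux 2 3 (by decide) 1 one_ne_zero (by simp [hw]) (by simp [hw])
    exact ⟨q, h₁, by simpa using h₂⟩
  · obtain ⟨q, h₁, h₂⟩ := aux 0 1 (by decide) (-1) (by norm_num) (by simp [hw]) (by simp [hw])
    exact ⟨q, h₁, by linarith⟩

end


noncomputable section

set_option maxSynthPendingDepth 3

/-! ### Self-dual metrics with an isotropic potential in coordinates -/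

theorem eq_sum_of_linear {n : ℕ} {f : Coord n → ℝ} (hadd : ∀ u v, f (u + v) = f u + f v)
    (hsmul : ∀ (c : ℝ) u, f (c • u) = c * f u) (u : Coord n) :
    f u = ∑ i, u i * f (coordVec i) := by
  let L : Coord n →ₗ[ℝ] ℝ := { toFun := f, map_add' := hadd, map_smul' := hsmul }
  change L u = _
  conv_lhs => rw [eq_sum_coordVec u, map_sum]
  simp [L]

theorem matrixForm_symm {n : ℕ} {A : Matrix (Fin n) (Fin n) ℝ} (hA : ∀ i j, A i j = A j i)
    (u v : Coord n) : matrixForm A u v = matrixForm A v u := by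
  rw [matrixForm_apply, matrixForm_apply, Finset.sum_comm]
  exact Finset.sum_congr rfl fun i _ => Finset.sum_congr rfl fun j _ => by rw [hA, mul_comm (u j)]

/-- The gradient of `F` as a vector field. -/
def gradientVec {n : ℕ} (G : Coord n → Matrix (Fin n) (Fin n) ℝ) (F : Coord n → ℝ) (x : Coord n) :
    Coord n :=
  WithLp.toLp 2 fun i => gradientCoeff G F i x

theorem matrixForm_gradientVec {n : ℕ} {G : Coord n → Matrix (Fin n) (Fin n) ℝ} {F : Coord n → ℝ}
    {x : Coord n} (hG : ∀ i j, G x i j = G x j i) (hdet : (G x).det ≠ 0) (v : Coord n) :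
    matrixForm (G x) (gradientVec G F x) v = fderiv ℝ F x v := by
  rw [matrixForm_symm hG, matrixForm_apply, fderiv_apply_eq_sum]
  refine Finset.sum_congr rfl fun i _ => ?_
  have h : ∑ j, G x i j * gradientCoeff G F j x = partialDeriv i F x := by
    have := congrFun (Matrix.mulVec_mulVec (fun j => partialDeriv j F x) (G x) (G x)⁻¹) i
    rw [Matrix.mul_nonsing_inv _ (isUnit_iff_ne_zero.2 hdet), Matrix.one_mulVec] at this
    rw [← this]
    rfl
  rw [← h, Finset.mul_sum]
  refine Finset.sum_congr rfl fun j _ => ?_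
  simp only [gradientVec]
  ring

theorem contDiffOn_gradientVec {n : ℕ} {G : Coord n → Matrix (Fin n) (Fin n) ℝ} {F : Coord n → ℝ}
    {U : Set (Coord n)} (hU : IsOpen U) (hG : ∀ i j, ContDiffOn ℝ ∞ (fun x => G x i j) U)
    (hdet : ∀ x ∈ U, (G x).det ≠ 0) (hF : ContDiffOn ℝ ∞ F U) :
    ContDiffOn ℝ ∞ (gradientVec G F) U := by
  rw [contDiffOn_euclidean]
  intro i
  change ContDiffOn ℝ ∞ (gradientCoeff G F i) U
  exact ContDiffOn.sum fun j _ => (contDiffOn_matrix_inv hG hdet i j).mul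
    (contDiffOn_partialDeriv hU hF j)

/-! ### Null frames in components: inverse metric, trace and orientation -/

section

variable {A : Matrix (Fin 4) (Fin 4) ℝ} {n₁ n₂ m₁ m₂ : Coord 4}

/-- The expansion of basis vectors in the null frame says precisely that the symmetrised sum of `n ⊗
m` is a left inverse of the metric. -/
theorem IsNullFrame.matrix_inv (h : IsNullFrame (matrixForm A) n₁ n₂ m₁ m₂)
    (hA : ∀ i j, A i j = A j i) (i j : Fin 4) :
    A⁻¹ i j = n₁ i * m₁ j + m₁ i * n₁ j + (n₂ i * m₂ j + m₂ i * n₂ j) := by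
  have : (Matrix.of fun i j => n₁ i * m₁ j + m₁ i * n₁ j + (n₂ i * m₂ j + m₂ i * n₂ j)) * A = 1 := by
    ext i k
    have low : ∀ u : Coord 4, matrixForm A (coordVec k) u = ∑ j, u j * A j k := fun u => by
      rw [matrixForm_symm hA, matrixForm_apply]
      exact Finset.sum_congr rfl fun j _ => by simp [mul_comm]
    have := congrArg (fun v : Coord 4 => v i) (h.expand (coordVec k))
    simp only [PiLp.add_apply, PiLp.smul_apply, low, smul_eq_mul] at this
    rw [Matrix.mul_apply]
    simp only [Matrix.of_apply, add_mul, mul_assoc, Finset.sum_add_distrib, ← Finset.mul_sum]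
    rw [Matrix.one_apply]
    rw [PiLp.single_apply] at this
    rw [this]
    ring
  rw [Matrix.inv_eq_left_inv this]
  rfl

theorem IsNullFrame.trace_form (h : IsNullFrame (matrixForm A) n₁ n₂ m₁ m₂)
    (hA : ∀ i j, A i j = A j i) (T : Coord 4 →L[ℝ] Coord 4 →L[ℝ] ℝ) :
    ∑ i, ∑ j, A⁻¹ i j * T (coordVec i) (coordVec j) =
      T n₁ m₁ + T m₁ n₁ + (T n₂ m₂ + T m₂ n₂) := by
  simp only [bilin_apply_eq_sum T n₁, bilin_apply_eq_sum T m₁, bilin_apply_eq_sum T n₂,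
    bilin_apply_eq_sum T m₂, ← Finset.sum_add_distrib, h.matrix_inv hA, add_mul]

/-- The matrix of the components of four vectors. -/
def rowMatrix (v₁ v₂ v₃ v₄ : Coord 4) : Matrix (Fin 4) (Fin 4) ℝ :=
  Matrix.of ![fun i => v₁ i, fun i => v₂ i, fun i => v₃ i, fun i => v₄ i]

theorem rowMatrix_swap_det (v₁ v₂ v₃ v₄ : Coord 4) :
    (rowMatrix v₁ v₄ v₃ v₂).det = -(rowMatrix v₁ v₂ v₃ v₄).det := by
  have : rowMatrix v₁ v₄ v₃ v₂ = (rowMatrix v₁ v₂ v₃ v₄).submatrix (Equiv.swap 1 3) id := by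
    ext i j
    fin_cases i <;> simp [rowMatrix, Equiv.swap_apply_def]
  rw [this, Matrix.det_permute, Equiv.Perm.sign_swap (by decide)]
  simp

theorem IsNullFrame.rowMatrix_det_ne_zero {g : Coord 4 →L[ℝ] Coord 4 →L[ℝ] ℝ}
    (h : IsNullFrame g n₁ n₂ m₁ m₂) : (rowMatrix n₁ n₂ m₁ m₂).det ≠ 0 := by
  refine Matrix.det_ne_zero_of_left_inverse (B := Matrix.of fun j =>
    ![g (coordVec j) m₁, g (coordVec j) m₂, g (coordVec j) n₁, g (coordVec j) n₂]) ?_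
  ext j i
  have := congrArg (fun v : Coord 4 => v i) (h.expand (coordVec j))
  simp only [PiLp.add_apply, PiLp.smul_apply, smul_eq_mul] at this
  rw [Matrix.mul_apply, Fin.sum_univ_four, Matrix.one_apply]
  rw [PiLp.single_apply] at this
  simp only [rowMatrix, Matrix.of_apply, Matrix.cons_val, ← this, eq_comm (a := i)]

/-- The pseudo-orthonormal frame of a null frame. -/
theorem rowMatrix_orthonormal_det (n₁ n₂ m₁ m₂ : Coord 4) :
    (rowMatrix (n₁ - (1 / 2 : ℝ) • m₁) (n₁ + (1 / 2 : ℝ) • m₁) (n₂ + (1 / 2 : ℝ) • m₂)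
      (n₂ - (1 / 2 : ℝ) • m₂)).det = (rowMatrix n₁ n₂ m₁ m₂).det := by
  have : rowMatrix (n₁ - (1 / 2 : ℝ) • m₁) (n₁ + (1 / 2 : ℝ) • m₁) (n₂ + (1 / 2 : ℝ) • m₂)
      (n₂ - (1 / 2 : ℝ) • m₂) =
      !![1, 0, -1 / 2, 0; 1, 0, 1 / 2, 0; 0, 1, 0, 1 / 2; 0, 1, 0, -1 / 2] *
        rowMatrix n₁ n₂ m₁ m₂ := by
    ext i j
    rw [Matrix.mul_apply, Fin.sum_univ_four]
    fin_cases i <;> simp [rowMatrix] <;> ring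
  rw [this, Matrix.det_mul]
  have hd : (!![1, 0, -1 / 2, 0; 1, 0, 1 / 2, 0; 0, 1, 0, 1 / 2; 0, 1, 0, -1 / 2] :
      Matrix (Fin 4) (Fin 4) ℝ).det = 1 := by
    simp [Matrix.det_succ_row_zero, Fin.sum_univ_succ, Fin.succAbove]
    norm_num
  rw [hd, one_mul]

end


theorem weylForm_eq_sum {B : Coord 4 → Coord 4 →L[ℝ] Coord 4 →L[ℝ] ℝ}
    {Γ : Coord 4 → Coord 4 →L[ℝ] Coord 4 →L[ℝ] Coord 4}
    {P : Coord 4 → Coord 4 →L[ℝ] Coord 4 →L[ℝ] ℝ} {x : Coord 4} (u v z t : Coord 4) :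
    weylForm B Γ P x u v z t =
      ∑ i, ∑ j, u i * v j * weylForm B Γ P x (coordVec i) (coordVec j) z t := by
  rw [eq_sum_of_linear (f := fun u => weylForm B Γ P x u v z t)
    (fun u u' => weylForm_add_left B Γ P x u u' v z t)
    (fun c u => weylForm_smul_left B Γ P x u v z t c)]
  refine Finset.sum_congr rfl fun i _ => ?_
  rw [eq_sum_of_linear (f := fun v => weylForm B Γ P x (coordVec i) v z t)
    (fun v v' => weylForm_add_middle B Γ P x (coordVec i) v v' z t)
    (fun c v => weylForm_smul_middle B Γ P x (coordVec i) v z t c), Finset.mul_sum]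
  exact Finset.sum_congr rfl fun j _ => (mul_assoc _ _ _).symm

theorem weylForm_eq_sum_right {B : Coord 4 → Coord 4 →L[ℝ] Coord 4 →L[ℝ] ℝ}
    {Γ : Coord 4 → Coord 4 →L[ℝ] Coord 4 →L[ℝ] Coord 4}
    {P : Coord 4 → Coord 4 →L[ℝ] Coord 4 →L[ℝ] ℝ} {x : Coord 4} (u v z t : Coord 4) :
    weylForm B Γ P x u v z t =
      ∑ k, ∑ l, z k * t l * weylForm B Γ P x u v (coordVec k) (coordVec l) := by
  rw [eq_sum_of_linear (f := fun z => weylForm B Γ P x u v z t)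
    (fun z z' => weylForm_add_third B Γ P x u v z z' t)
    (fun c z => weylForm_smul_third B Γ P x u v z t c)]
  refine Finset.sum_congr rfl fun i _ => ?_
  rw [eq_sum_of_linear (f := fun t => weylForm B Γ P x u v (coordVec i) t)
    (fun t t' => weylForm_add_right B Γ P x u v (coordVec i) t t')
    (fun c t => weylForm_smul_right B Γ P x u v (coordVec i) t c), Finset.mul_sum]
  exact Finset.sum_congr rfl fun j _ => (mul_assoc _ _ _).symm

/-- The self-duality condition expressed by a null frame. -/
theorem vanishesOnAntiSelfDual_of_weylFrame {G : Coord 4 → Matrix (Fin 4) (Fin 4) ℝ}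
    {Γ : Coord 4 → Coord 4 →L[ℝ] Coord 4 →L[ℝ] Coord 4}
    {P : Coord 4 → Coord 4 →L[ℝ] Coord 4 →L[ℝ] ℝ} {x n₁ n₂ m₁ m₂ : Coord 4}
    (hG : ∀ i j, G x i j = G x j i) (h : IsNullFrame (matrixForm (G x)) n₁ n₂ m₁ m₂)
    (hpos : 0 < (rowMatrix n₁ n₂ m₁ m₂).det)
    (hweyl : ∀ i j k l, weyl G i j k l x = weylForm (fun x => matrixForm (G x)) Γ P x
      (coordVec i) (coordVec j) (coordVec k) (coordVec l))
    (hsd : ∀ (E : Matrix (Fin 4) (Fin 4) ℝ) (ε : Fin 4 → ℝ), (∀ a, ε a = 1 ∨ ε a = -1) →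
      (∀ a b, ∑ i, ∑ j, E a i * E b j * G x i j = if a = b then ε a else 0) → 0 < E.det →
      ∀ k l : Fin 4,
      weylFrame G E 0 1 k l x - ε 2 * ε 3 * weylFrame G E 2 3 k l x = 0 ∧
      weylFrame G E 0 2 k l x + ε 1 * ε 3 * weylFrame G E 1 3 k l x = 0 ∧
      weylFrame G E 0 3 k l x - ε 1 * ε 2 * weylFrame G E 1 2 k l x = 0) :
    VanishesOnAntiSelfDual (weylForm (fun x => matrixForm (G x)) Γ P x) n₁ n₂ m₁ m₂ := by
  set W := weylForm (fun x => matrixForm (G x)) Γ P x with hW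
  -- An orthonormal frame of signs `-1, 1, 1, -1`, ordered so that its determinant is that of the
  -- null frame. Its three anti-self-dual bivectors are `n₁ ∧ m₁ - n₂ ∧ m₂`, `n₁ ∧ m₂ + n₂ ∧ m₁` and
  -- `n₂ ∧ m₁ - n₁ ∧ m₂`, so `n₁ ∧ m₂` and `n₂ ∧ m₁` are separated by adding and subtracting.
  set v : Fin 4 → Coord 4 := ![n₁ - (1 / 2 : ℝ) • m₁, n₁ + (1 / 2 : ℝ) • m₁,
    n₂ + (1 / 2 : ℝ) • m₂, n₂ - (1 / 2 : ℝ) • m₂] with hv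
  set E : Matrix (Fin 4) (Fin 4) ℝ := rowMatrix (n₁ - (1 / 2 : ℝ) • m₁) (n₁ + (1 / 2 : ℝ) • m₁)
    (n₂ + (1 / 2 : ℝ) • m₂) (n₂ - (1 / 2 : ℝ) • m₂) with hE
  have hEv : ∀ a i, E a i = v a i := by
    intro a i
    fin_cases a <;> rfl
  have hframe : ∀ a b k l, weylFrame G E a b k l x = W (v a) (v b) (coordVec k) (coordVec l) := by
    intro a b k l
    rw [hW, weylForm_eq_sum, weylFrame]
    simp only [hEv, hweyl, hW]
  have hsy := matrixForm_symm hG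
  have hgram : ∀ a b, ∑ i, ∑ j, E a i * E b j * G x i j =
      if a = b then (![-1, 1, 1, -1] : Fin 4 → ℝ) a else 0 := by
    intro a b
    have e : ∑ i, ∑ j, E a i * E b j * G x i j = matrixForm (G x) (v a) (v b) := by
      rw [matrixForm_apply]
      simp only [hEv, mul_comm]
    rw [e]
    fin_cases a <;> fin_cases b <;>
    simp [hv, h.n₁n₁, h.n₁n₂, h.n₁m₁, h.n₁m₂, h.n₂n₂, h.n₂m₁, h.n₂m₂, h.m₁m₁, h.m₁m₂, h.m₂m₂,
      hsy m₁ n₁, hsy m₂ n₁, hsy m₁ n₂, hsy m₂ n₂, hsy n₂ n₁, hsy m₂ m₁] <;> norm_num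
  have key := hsd E ![-1, 1, 1, -1] (by intro a; fin_cases a <;> simp) hgram
    (by rw [hE, rowMatrix_orthonormal_det]; exact hpos)
  simp only [hframe] at key
  have hadd₁ : ∀ u u' v z t, W (u + u') v z t = W u v z t + W u' v z t :=
    weylForm_add_left _ _ _ _
  have hadd₂ : ∀ u v v' z t, W u (v + v') z t = W u v z t + W u v' z t :=
    weylForm_add_middle _ _ _ _
  have hsm₁ : ∀ u v z t (c : ℝ), W (c • u) v z t = c * W u v z t := weylForm_smul_left _ _ _ _
  have hsm₂ : ∀ u v z t (c : ℝ), W u (c • v) z t = c * W u v z t := weylForm_smul_middle _ _ _ _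
  have hswap : ∀ u v z t, W v u z t = -W u v z t := weylForm_swap _ _ _ _
  have hself : ∀ u z t, W u u z t = 0 := fun u z t => by linarith [hswap u u z t]
  have hall : ∀ k l, W n₁ m₂ (coordVec k) (coordVec l) = 0 ∧ W n₂ m₁ (coordVec k) (coordVec l) = 0 ∧
      W n₁ m₁ (coordVec k) (coordVec l) = W n₂ m₂ (coordVec k) (coordVec l) := by
    intro k l
    obtain ⟨h₁, h₂, h₃⟩ := key k l
    simp only [hv, Matrix.cons_val, sub_eq_add_neg, ← neg_smul, hadd₁, hadd₂, hsm₁, hsm₂, hself,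
      hswap n₁ m₁, hswap n₂ m₂, hswap n₂ m₁] at h₁ h₂ h₃
    refine ⟨?_, ?_, ?_⟩ <;> linarith
  refine ⟨fun z t => ?_, fun z t => ?_, fun z t => ?_⟩ <;> simp only [hW]
  · rw [weylForm_eq_sum_right]
    simp [← hW, (hall _ _).1]
  · rw [weylForm_eq_sum_right]
    simp [← hW, (hall _ _).2.1]
  · rw [weylForm_eq_sum_right, weylForm_eq_sum_right n₂]
    simp [← hW, (hall _ _).2.2]

/-- The gradient is completed to a smooth null frame of the right orientation. The quasi-Einstein
equation then identifies the component Weyl tensor with `weylForm` of the Schouten type tensor, so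
self-duality takes its null frame form. -/
theorem exists_isIsotropicSelfDual {G : Coord 4 → Matrix (Fin 4) (Fin 4) ℝ} {U : Set (Coord 4)}
    {F lam : Coord 4 → ℝ} {μ : ℝ} (hU : IsOpen U)
    (hG : ∀ i j, ContDiffOn ℝ ∞ (fun x => G x i j) U)
    (hsymm : ∀ x ∈ U, ∀ i j, G x i j = G x j i)
    (hnd : ∀ x ∈ U, ∀ u, (∀ v, matrixForm (G x) u v = 0) → u = 0)
    (hF : ContDiffOn ℝ ∞ F U) (hlam : ContDiffOn ℝ ∞ lam U)
    (heq : ∀ x ∈ U, ∀ i j, hessian (christoffel G) F i j x + ricci (christoffel G) i j x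
      - μ * (partialDeriv i F x * partialDeriv j F x) = lam x * G x i j)
    (hiso : ∀ x ∈ U, ∑ i, ∑ j, G x i j * gradientCoeff G F i x * gradientCoeff G F j x = 0)
    (hsd : ∀ x ∈ U, ∀ (E : Matrix (Fin 4) (Fin 4) ℝ) (ε : Fin 4 → ℝ), (∀ a, ε a = 1 ∨ ε a = -1) →
      (∀ a b, ∑ i, ∑ j, E a i * E b j * G x i j = if a = b then ε a else 0) → 0 < E.det →
      ∀ k l : Fin 4,
      weylFrame G E 0 1 k l x - ε 2 * ε 3 * weylFrame G E 2 3 k l x = 0 ∧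
      weylFrame G E 0 2 k l x + ε 1 * ε 3 * weylFrame G E 1 3 k l x = 0 ∧
      weylFrame G E 0 3 k l x - ε 1 * ε 2 * weylFrame G E 1 2 k l x = 0)
    {x : Coord 4} (hx : x ∈ U) (hgrad : ∃ i, gradientCoeff G F i x ≠ 0) {w : Fin 4 → Coord 4}
    (hw : ∀ i j, matrixForm (G x) (w i) (w j) =
      if i = j then (![-1, -1, 1, 1] : Fin 4 → ℝ) i else 0) :
    ∃ (T : Set (Coord 4)) (ψ : Coord 4 → ℝ) (n₁ n₂ m₁ m₂ : Coord 4 → Coord 4), x ∈ T ∧ T ⊆ U ∧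
      IsIsotropicSelfDual T (fun x => matrixForm (G x)) (connForm (christoffel G)) F lam ψ μ
        n₁ n₂ m₁ m₂ := by
  have hLC := isLeviCivita_christoffel hU hG hsymm hnd
  have hdet : ∀ x ∈ U, (G x).det ≠ 0 := fun x hx => det_ne_zero_of_nondegenerate (hnd x hx)
  set n := gradientVec G F with hn
  have hns : ContDiffOn ℝ ∞ n U := contDiffOn_gradientVec hU hG hdet hF
  have hnull : ∀ y ∈ U, matrixForm (G y) (n y) (n y) = 0 := fun y hy => by
    rw [matrixForm_apply, ← hiso y hy]
    exact Finset.sum_congr rfl fun i _ => Finset.sum_congr rfl fun j _ => (mul_assoc _ _ _).symm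
  have hnx : n x ≠ 0 := fun h0 => by
    obtain ⟨i, hi⟩ := hgrad
    exact hi (congrArg (fun v : Coord 4 => v i) h0)
  obtain ⟨⟨q, hq, hqq⟩, r, hr, hrr⟩ := exists_orthogonal_of_neutral hw (n x)
  obtain ⟨T₁, n₂, m₁, m₂, hT₁, hxT₁, hT₁U, hn₂, hm₁, hm₂, hfr⟩ := exists_smooth_nullFrame
    (by simp) hU hLC.smooth_metric hLC.symm hnd hns hnull hx hnx hq hqq hr hrr
  obtain ⟨n₂, m₂, hn₂, hm₂, hfr, hposx⟩ : ∃ n₂ m₂ : Coord 4 → Coord 4, ContDiffOn ℝ ∞ n₂ T₁ ∧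
      ContDiffOn ℝ ∞ m₂ T₁ ∧ (∀ y ∈ T₁, IsNullFrame (matrixForm (G y)) (n y) (n₂ y) (m₁ y) (m₂ y)) ∧
      0 < (rowMatrix (n x) (n₂ x) (m₁ x) (m₂ x)).det := by
    rcases (hfr x hxT₁).rowMatrix_det_ne_zero.lt_or_gt with h0 | h0
    · refine ⟨m₂, n₂, hm₂, hn₂, fun y hy => (hfr y hy).swap (hLC.symm y (hT₁U hy)), ?_⟩
      rw [rowMatrix_swap_det]
      linarith
    · exact ⟨n₂, m₂, hn₂, hm₂, hfr, h0⟩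
  set δ : Coord 4 → ℝ := fun y => (rowMatrix (n y) (n₂ y) (m₁ y) (m₂ y)).det with hδ
  have hδs : ContDiffOn ℝ ∞ δ T₁ := contDiffOn_matrix_det fun i j => by
    have := fun {f : Coord 4 → Coord 4} (hf : ContDiffOn ℝ ∞ f T₁) => contDiffOn_euclidean.1 hf j
    fin_cases i
    exacts [this (hns.mono hT₁U), this hn₂, this hm₁, this hm₂]
  set T := T₁ ∩ δ ⁻¹' Set.Ioi 0 with hT
  have hTo : IsOpen T := hδs.continuousOn.isOpen_inter_preimage hT₁ isOpen_Ioi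
  have hTT₁ : T ⊆ T₁ := Set.inter_subset_left
  have hTU : T ⊆ U := hTT₁.trans hT₁U
  have hLT := isLeviCivita_christoffel hTo (fun i j => (hG i j).mono hTU)
    (fun y hy => hsymm y (hTU hy)) (fun y hy => hnd y (hTU hy))
  set Γ := connForm (christoffel G) with hΓ
  have hHs : ContDiffOn ℝ ∞ (hessForm Γ F) T := by
    have h₁ := (hF.mono hTU).fderiv_of_isOpen hTo (m := ∞) (by simp)
    have h₂ := h₁.fderiv_of_isOpen hTo (m := ∞) (by simp)
    exact h₂.sub ((contDiffOn_const.clm_apply h₁).clm_comp hLT.smooth_conn)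
  -- The value that makes `ψ = λ - τ/6`: tracing the equation gives `τ = 4λ - Δf`, as the gradient
  -- is null, and `Δf` is twice the sum of the two Hessian components.
  set ψ : Coord 4 → ℝ := fun y => 1 / 3 * (lam y + hessForm Γ F y (n y) (m₁ y)
    + hessForm Γ F y (n₂ y) (m₂ y)) with hψ
  have hψs : ContDiffOn ℝ ∞ ψ T := contDiffOn_const.mul (((hlam.mono hTU).add
    ((hHs.clm_apply (hns.mono hTU)).clm_apply (hm₁.mono hTT₁))).add
    ((hHs.clm_apply (hn₂.mono hTT₁)).clm_apply (hm₂.mono hTT₁)))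
  have hgr : ∀ y ∈ T, ∀ v, matrixForm (G y) (n y) v = fderiv ℝ F y v := fun y hy v =>
    matrixForm_gradientVec (hsymm y (hTU hy)) (hdet y (hTU hy)) v
  have hψ3 : ∀ y, 3 * ψ y = lam y + hessForm Γ F y (n y) (m₁ y) + hessForm Γ F y (n₂ y) (m₂ y) :=
    fun y => by simp only [hψ]; ring
  refine ⟨T, ψ, n, n₂, m₁, m₂, ⟨hxT₁, hposx⟩, hTU, { hLT with
    smooth_potential := hF.mono hTU
    smooth_lam := hlam.mono hTU
    smooth_ψ := hψs
    smooth_n₁ := hns.mono hTU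
    smooth_n₂ := hn₂.mono hTT₁
    smooth_m₁ := hm₁.mono hTT₁
    smooth_m₂ := hm₂.mono hTT₁
    frame := fun y hy => hfr y (hTT₁ hy)
    grad := hgr
    trace := fun y _ => hψ3 y
    selfDual := fun y hy => ?_ }⟩
  have hyU := hTU hy
  have hFr := hfr y (hTT₁ hy)
  refine vanishesOnAntiSelfDual_of_weylFrame (hsymm y hyU) hFr hy.2 (fun i j k l => ?_) (hsd y hyU)
  set P := schoutenForm (fun x => matrixForm (G x)) Γ F ψ μ with hP
  -- The Ricci tensor recovered from `P`, with `λ - ψ` in the role of `τ/6`.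
  set R : Coord 4 →L[ℝ] Coord 4 →L[ℝ] ℝ :=
    (2 : ℝ) • P y + (lam y - ψ y) • matrixForm (G y) with hR
  have hRapp : ∀ u v, R u v = lam y * matrixForm (G y) u v + μ * (fderiv ℝ F y u * fderiv ℝ F y v)
      - hessForm Γ F y u v := fun u v => by
    simp only [hR, hP, add_apply, smul_apply, smul_eq_mul, schoutenForm_apply]
    ring
  have hFd : DifferentiableAt ℝ (fderiv ℝ F) y :=
    ((hF.contDiffAt (hU.mem_nhds hyU)).fderiv_right (m := ∞) (by simp)).differentiableAt (by simp)
  have hric : ∀ i j, ricci (christoffel G) i j y = R (coordVec i) (coordVec j) := fun i j => by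
    rw [hRapp, hΓ, hessForm_coordVec hFd, matrixForm_coordVec, ← heq y hyU]
    simp only [partialDeriv]
    ring
  have htr : scalarCurvature G y = 6 * (lam y - ψ y) := by
    have hs := hsymm y hyU
    have hHsy := hLT.hessForm_symm (hF.mono hTU) hy
    have g₁ : fderiv ℝ F y (n y) = 0 := by rw [← hgr y hy, hFr.n₁n₁]
    have g₂ : fderiv ℝ F y (n₂ y) = 0 := by rw [← hgr y hy, hFr.n₁n₂]
    simp only [scalarCurvature, hric]
    rw [hFr.trace_form hs R]
    simp only [hRapp, g₁, g₂, hFr.n₁m₁, hFr.n₂m₂, matrixForm_symm hs (m₁ y), matrixForm_symm hs (m₂ y),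
      hHsy (m₁ y), hHsy (m₂ y)]
    linarith [hψ3 y]
  rw [weyl, curvatureTensor_eq ((hLT.contDiffAt_conn hy).differentiableAt (by simp)), htr, weylForm,
    kulkarniNomizu]
  simp only [hric, hR, add_apply, smul_apply, smul_eq_mul, matrixForm_coordVec]
  ring

end


noncomputable section

set_option maxSynthPendingDepth 3

/-! ### Walker metrics -/

/-- The index of the base coordinate `xⁱ`. -/
def baseIdx (i : Fin 2) : Fin 4 := Fin.castAdd 2 i

/-- The index of the fibre coordinate `x_{i'}`. -/
def fibIdx (i : Fin 2) : Fin 4 := Fin.natAdd 2 i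

theorem sum_base_fib {R : Type*} [AddCommMonoid R] (f : Fin 4 → R) :
    ∑ k, f k = ∑ i, f (baseIdx i) + ∑ i, f (fibIdx i) :=
  Fin.sum_univ_add (a := 2) (b := 2) f

theorem finSumFinEquiv_symm_baseIdx (i : Fin 2) :
    (finSumFinEquiv (m := 2) (n := 2)).symm (baseIdx i) = Sum.inl i :=
  finSumFinEquiv_symm_apply_castAdd i

theorem finSumFinEquiv_symm_fibIdx (i : Fin 2) :
    (finSumFinEquiv (m := 2) (n := 2)).symm (fibIdx i) = Sum.inr i :=
  finSumFinEquiv_symm_apply_natAdd i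

section

variable (a : Matrix (Fin 2) (Fin 2) ℝ) (i j : Fin 2)

@[simp] theorem walkerMatrix_base_base : walkerMatrix a (baseIdx i) (baseIdx j) = a i j := by
  simp [walkerMatrix, finSumFinEquiv_symm_baseIdx]

@[simp] theorem walkerMatrix_base_fib :
    walkerMatrix a (baseIdx i) (fibIdx j) = (1 : Matrix (Fin 2) (Fin 2) ℝ) i j := by
  simp [walkerMatrix, finSumFinEquiv_symm_baseIdx, finSumFinEquiv_symm_fibIdx]

@[simp] theorem walkerMatrix_fib_base :
    walkerMatrix a (fibIdx i) (baseIdx j) = (1 : Matrix (Fin 2) (Fin 2) ℝ) i j := by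
  simp [walkerMatrix, finSumFinEquiv_symm_baseIdx, finSumFinEquiv_symm_fibIdx]

@[simp] theorem walkerMatrix_fib_fib : walkerMatrix a (fibIdx i) (fibIdx j) = 0 := by
  simp [walkerMatrix, finSumFinEquiv_symm_fibIdx]

theorem walkerMatrix_inv : (walkerMatrix a)⁻¹ =
    (Matrix.fromBlocks 0 1 1 (-a)).submatrix (finSumFinEquiv (m := 2) (n := 2)).symm
      (finSumFinEquiv (m := 2) (n := 2)).symm := by
  refine Matrix.inv_eq_left_inv ?_
  rw [walkerMatrix, Matrix.submatrix_mul_equiv, Matrix.fromBlocks_multiply]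
  simp

@[simp] theorem walkerMatrix_inv_base_base : (walkerMatrix a)⁻¹ (baseIdx i) (baseIdx j) = 0 := by
  simp [walkerMatrix_inv, finSumFinEquiv_symm_baseIdx]

@[simp] theorem walkerMatrix_inv_base_fib :
    (walkerMatrix a)⁻¹ (baseIdx i) (fibIdx j) = (1 : Matrix (Fin 2) (Fin 2) ℝ) i j := by
  simp [walkerMatrix_inv, finSumFinEquiv_symm_baseIdx, finSumFinEquiv_symm_fibIdx]

@[simp] theorem walkerMatrix_inv_fib_base :
    (walkerMatrix a)⁻¹ (fibIdx i) (baseIdx j) = (1 : Matrix (Fin 2) (Fin 2) ℝ) i j := by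
  simp [walkerMatrix_inv, finSumFinEquiv_symm_baseIdx, finSumFinEquiv_symm_fibIdx]

@[simp] theorem walkerMatrix_inv_fib_fib : (walkerMatrix a)⁻¹ (fibIdx i) (fibIdx j) = -a i j := by
  simp [walkerMatrix_inv, finSumFinEquiv_symm_fibIdx]

end

section partialDeriv

variable {n : ℕ} {F H : Coord n → ℝ} {x : Coord n}

theorem partialDeriv_const (i : Fin n) (c : ℝ) : partialDeriv i (fun _ => c) x = 0 := by
  simp [partialDeriv]

theorem partialDeriv_const_mul (hF : DifferentiableAt ℝ F x) (i : Fin n) (c : ℝ) :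
    partialDeriv i (fun y => c * F y) x = c * partialDeriv i F x := by
  simp [partialDeriv, fderiv_const_mul hF]

theorem partialDeriv_add (hF : DifferentiableAt ℝ F x) (hH : DifferentiableAt ℝ H x) (i : Fin n) :
    partialDeriv i (fun y => F y + H y) x = partialDeriv i F x + partialDeriv i H x := by
  simp [partialDeriv, fderiv_fun_add hF hH]

theorem partialDeriv_sub (hF : DifferentiableAt ℝ F x) (hH : DifferentiableAt ℝ H x) (i : Fin n) :
    partialDeriv i (fun y => F y - H y) x = partialDeriv i F x - partialDeriv i H x := by
  simp [partialDeriv, fderiv_fun_sub hF hH]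

theorem partialDeriv_mul (hF : DifferentiableAt ℝ F x) (hH : DifferentiableAt ℝ H x) (i : Fin n) :
    partialDeriv i (fun y => F y * H y) x = F x * partialDeriv i H x + partialDeriv i F x * H x := by
  simp [partialDeriv, fderiv_fun_mul hF hH, mul_comm]

theorem partialDeriv_comm {U : Set (Coord n)} (hU : IsOpen U) (hF : ContDiffOn ℝ ∞ F U)
    (hx : x ∈ U) (i j : Fin n) :
    partialDeriv i (partialDeriv j F) x = partialDeriv j (partialDeriv i F) x := by
  have hFx := hF.contDiffAt (hU.mem_nhds hx)
  have hd : DifferentiableAt ℝ (fderiv ℝ F) x :=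
    (hFx.fderiv_right (m := ∞) (by simp)).differentiableAt (by simp)
  have h : ∀ i j, partialDeriv i (partialDeriv j F) x =
      fderiv ℝ (fderiv ℝ F) x (coordVec i) (coordVec j) := fun i j => by
    have e : HasFDerivAt (partialDeriv j F) _ x :=
      hd.hasFDerivAt.clm_apply (hasFDerivAt_const (coordVec j) x)
    rw [partialDeriv, e.fderiv]
    simp
  rw [h, h, hFx.isSymmSndFDerivAt minSmoothness_two_le]

end partialDeriv

/-- The metric with components `G` is a Walker metric on the open set `V`. -/
structure IsWalker (V : Set (Coord 4)) (G : Coord 4 → Matrix (Fin 4) (Fin 4) ℝ)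
    (a : Fin 2 → Fin 2 → Coord 4 → ℝ) : Prop where
  isOpen : IsOpen V
  smooth : ∀ i j, ContDiffOn ℝ ∞ (a i j) V
  symm : ∀ i j, ∀ x ∈ V, a i j x = a j i x
  eq : ∀ x ∈ V, G x = walkerMatrix (Matrix.of fun i j => a i j x)

/-- The components with respect to the base coordinates of the Levi-Civita connection of a Walker
metric. -/
def walkerConn (a : Fin 2 → Fin 2 → Coord 4 → ℝ) (i j k : Fin 2) (x : Coord 4) : ℝ :=
  -(1 / 2) * partialDeriv (fibIdx k) (a i j) x

namespace IsWalker

variable {V : Set (Coord 4)} {G : Coord 4 → Matrix (Fin 4) (Fin 4) ℝ}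
  {a : Fin 2 → Fin 2 → Coord 4 → ℝ} (h : IsWalker V G a) {x : Coord 4}

include h

theorem differentiableAt (hx : x ∈ V) (i j : Fin 2) : DifferentiableAt ℝ (a i j) x :=
  ((h.smooth i j).contDiffAt (h.isOpen.mem_nhds hx)).differentiableAt (by simp)

theorem differentiableAt_partialDeriv (hx : x ∈ V) (i j : Fin 2) (k : Fin 4) :
    DifferentiableAt ℝ (partialDeriv k (a i j)) x :=
  ((contDiffOn_partialDeriv h.isOpen (h.smooth i j) k).contDiffAt
    (h.isOpen.mem_nhds hx)).differentiableAt (by simp)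

theorem partialDeriv_symm (hx : x ∈ V) (i j : Fin 2) (k : Fin 4) :
    partialDeriv k (a i j) x = partialDeriv k (a j i) x :=
  partialDeriv_congr h.isOpen (h.symm i j) hx k

theorem partialDeriv_partialDeriv_symm (hx : x ∈ V) (i j : Fin 2) (k l : Fin 4) :
    partialDeriv l (partialDeriv k (a i j)) x = partialDeriv l (partialDeriv k (a j i)) x :=
  partialDeriv_congr h.isOpen (fun _ hy => h.partialDeriv_symm hy i j k) hx l

theorem partialDeriv_base_base (hx : x ∈ V) (i j : Fin 2) (k : Fin 4) :
    partialDeriv k (fun y => G y (baseIdx i) (baseIdx j)) x = partialDeriv k (a i j) x :=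
  partialDeriv_congr h.isOpen (fun y hy => by rw [h.eq y hy, walkerMatrix_base_base]; rfl) hx k

theorem partialDeriv_base_fib (hx : x ∈ V) (i j : Fin 2) (k : Fin 4) :
    partialDeriv k (fun y => G y (baseIdx i) (fibIdx j)) x = 0 :=
  (partialDeriv_congr h.isOpen (fun y hy => by rw [h.eq y hy, walkerMatrix_base_fib]) hx k).trans
    (partialDeriv_const k _)

theorem partialDeriv_fib_base (hx : x ∈ V) (i j : Fin 2) (k : Fin 4) :
    partialDeriv k (fun y => G y (fibIdx i) (baseIdx j)) x = 0 :=
  (partialDeriv_congr h.isOpen (fun y hy => by rw [h.eq y hy, walkerMatrix_fib_base]) hx k).trans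
    (partialDeriv_const k _)

theorem partialDeriv_fib_fib (hx : x ∈ V) (i j : Fin 2) (k : Fin 4) :
    partialDeriv k (fun y => G y (fibIdx i) (fibIdx j)) x = 0 :=
  (partialDeriv_congr h.isOpen (fun y hy => by rw [h.eq y hy, walkerMatrix_fib_fib]) hx k).trans
    (partialDeriv_const k _)

theorem christoffel_base_base_base (hx : x ∈ V) (i j k : Fin 2) :
    christoffel G (baseIdx i) (baseIdx j) (baseIdx k) x = walkerConn a i j k x := by
  simp [-Fin.sum_univ_two, christoffel, sum_base_fib, h.eq x hx, h.partialDeriv_base_base hx,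
    h.partialDeriv_base_fib hx, walkerConn, Matrix.one_apply]

theorem christoffel_base_base_fib (hx : x ∈ V) (i j k : Fin 2) :
    christoffel G (baseIdx i) (baseIdx j) (fibIdx k) x =
      (1 / 2) * (partialDeriv (baseIdx i) (a j k) x + partialDeriv (baseIdx j) (a i k) x
        - partialDeriv (baseIdx k) (a i j) x)
      - ∑ l, a k l x * walkerConn a i j l x := by
  simp [-Fin.sum_univ_two, christoffel, sum_base_fib, h.eq x hx, h.partialDeriv_base_base hx,
    h.partialDeriv_base_fib hx, walkerConn, Matrix.one_apply, mul_add,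
    Finset.mul_sum]
  ring_nf

/-- A fibre index below together with a base index above always gives zero, here and in the two
analogous lemmas: the vertical plane field is parallel. -/
theorem christoffel_base_fib_base (hx : x ∈ V) (i j k : Fin 2) :
    christoffel G (baseIdx i) (fibIdx j) (baseIdx k) x = 0 := by
  simp [-Fin.sum_univ_two, christoffel, sum_base_fib, h.eq x hx, h.partialDeriv_base_fib hx, h.partialDeriv_fib_fib hx]

theorem christoffel_fib_base_base (hx : x ∈ V) (i j k : Fin 2) :
    christoffel G (fibIdx i) (baseIdx j) (baseIdx k) x = 0 := by
  simp [-Fin.sum_univ_two, christoffel, sum_base_fib, h.eq x hx, h.partialDeriv_base_fib hx, h.partialDeriv_fib_base hx,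
    h.partialDeriv_fib_fib hx]

theorem christoffel_base_fib_fib (hx : x ∈ V) (i j k : Fin 2) :
    christoffel G (baseIdx i) (fibIdx j) (fibIdx k) x = -walkerConn a i k j x := by
  simp [-Fin.sum_univ_two, christoffel, sum_base_fib, h.eq x hx, h.partialDeriv_base_fib hx, h.partialDeriv_fib_base hx,
    h.partialDeriv_base_base hx, h.partialDeriv_fib_fib hx, walkerConn, Matrix.one_apply]

theorem christoffel_fib_base_fib (hx : x ∈ V) (i j k : Fin 2) :
    christoffel G (fibIdx i) (baseIdx j) (fibIdx k) x = -walkerConn a j k i x := by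
  simp [-Fin.sum_univ_two, christoffel, sum_base_fib, h.eq x hx, h.partialDeriv_base_fib hx, h.partialDeriv_fib_base hx,
    h.partialDeriv_base_base hx, h.partialDeriv_fib_fib hx, walkerConn, Matrix.one_apply]

theorem christoffel_fib_fib_base (hx : x ∈ V) (i j k : Fin 2) :
    christoffel G (fibIdx i) (fibIdx j) (baseIdx k) x = 0 := by
  simp [-Fin.sum_univ_two, christoffel, sum_base_fib, h.eq x hx, h.partialDeriv_fib_fib hx]

theorem christoffel_fib_fib_fib (hx : x ∈ V) (i j k : Fin 2) :
    christoffel G (fibIdx i) (fibIdx j) (fibIdx k) x = 0 := by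
  simp [-Fin.sum_univ_two, christoffel, sum_base_fib, h.eq x hx, h.partialDeriv_fib_base hx, h.partialDeriv_fib_fib hx]

theorem differentiableAt_walkerConn (hx : x ∈ V) (i j k : Fin 2) :
    DifferentiableAt ℝ (walkerConn a i j k) x :=
  (h.differentiableAt_partialDeriv hx i j (fibIdx k)).const_mul _

theorem partialDeriv_walkerConn (hx : x ∈ V) (i j k : Fin 2) (l : Fin 4) :
    partialDeriv l (walkerConn a i j k) x =
      -(1 / 2) * partialDeriv l (partialDeriv (fibIdx k) (a i j)) x :=
  partialDeriv_const_mul (h.differentiableAt_partialDeriv hx i j (fibIdx k)) l _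

theorem walkerConn_symm (hx : x ∈ V) (i j k : Fin 2) :
    walkerConn a i j k x = walkerConn a j i k x := by
  rw [walkerConn, walkerConn, h.partialDeriv_symm hx]

theorem partialDeriv_christoffel_base_base_base (hx : x ∈ V) (i j k : Fin 2) (l : Fin 4) :
    partialDeriv l (christoffel G (baseIdx i) (baseIdx j) (baseIdx k)) x =
      partialDeriv l (walkerConn a i j k) x :=
  partialDeriv_congr h.isOpen (fun _ hy => h.christoffel_base_base_base hy i j k) hx l

theorem partialDeriv_christoffel_base_fib_base (hx : x ∈ V) (i j k : Fin 2) (l : Fin 4) :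
    partialDeriv l (christoffel G (baseIdx i) (fibIdx j) (baseIdx k)) x = 0 :=
  (partialDeriv_congr h.isOpen (fun _ hy => h.christoffel_base_fib_base hy i j k) hx l).trans
    (partialDeriv_const l 0)

theorem partialDeriv_christoffel_fib_base_base (hx : x ∈ V) (i j k : Fin 2) (l : Fin 4) :
    partialDeriv l (christoffel G (fibIdx i) (baseIdx j) (baseIdx k)) x = 0 :=
  (partialDeriv_congr h.isOpen (fun _ hy => h.christoffel_fib_base_base hy i j k) hx l).trans
    (partialDeriv_const l 0)

theorem partialDeriv_christoffel_fib_fib_base (hx : x ∈ V) (i j k : Fin 2) (l : Fin 4) :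
    partialDeriv l (christoffel G (fibIdx i) (fibIdx j) (baseIdx k)) x = 0 :=
  (partialDeriv_congr h.isOpen (fun _ hy => h.christoffel_fib_fib_base hy i j k) hx l).trans
    (partialDeriv_const l 0)

theorem partialDeriv_christoffel_fib_fib_fib (hx : x ∈ V) (i j k : Fin 2) (l : Fin 4) :
    partialDeriv l (christoffel G (fibIdx i) (fibIdx j) (fibIdx k)) x = 0 :=
  (partialDeriv_congr h.isOpen (fun _ hy => h.christoffel_fib_fib_fib hy i j k) hx l).trans
    (partialDeriv_const l 0)

theorem partialDeriv_neg_walkerConn (hx : x ∈ V) (i j k : Fin 2) (l : Fin 4) :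
    partialDeriv l (fun y => -walkerConn a i j k y) x = -partialDeriv l (walkerConn a i j k) x := by
  have := partialDeriv_const_mul (h.differentiableAt_walkerConn hx i j k) l (-1)
  simpa using this

theorem partialDeriv_christoffel_base_fib_fib (hx : x ∈ V) (i j k : Fin 2) (l : Fin 4) :
    partialDeriv l (christoffel G (baseIdx i) (fibIdx j) (fibIdx k)) x =
      -partialDeriv l (walkerConn a i k j) x :=
  (partialDeriv_congr h.isOpen (fun _ hy => h.christoffel_base_fib_fib hy i j k) hx l).trans
    (h.partialDeriv_neg_walkerConn hx i k j l)

theorem partialDeriv_christoffel_fib_base_fib (hx : x ∈ V) (i j k : Fin 2) (l : Fin 4) :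
    partialDeriv l (christoffel G (fibIdx i) (baseIdx j) (fibIdx k)) x =
      -partialDeriv l (walkerConn a j k i) x :=
  (partialDeriv_congr h.isOpen (fun _ hy => h.christoffel_fib_base_fib hy i j k) hx l).trans
    (h.partialDeriv_neg_walkerConn hx j k i l)

theorem partialDeriv_partialDeriv_comm (hx : x ∈ V) (i j : Fin 2) (k l : Fin 4) :
    partialDeriv l (partialDeriv k (a i j)) x = partialDeriv k (partialDeriv l (a i j)) x :=
  partialDeriv_comm h.isOpen (h.smooth i j) hx l k

theorem partialDeriv_christoffel_base_base_fib (hx : x ∈ V) (i j k l : Fin 2) :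
    partialDeriv (fibIdx l) (christoffel G (baseIdx i) (baseIdx j) (fibIdx k)) x =
      -partialDeriv (baseIdx i) (walkerConn a j k l) x
      - partialDeriv (baseIdx j) (walkerConn a i k l) x
      + partialDeriv (baseIdx k) (walkerConn a i j l) x
      + ∑ m, (2 * walkerConn a k m l x * walkerConn a i j m x
        + 1 / 2 * (a k m x * partialDeriv (fibIdx l) (partialDeriv (fibIdx m) (a i j)) x)) := by
  rw [partialDeriv_congr h.isOpen (fun _ hy => h.christoffel_base_base_fib hy i j k) hx]
  have d := fun i j k => h.differentiableAt_partialDeriv hx i j k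
  have p := fun k m => (h.differentiableAt hx k m).fun_mul (h.differentiableAt_walkerConn hx i j m)
  simp only [Fin.sum_univ_two]
  rw [partialDeriv_sub ((((d _ _ _).fun_add (d _ _ _)).fun_sub (d _ _ _)).const_mul _)
    ((p _ _).fun_add (p _ _)), partialDeriv_const_mul (((d _ _ _).fun_add (d _ _ _)).fun_sub (d _ _ _)),
    partialDeriv_sub ((d _ _ _).fun_add (d _ _ _)) (d _ _ _), partialDeriv_add (d _ _ _) (d _ _ _),
    partialDeriv_add (p _ _) (p _ _),
    partialDeriv_mul (h.differentiableAt hx _ _) (h.differentiableAt_walkerConn hx _ _ _),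
    partialDeriv_mul (h.differentiableAt hx _ _) (h.differentiableAt_walkerConn hx _ _ _)]
  simp only [h.partialDeriv_walkerConn hx, h.partialDeriv_partialDeriv_comm hx _ _ (baseIdx _) (fibIdx _)]
  simp only [walkerConn]
  ring

/-- These components are the link between the known curvature on the plane field and the dependence
of `a` on the fibre coordinates. -/
theorem curvature_fib_base_fib_fib (hx : x ∈ V) (i j k l : Fin 2) :
    curvature (christoffel G) (fibIdx k) (baseIdx i) (fibIdx l) (fibIdx j) x =
      -(1 / 2) * partialDeriv (fibIdx k) (partialDeriv (fibIdx l) (a i j)) x := by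
  simp [-Fin.sum_univ_two, curvature, sum_base_fib, h.christoffel_base_fib_base hx,
    h.christoffel_fib_fib_base hx, h.christoffel_fib_fib_fib hx,
    h.partialDeriv_christoffel_base_fib_fib hx, h.partialDeriv_christoffel_fib_fib_fib hx,
    h.partialDeriv_walkerConn hx]

theorem curvature_fib_base_fib_base (hx : x ∈ V) (i j k l : Fin 2) :
    curvature (christoffel G) (fibIdx k) (baseIdx i) (fibIdx l) (baseIdx j) x = 0 := by
  simp [-Fin.sum_univ_two, curvature, sum_base_fib, h.christoffel_base_fib_base hx,
    h.christoffel_fib_base_base hx, h.christoffel_fib_fib_base hx, h.christoffel_fib_fib_fib hx,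
    h.partialDeriv_christoffel_base_fib_base hx, h.partialDeriv_christoffel_fib_fib_base hx]

theorem ricci_fib_base (hx : x ∈ V) (i j : Fin 2) :
    ricci (christoffel G) (fibIdx i) (baseIdx j) x =
      1 / 2 * ∑ k, partialDeriv (fibIdx i) (partialDeriv (fibIdx k) (a k j)) x := by
  simp only [ricci, sum_base_fib, curvature, h.christoffel_base_fib_base hx,
    h.christoffel_fib_base_base hx, h.christoffel_fib_fib_base hx, h.christoffel_fib_fib_fib hx,
    h.partialDeriv_christoffel_fib_base_base hx, h.partialDeriv_christoffel_base_base_base hx,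
    h.partialDeriv_christoffel_fib_base_fib hx,
    h.partialDeriv_walkerConn hx, Fin.sum_univ_two,
    h.partialDeriv_partialDeriv_symm hx j, h.partialDeriv_partialDeriv_comm hx _ _ (fibIdx i)]
  ring

/-- The Ricci form of the base components of the connection of a Walker metric. -/
theorem ricci_base_base (hx : x ∈ V) (i j : Fin 2) :
    ricci (christoffel G) (baseIdx i) (baseIdx j) x =
      (∑ k, -(partialDeriv (baseIdx i) (walkerConn a k j k) x
        - partialDeriv (baseIdx k) (walkerConn a i j k) x
        + ∑ m, (walkerConn a i m k x * walkerConn a k j m x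
          - walkerConn a k m k x * walkerConn a i j m x)))
      + (∑ k, -(partialDeriv (baseIdx j) (walkerConn a k i k) x
        - partialDeriv (baseIdx k) (walkerConn a j i k) x
        + ∑ m, (walkerConn a j m k x * walkerConn a k i m x
          - walkerConn a k m k x * walkerConn a j i m x)))
      + 1 / 2 * ∑ k, ∑ m, a k m x * partialDeriv (fibIdx k) (partialDeriv (fibIdx m) (a i j)) x := by
  have s := fun i j k => h.walkerConn_symm hx i j k
  have ps := fun i j k l => partialDeriv_congr h.isOpen (fun _ hy => h.walkerConn_symm hy i j k) hx l
  simp only [ricci, sum_base_fib, curvature, h.christoffel_base_fib_base hx,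
    h.christoffel_fib_base_base hx, h.christoffel_fib_fib_fib hx,
    h.christoffel_base_base_base hx, h.christoffel_fib_base_fib hx, h.christoffel_base_fib_fib hx,
    h.partialDeriv_christoffel_base_base_base hx,
    h.partialDeriv_christoffel_fib_base_fib hx, h.partialDeriv_christoffel_base_base_fib hx,
    Fin.sum_univ_two, s 1 0]
  fin_cases i <;> fin_cases j <;> simp [ps 1 0, s 1 0, h.symm 1 0 x hx] <;> ring

end IsWalker

end


noncomputable section

set_option maxSynthPendingDepth 3

/-! ### Self-dual Walker metrics -/

/-- The vector of fibre coordinates. -/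
def fibreVec (x : Coord 4) : Coord 2 := WithLp.toLp 2 fun k => fibreCoord k x

/-- The decomposition of `ℝ⁴` into the base and the fibre. -/
def joinCoord : (Coord 2 × Coord 2) ≃L[ℝ] Coord 4 :=
  LinearEquiv.toContinuousLinearEquiv
    { toFun := fun z => ∑ i, z.1 i • coordVec (baseIdx i) + ∑ i, z.2 i • coordVec (fibIdx i)
      map_add' := fun z z' => by simp only [Prod.fst_add, Prod.snd_add, PiLp.add_apply, add_smul,
        Finset.sum_add_distrib]; abel
      map_smul' := fun c z => by simp [mul_smul]
      invFun := fun x => (cotangentProj x, fibreVec x)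
      left_inv := fun z => by
        refine Prod.ext ?_ ?_ <;> ext i <;> fin_cases i <;>
        simp [cotangentProj, fibreVec, fibreCoord, baseIdx, fibIdx, Fin.castAdd, Fin.natAdd, Fin.castLE]
      right_inv := fun x => by
        ext i
        fin_cases i <;>
        simp [cotangentProj, fibreVec, fibreCoord, baseIdx, fibIdx, Fin.castAdd, Fin.natAdd,
          Fin.castLE] }

theorem joinCoord_apply (z : Coord 2 × Coord 2) :
    joinCoord z = ∑ i, z.1 i • coordVec (baseIdx i) + ∑ i, z.2 i • coordVec (fibIdx i) := rfl

@[simp] theorem joinCoord_proj (x : Coord 4) : joinCoord (cotangentProj x, fibreVec x) = x :=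
  joinCoord.apply_symm_apply x

@[simp] theorem cotangentProj_joinCoord (z : Coord 2 × Coord 2) :
    cotangentProj (joinCoord z) = z.1 :=
  congrArg Prod.fst (joinCoord.symm_apply_apply z)

@[simp] theorem fibreVec_joinCoord (z : Coord 2 × Coord 2) : fibreVec (joinCoord z) = z.2 :=
  congrArg Prod.snd (joinCoord.symm_apply_apply z)

theorem joinCoord_inl (i : Fin 2) : joinCoord (coordVec i, 0) = coordVec (baseIdx i) := by
  simp [joinCoord_apply, -Fin.sum_univ_two]

/-- The derivative along the zero section. -/
theorem partialDeriv_zeroSection {H : Coord 4 → ℝ} {y : Coord 2}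
    (hH : DifferentiableAt ℝ H (joinCoord (y, 0))) (i : Fin 2) :
    partialDeriv i (fun y => H (joinCoord (y, 0))) y =
      partialDeriv (baseIdx i) H (joinCoord (y, 0)) := by
  have h₁ : HasFDerivAt (fun y : Coord 2 => joinCoord (y, 0))
      ((joinCoord : (Coord 2 × Coord 2) →L[ℝ] Coord 4).comp (ContinuousLinearMap.inl ℝ _ _)) y :=
    ((joinCoord : (Coord 2 × Coord 2) →L[ℝ] Coord 4).comp
      (ContinuousLinearMap.inl ℝ (Coord 2) (Coord 2))).hasFDerivAt
  have h₂ := HasFDerivAt.comp (g := H) (f := fun y : Coord 2 => joinCoord (y, 0)) y hH.hasFDerivAt h₁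
  have h₃ : HasFDerivAt (fun y => H (joinCoord (y, 0))) _ y := h₂
  rw [partialDeriv, h₃.fderiv]
  simp [partialDeriv, ← joinCoord_inl]

theorem eq_of_hasDerivAt_zero {φ : ℝ → ℝ} (h : ∀ s ∈ Set.Icc (0 : ℝ) 1, HasDerivAt φ 0 s) :
    φ 1 = φ 0 := by
  obtain ⟨c, _, hc⟩ := exists_hasDerivAt_eq_slope φ (fun _ => 0) zero_lt_one
    (fun s hs => (h s hs).continuousAt.continuousWithinAt)
    fun s hs => h s (Set.Ioo_subset_Icc_self hs)
  simp at hc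
  linarith

/-- A function with constant second derivative is a quadratic polynomial. -/
theorem eq_quadratic_of_hasDerivAt {φ γ : ℝ → ℝ} {c : ℝ}
    (h₁ : ∀ s ∈ Set.Icc (0 : ℝ) 1, HasDerivAt φ (γ s) s)
    (h₂ : ∀ s ∈ Set.Icc (0 : ℝ) 1, HasDerivAt γ c s) : φ 1 = φ 0 + γ 0 + c / 2 := by
  have e₁ := eq_of_hasDerivAt_zero (φ := fun s => γ s - c * s) fun s hs => by
    exact ((h₂ s hs).fun_sub ((hasDerivAt_id' s).const_mul c)).congr_deriv (by ring)
  have e₂ := eq_of_hasDerivAt_zero (φ := fun s => φ s - γ s * s + c / 2 * s ^ 2) fun s hs => by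
    exact (((h₁ s hs).fun_sub ((h₂ s hs).fun_mul (hasDerivAt_id' s))).fun_add
      (((hasDerivAt_id' s).fun_pow 2).const_mul (c / 2))).congr_deriv (by simp; ring)
  simp at e₁ e₂
  linarith

/-- A neighbourhood of the zero section. -/
def fibreBox (r : ℝ) : Set (Coord 4) :=
  {x | cotangentProj x ∈ Metric.ball 0 r ∧ fibreVec x ∈ Metric.ball 0 r}

theorem joinCoord_mem_fibreBox {r : ℝ} {z : Coord 2 × Coord 2} :
    joinCoord z ∈ fibreBox r ↔ z.1 ∈ Metric.ball 0 r ∧ z.2 ∈ Metric.ball 0 r := by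
  simp [fibreBox]

theorem segment_mem_fibreBox {r : ℝ} {x : Coord 4} (hx : x ∈ fibreBox r) {s : ℝ}
    (hs : s ∈ Set.Icc (0 : ℝ) 1) : joinCoord (cotangentProj x, s • fibreVec x) ∈ fibreBox r := by
  refine joinCoord_mem_fibreBox.2 ⟨hx.1, ?_⟩
  have h2 := hx.2
  simp only [mem_ball_zero_iff, norm_smul, Real.norm_eq_abs, abs_of_nonneg hs.1] at h2 ⊢
  nlinarith [norm_nonneg (fibreVec x), hs.2]

theorem zero_mem_fibreBox {r : ℝ} {y : Coord 2} (hy : y ∈ Metric.ball 0 r) :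
    joinCoord (y, 0) ∈ fibreBox r :=
  joinCoord_mem_fibreBox.2 ⟨hy, Metric.mem_ball_self (Metric.pos_of_mem_ball hy)⟩

theorem hasDerivAt_segment {H : Coord 4 → ℝ} {x : Coord 4} {s : ℝ}
    (hH : DifferentiableAt ℝ H (joinCoord (cotangentProj x, s • fibreVec x))) :
    HasDerivAt (fun s : ℝ => H (joinCoord (cotangentProj x, s • fibreVec x)))
      (∑ k, fibreCoord k x * partialDeriv (fibIdx k) H (joinCoord (cotangentProj x, s • fibreVec x)))
      s := by
  have h₀ : HasDerivAt (fun s : ℝ => s • fibreVec x) (fibreVec x) s := by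
    simpa using (hasDerivAt_id s).smul_const (fibreVec x)
  have h₁ : HasDerivAt (fun s : ℝ => joinCoord (cotangentProj x, s • fibreVec x))
      (joinCoord (0, fibreVec x)) s :=
    ((joinCoord : (Coord 2 × Coord 2) →L[ℝ] Coord 4).hasFDerivAt.comp_hasDerivAt s
      ((hasDerivAt_const s (cotangentProj x)).prodMk h₀))
  have h₂ := hH.hasFDerivAt.comp_hasDerivAt s h₁
  refine HasDerivAt.congr_deriv (f := fun s : ℝ => H (joinCoord (cotangentProj x, s • fibreVec x)))
    h₂ ?_
  have e : joinCoord (0, fibreVec x) = ∑ k, fibreCoord k x • coordVec (fibIdx k) := by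
    rw [joinCoord_apply]
    simp [-Fin.sum_univ_two, fibreVec]
  rw [e]
  simp only [map_sum, map_smul, partialDeriv, smul_eq_mul]

namespace IsWalker

variable {r : ℝ} {G : Coord 4 → Matrix (Fin 4) (Fin 4) ℝ} {a : Fin 2 → Fin 2 → Coord 4 → ℝ}
  (h : IsWalker (fibreBox r) G a) {F lam c : Coord 4 → ℝ} {μ : ℝ}

include h

theorem eq_on_fibres (hF : ContDiffOn ℝ ∞ F (fibreBox r))
    (hFf : ∀ x ∈ fibreBox r, ∀ k, partialDeriv (fibIdx k) F x = 0) {x : Coord 4}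
    (hx : x ∈ fibreBox r) : F x = F (joinCoord (cotangentProj x, 0)) := by
  have := eq_of_hasDerivAt_zero (φ := fun s => F (joinCoord (cotangentProj x, s • fibreVec x)))
    fun s hs => by
      have hs' := segment_mem_fibreBox hx hs
      have := hasDerivAt_segment (H := F) (x := x) (s := s)
        ((hF.contDiffAt (h.isOpen.mem_nhds hs')).differentiableAt (by simp))
      simpa [hFf _ hs'] using this
  simpa using this

/-- The sign changes from `curvature` to `riem`. Lowering the index only sees the fibre component,
as the base component of the curvature is zero here. -/
theorem inner_riem_coordVec {x : Coord 4} (hx : x ∈ fibreBox r)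
    (hd : DifferentiableAt ℝ (connForm (christoffel G)) x) (i j k l : Fin 2) :
    matrixForm (G x) (riem (connForm (christoffel G)) x (coordVec (fibIdx k)) (coordVec (baseIdx i))
      (coordVec (fibIdx l))) (coordVec (baseIdx j)) =
      1 / 2 * partialDeriv (fibIdx k) (partialDeriv (fibIdx l) (a i j)) x := by
  have e := curvatureTensor_eq hd (fibIdx k) (baseIdx i) (fibIdx l) (baseIdx j)
  rw [← neg_inj, ← e, curvatureTensor, sum_base_fib]
  simp only [h.curvature_fib_base_fib_base hx, h.curvature_fib_base_fib_fib hx, h.eq x hx,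
    walkerMatrix_fib_base]
  simp [-Fin.sum_univ_two, Matrix.one_apply]

/-- The second fibre derivatives of the components of a self-dual Walker metric. -/
theorem fibre_hessian (hF : ContDiffOn ℝ ∞ F (fibreBox r))
    (hFf : ∀ x ∈ fibreBox r, ∀ k, partialDeriv (fibIdx k) F x = 0)
    (hd : ∀ x ∈ fibreBox r, DifferentiableAt ℝ (connForm (christoffel G)) x)
    (heq : ∀ x ∈ fibreBox r, ∀ i j, hessian (christoffel G) F i j x + ricci (christoffel G) i j x
      - μ * (partialDeriv i F x * partialDeriv j F x) = lam x * G x i j)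
    (hc : ∀ x ∈ fibreBox r, 3 * c x = lam x)
    (hR : ∀ x ∈ fibreBox r, ∀ b w b' w' : Fin 2 → ℝ, b 0 * w 0 + b 1 * w 1 = 0 →
      b' 0 * w' 0 + b' 1 * w' 1 = 0 →
      matrixForm (G x) (riem (connForm (christoffel G)) x
        (b 0 • coordVec (fibIdx 0) + b 1 • coordVec (fibIdx 1))
        (w 0 • coordVec (baseIdx 0) + w 1 • coordVec (baseIdx 1))
        (b' 0 • coordVec (fibIdx 0) + b' 1 • coordVec (fibIdx 1)))
        (w' 0 • coordVec (baseIdx 0) + w' 1 • coordVec (baseIdx 1)) =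
      c x * ((b 0 * w' 0 + b 1 * w' 1) * (w 0 * b' 0 + w 1 * b' 1)))
    {x : Coord 4} (hx : x ∈ fibreBox r) (i j k l : Fin 2) :
    partialDeriv (fibIdx k) (partialDeriv (fibIdx l) (a i j)) x =
      2 / 3 * lam x * ((1 : Matrix (Fin 2) (Fin 2) ℝ) k i * (1 : Matrix (Fin 2) (Fin 2) ℝ) l j
        + (1 : Matrix (Fin 2) (Fin 2) ℝ) k j * (1 : Matrix (Fin 2) (Fin 2) ℝ) l i) := by
  -- `F` is constant on fibres, so its mixed Hessian and the term `dF ⊗ dF` vanish in these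
  -- components.
  have hric : ∀ i j, ricci (christoffel G) (fibIdx i) (baseIdx j) x =
      lam x * (1 : Matrix (Fin 2) (Fin 2) ℝ) i j := by
    intro i j
    have e := heq x hx (fibIdx i) (baseIdx j)
    have z : partialDeriv (fibIdx i) (partialDeriv (baseIdx j) F) x = 0 := by
      rw [partialDeriv_comm h.isOpen hF hx, partialDeriv_congr h.isOpen (fun y hy => hFf y hy i) hx]
      exact partialDeriv_const _ 0
    rw [h.eq x hx, walkerMatrix_fib_base, hessian, sum_base_fib, z] at e
    simpa [-Fin.sum_univ_two, hFf x hx, h.christoffel_fib_base_base hx] using e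
  have r := fun i j => (h.ricci_fib_base hx i j).symm.trans (hric i j)
  have q := hR x hx
  have s := fun i j k l => h.partialDeriv_partialDeriv_symm hx i j k l
  have s' := fun i j k l => h.partialDeriv_partialDeriv_comm hx i j k l
  simp only [riem_add_left, riem_smul_left, riem_add_middle, riem_smul_middle, riem_add_right,
    riem_smul_right, map_add, map_smul, add_apply, smul_apply, smul_eq_mul,
    h.inner_riem_coordVec hx (hd x hx)] at q
  simp only [Fin.sum_univ_two] at r
  have hcx := hc x hx
  -- By symmetry there are nine unknown second fibre derivatives. Five equations come from
  -- orthogonal pairs in the curvature formula, where `![1, -1]` and `![1, 1]` reach the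
  -- off-diagonal terms, and four from the mixed Ricci components.
  have q₁ := q ![1, 0] ![0, 1] ![1, 0] ![0, 1] (by simp) (by simp)
  have q₂ := q ![1, 0] ![0, 1] ![0, 1] ![1, 0] (by simp) (by simp)
  have q₃ := q ![0, 1] ![1, 0] ![0, 1] ![1, 0] (by simp) (by simp)
  have q₄ := q ![1, 0] ![0, 1] ![1, -1] ![1, 1] (by simp) (by simp)
  have q₅ := q ![0, 1] ![1, 0] ![1, -1] ![1, 1] (by simp) (by simp)
  have r₁ := r 0 0
  have r₂ := r 0 1
  have r₃ := r 1 0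
  have r₄ := r 1 1
  have e₀₀ : (1 : Matrix (Fin 2) (Fin 2) ℝ) 0 0 = 1 := rfl
  have e₀₁ : (1 : Matrix (Fin 2) (Fin 2) ℝ) 0 1 = 0 := rfl
  have e₁₀ : (1 : Matrix (Fin 2) (Fin 2) ℝ) 1 0 = 0 := rfl
  have e₁₁ : (1 : Matrix (Fin 2) (Fin 2) ℝ) 1 1 = 1 := rfl
  simp only [Matrix.cons_val, zero_mul, mul_zero, one_mul, mul_one, add_zero, zero_add,
    neg_mul, mul_neg, s 1 0, s' _ _ (fibIdx 0) (fibIdx 1), e₀₀, e₀₁, e₁₀, e₁₁]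
    at q₁ q₂ q₃ q₄ q₅ r₁ r₂ r₃ r₄
  revert i j k l
  simp only [Fin.forall_fin_two, e₀₀, e₀₁, e₁₀, e₁₁, s 1 0, s' _ _ (fibIdx 0) (fibIdx 1)]
  and_intros <;> linarith

/-- The components of a self-dual Walker metric are quadratic polynomials on the fibres. -/
theorem eq_quadratic {t : Coord 4 → ℝ} (ht : ∀ x ∈ fibreBox r, t x = t (joinCoord (cotangentProj x, 0)))
    (hA : ∀ x ∈ fibreBox r, ∀ i j k l, partialDeriv (fibIdx k) (partialDeriv (fibIdx l) (a i j)) x =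
      t x * ((1 : Matrix (Fin 2) (Fin 2) ℝ) k i * (1 : Matrix (Fin 2) (Fin 2) ℝ) l j
        + (1 : Matrix (Fin 2) (Fin 2) ℝ) k j * (1 : Matrix (Fin 2) (Fin 2) ℝ) l i))
    {x : Coord 4} (hx : x ∈ fibreBox r) (i j : Fin 2) :
    a i j x = t (joinCoord (cotangentProj x, 0)) * (fibreCoord i x * fibreCoord j x)
      - 2 * (∑ k, fibreCoord k x * walkerConn a i j k (joinCoord (cotangentProj x, 0)))
      + a i j (joinCoord (cotangentProj x, 0)) := by
  set z := joinCoord (cotangentProj x, 0) with hz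
  have key := eq_quadratic_of_hasDerivAt
    (φ := fun s => a i j (joinCoord (cotangentProj x, s • fibreVec x)))
    (γ := fun s => ∑ l, fibreCoord l x *
      partialDeriv (fibIdx l) (a i j) (joinCoord (cotangentProj x, s • fibreVec x)))
    (c := 2 * t z * (fibreCoord i x * fibreCoord j x))
    (fun s hs => hasDerivAt_segment (h.differentiableAt (segment_mem_fibreBox hx hs) i j))
    (fun s hs => by
      have hs' := segment_mem_fibreBox hx hs
      have e := HasDerivAt.fun_sum (u := Finset.univ) fun l _ =>
        (hasDerivAt_segment (h.differentiableAt_partialDeriv hs' i j (fibIdx l))).const_mul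
          (fibreCoord l x)
      refine e.congr_deriv ?_
      have hts : t (joinCoord (cotangentProj x, s • fibreVec x)) = t z := by
        rw [ht _ hs', cotangentProj_joinCoord]
      simp only [hA _ hs', hts, Matrix.one_apply]
      fin_cases i <;> fin_cases j <;> simp <;> ring)
  simp only [one_smul, zero_smul, joinCoord_proj, ← hz] at key
  rw [key]
  simp only [walkerConn, Fin.sum_univ_two]
  ring

/-- The affine surface of a Walker metric. -/
def surface : AffineSurface where
  carrier := Metric.ball 0 r
  isOpen_carrier := Metric.isOpen_ball
  Γ := fun i j k y => walkerConn a i j k (joinCoord (y, 0))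
  smooth := fun i j k => by
    refine ContDiffOn.comp (t := fibreBox r)
      (contDiffOn_const.mul (contDiffOn_partialDeriv h.isOpen (h.smooth i j) (fibIdx k)))
      (joinCoord.contDiff.comp (contDiff_id.prodMk contDiff_const)).contDiffOn
      fun y hy => zero_mem_fibreBox hy
  torsion_free := fun i j k y hy => h.walkerConn_symm (zero_mem_fibreBox hy) i j k

/-- Connection, tensor and potential on the base are the restrictions of `walkerConn a`, `a` and `F`
to the zero section; constancy or quadratic dependence along the fibres recovers everything else.
The equation on the base is the base part of the quasi-Einstein equation on the zero section. -/
theorem exists_extension (hF : ContDiffOn ℝ ∞ F (fibreBox r))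
    (hFf : ∀ x ∈ fibreBox r, ∀ k, partialDeriv (fibIdx k) F x = 0)
    (heq : ∀ x ∈ fibreBox r, ∀ i j, hessian (christoffel G) F i j x + ricci (christoffel G) i j x
      - μ * (partialDeriv i F x * partialDeriv j F x) = lam x * G x i j)
    {t : Coord 4 → ℝ} (hlt : ∀ x ∈ fibreBox r, lam x = 3 / 2 * t x)
    (ht : ∀ x ∈ fibreBox r, t x = t (joinCoord (cotangentProj x, 0)))
    (hA : ∀ x ∈ fibreBox r, ∀ i j k l, partialDeriv (fibIdx k) (partialDeriv (fibIdx l) (a i j)) x =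
      t x * ((1 : Matrix (Fin 2) (Fin 2) ℝ) k i * (1 : Matrix (Fin 2) (Fin 2) ℝ) l j
        + (1 : Matrix (Fin 2) (Fin 2) ℝ) k j * (1 : Matrix (Fin 2) (Fin 2) ℝ) l i)) :
    ∃ (S : AffineSurface) (Φ : Fin 2 → Fin 2 → Coord 2 → ℝ) (fhat : Coord 2 → ℝ),
      S.carrier = Metric.ball 0 r ∧ S.IsSymmTensor Φ ∧ ContDiffOn ℝ ∞ fhat S.carrier ∧
      (∀ x ∈ fibreBox r, F x = fhat (cotangentProj x)) ∧
      (∀ y ∈ S.carrier, ∀ i j,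
        S.quasiEinsteinTensor μ fhat i j y = t (joinCoord (y, 0)) / 2 * Φ i j y) ∧
      ∀ x ∈ fibreBox r, G x = walkerMatrix (Matrix.of fun i j =>
        t (joinCoord (cotangentProj x, 0)) * (fibreCoord i x * fibreCoord j x)
        - 2 * (∑ k, fibreCoord k x * S.Γ i j k (cotangentProj x)) + Φ i j (cotangentProj x)) := by
  have hball : IsOpen (Metric.ball (0 : Coord 2) r) := Metric.isOpen_ball
  have hzero : ContDiff ℝ ∞ fun y : Coord 2 => joinCoord (y, 0) :=
    joinCoord.contDiff.comp (contDiff_id.prodMk contDiff_const)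
  have hmaps : Set.MapsTo (fun y : Coord 2 => joinCoord (y, 0)) (Metric.ball 0 r) (fibreBox r) :=
    fun y hy => zero_mem_fibreBox hy
  have hpull : ∀ {H : Coord 4 → ℝ}, ContDiffOn ℝ ∞ H (fibreBox r) → ∀ {y}, y ∈ Metric.ball 0 r →
      ∀ i, partialDeriv i (fun y => H (joinCoord (y, 0))) y =
        partialDeriv (baseIdx i) H (joinCoord (y, 0)) := fun hH y hy i =>
    partialDeriv_zeroSection ((hH.contDiffAt (h.isOpen.mem_nhds (hmaps hy))).differentiableAt
      (by simp)) i
  refine ⟨h.surface, fun i j y => a i j (joinCoord (y, 0)), fun y => F (joinCoord (y, 0)), rfl,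
    ⟨fun i j => (h.smooth i j).comp hzero.contDiffOn hmaps,
      fun i j y hy => h.symm i j _ (hmaps hy)⟩, hF.comp hzero.contDiffOn hmaps,
    fun x hx => h.eq_on_fibres hF hFf hx, fun y hy i j => ?_, fun x hx => ?_⟩
  · have hyr : y ∈ Metric.ball (0 : Coord 2) r := hy
    have hz := hmaps hyr
    have e := heq _ hz (baseIdx i) (baseIdx j)
    have hw : ∀ i j k, ContDiffOn ℝ ∞ (walkerConn a i j k) (fibreBox r) := fun i j k =>
      contDiffOn_const.mul (contDiffOn_partialDeriv h.isOpen (h.smooth i j) (fibIdx k))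
    have hΓ : ∀ i j k l, partialDeriv l (h.surface.Γ i j k) y =
        partialDeriv (baseIdx l) (walkerConn a i j k) (joinCoord (y, 0)) :=
      fun i j k l => hpull (hw i j k) hyr l
    have hΓ' : ∀ i j k, h.surface.Γ i j k y = walkerConn a i j k (joinCoord (y, 0)) :=
      fun _ _ _ => rfl
    have hF₂ : partialDeriv i (partialDeriv j fun y => F (joinCoord (y, 0))) y =
        partialDeriv (baseIdx i) (partialDeriv (baseIdx j) F) (joinCoord (y, 0)) := by
      rw [partialDeriv_congr hball (fun y hy => hpull hF hy j) hyr]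
      exact hpull (contDiffOn_partialDeriv h.isOpen hF _) hyr i
    rw [h.ricci_base_base hz, hessian, sum_base_fib, hlt _ hz, h.eq _ hz,
      walkerMatrix_base_base] at e
    simp only [h.christoffel_base_base_base hz, hFf _ hz, mul_zero, Finset.sum_const_zero, add_zero,
      hA _ hz, Matrix.of_apply] at e
    -- The fibre Hessian adds `t a_ij` to the Ricci tensor, and the rest of it is twice the
    -- symmetrised Ricci tensor of the base. Against `λ a_ij = 3/2 t a_ij` this leaves `t/2 a_ij`.
    have htr : ∑ k, ∑ m, a k m (joinCoord (y, 0)) * (t (joinCoord (y, 0)) *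
        ((1 : Matrix (Fin 2) (Fin 2) ℝ) k i * (1 : Matrix (Fin 2) (Fin 2) ℝ) m j
        + (1 : Matrix (Fin 2) (Fin 2) ℝ) k j * (1 : Matrix (Fin 2) (Fin 2) ℝ) m i)) =
        2 * t (joinCoord (y, 0)) * a i j (joinCoord (y, 0)) := by
      have hs := h.symm 1 0 _ hz
      fin_cases i <;> fin_cases j <;> simp [Matrix.one_apply, hs] <;> ring
    rw [htr] at e
    simp only [AffineSurface.quasiEinsteinTensor, ricciSymm, ricci, curvature, hessian, hΓ, hΓ', hF₂,
      hpull hF hyr]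
    linarith
  · rw [h.eq x hx]
    congr 1
    ext i j
    exact h.eq_quadratic ht hA hx i j

end IsWalker

end


noncomputable section

set_option maxSynthPendingDepth 3

/-! ### Walker coordinates of self-dual metrics with an isotropic potential -/

theorem exists_fibreBox_subset {W : Set (Coord 4)} (hW : W ∈ 𝓝 (0 : Coord 4)) :
    ∃ r > 0, fibreBox r ⊆ W := by
  have hj : joinCoord ⁻¹' W ∈ 𝓝 ((0 : Coord 2), (0 : Coord 2)) :=
    joinCoord.continuous.continuousAt.preimage_mem_nhds (by rwa [← Prod.zero_eq_mk, map_zero])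
  obtain ⟨r, hr, h⟩ := Metric.mem_nhds_iff.1 hj
  refine ⟨r, hr, fun x hx => ?_⟩
  have : (cotangentProj x, fibreVec x) ∈ joinCoord ⁻¹' W := h (by
    rw [← ball_prod_same]
    exact hx)
  simpa using this

theorem isOpen_fibreBox (r : ℝ) : IsOpen (fibreBox r) := by
  have : fibreBox r = joinCoord.symm ⁻¹' (Metric.ball 0 r ×ˢ Metric.ball 0 r) := rfl
  rw [this]
  exact (Metric.isOpen_ball.prod Metric.isOpen_ball).preimage joinCoord.symm.continuous

namespace IsIsotropicSelfDual

variable {U : Set (Coord 4)} {B : Coord 4 → Coord 4 →L[ℝ] Coord 4 →L[ℝ] ℝ}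
  {Γ : Coord 4 → Coord 4 →L[ℝ] Coord 4 →L[ℝ] Coord 4} {F lam ψ : Coord 4 → ℝ}
  {μ : ℝ} {n₁ n₂ m₁ m₂ : Coord 4 → Coord 4}
  (h : IsIsotropicSelfDual U B Γ F lam ψ μ n₁ n₂ m₁ m₂) {x : Coord 4}

include h

/-- The Walker coordinates are transported from `ℝ² × ℝ²` to `ℝ⁴` and cut down to a box, whose
fibres are star-shaped about the zero section. -/
theorem exists_walker_parametrization (hμ : μ ≠ -(1 / 2)) (hx : x ∈ U) :
    ∃ r > 0, ∃ Ψ : OpenPartialHomeomorph (Coord 4) (Coord 4), Ψ.source = fibreBox r ∧ Ψ 0 = x ∧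
      Ψ.target ⊆ U ∧ ContDiffOn ℝ ∞ Ψ Ψ.source ∧ ContDiffOn ℝ ∞ Ψ.symm Ψ.target ∧
      (∀ z ∈ Ψ.source, Function.Surjective (fderiv ℝ Ψ z)) ∧
      ∀ z ∈ Ψ.source, ∀ b,
        (∀ v, B (Ψ z) (fderiv ℝ Ψ z (joinCoord (0, b))) (fderiv ℝ Ψ z v) =
          inner ℝ (cotangentProj v) b) ∧
        B (Ψ z) (fderiv ℝ Ψ z (joinCoord (0, b))) (n₁ (Ψ z)) = 0 ∧
        B (Ψ z) (fderiv ℝ Ψ z (joinCoord (0, b))) (n₂ (Ψ z)) = 0 := by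
  obtain ⟨e, he0, hex, heU, hes, hesymm, hB⟩ := h.exists_walker_coordinates hμ hx
  set Ψ₀ := joinCoord.symm.toHomeomorph.toOpenPartialHomeomorph.trans e with hΨ₀
  have hsrc : Ψ₀.source ∈ 𝓝 (0 : Coord 4) := Ψ₀.open_source.mem_nhds (by
    have : joinCoord.symm (0 : Coord 4) = (0, 0) := map_zero _
    simp only [hΨ₀, OpenPartialHomeomorph.trans_source]
    exact ⟨trivial, by simpa using (this ▸ he0 : joinCoord.symm (0 : Coord 4) ∈ e.source)⟩)
  obtain ⟨r, hr, hrs⟩ := exists_fibreBox_subset hsrc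
  set Ψ := Ψ₀.restrOpen (fibreBox r) (isOpen_fibreBox r) with hΨ
  have hΨs : Ψ.source = fibreBox r := Set.inter_eq_right.2 hrs
  have hmem : ∀ z ∈ Ψ.source, joinCoord.symm z ∈ e.source := fun z hz => (hz.1.2 : _)
  have hΨe : ∀ z, Ψ z = e (joinCoord.symm z) := fun _ => rfl
  have hΨt : Ψ.target ⊆ e.target := fun y hy => by
    have := hmem _ (Ψ.map_target hy)
    have h2 := e.map_source this
    rwa [← hΨe, Ψ.right_inv hy] at h2
  have hΨsymm : ∀ y ∈ Ψ.target, Ψ.symm y = joinCoord (e.symm y) := fun y _ => rfl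
  have hd : ∀ z ∈ Ψ.source, ∀ v, fderiv ℝ Ψ z v = fderiv ℝ e (joinCoord.symm z) (joinCoord.symm v) := by
    intro z hz v
    have h₁ : HasFDerivAt e (fderiv ℝ e (joinCoord.symm z)) (joinCoord.symm z) :=
      ((hes.contDiffAt (e.open_source.mem_nhds (hmem z hz))).differentiableAt (by simp)).hasFDerivAt
    have h₂ : HasFDerivAt Ψ _ z := h₁.comp z joinCoord.symm.hasFDerivAt
    rw [h₂.fderiv]
    rfl
  have hΨc : ContDiffOn ℝ ∞ Ψ Ψ.source := hes.comp joinCoord.symm.contDiff.contDiffOn hmem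
  have hΨsc : ContDiffOn ℝ ∞ Ψ.symm Ψ.target :=
    joinCoord.contDiff.comp_contDiffOn (hesymm.mono hΨt)
  refine ⟨r, hr, Ψ, hΨs, by rw [hΨe, map_zero]; exact hex, hΨt.trans heU, hΨc, hΨsc,
    fun z hz v => ?_, fun z hz b => ?_⟩
  · have hy := Ψ.map_source hz
    have h₁ : HasFDerivAt Ψ.symm (fderiv ℝ Ψ.symm (Ψ z)) (Ψ z) :=
      ((hΨsc.contDiffAt (Ψ.open_target.mem_nhds hy)).differentiableAt (by simp)).hasFDerivAt
    have h₂ : HasFDerivAt Ψ (fderiv ℝ Ψ z) (Ψ.symm (Ψ z)) := by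
      rw [Ψ.left_inv hz]
      exact ((hΨc.contDiffAt (Ψ.open_source.mem_nhds hz)).differentiableAt (by simp)).hasFDerivAt
    have h₃ := (HasFDerivAt.comp (g := Ψ) (f := Ψ.symm) (Ψ z) h₂ h₁).unique
      ((hasFDerivAt_id (Ψ z)).congr_of_eventuallyEq (by
        filter_upwards [Ψ.open_target.mem_nhds hy] with y hy using Ψ.right_inv hy))
    exact ⟨fderiv ℝ Ψ.symm (Ψ z) v, congrArg (fun L => L v) h₃⟩
  · obtain ⟨h₁, h₂, h₃⟩ := hB (joinCoord.symm z) (hmem z hz) b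
    have hb : joinCoord.symm (joinCoord ((0 : Coord 2), b)) = (0, b) := joinCoord.symm_apply_apply _
    refine ⟨fun v => ?_, ?_, ?_⟩
    · rw [hd z hz, hd z hz, hb, hΨe, h₁]
      rfl
    · rw [hd z hz, hb, hΨe, h₂]
    · rw [hd z hz, hb, hΨe, h₃]

/-- The components `G` are left free and only required to represent the pulled back form: in the
application they are the matrix of the manifold metric in the new chart. Self-duality enters through
`inner_riem_plane`, carried over by `map_riem`. -/
theorem exists_walker_chart (hμ : μ ≠ -(1 / 2)) (hx : x ∈ U) :
    ∃ r > 0, ∃ Ψ : OpenPartialHomeomorph (Coord 4) (Coord 4), Ψ.source = fibreBox r ∧ Ψ 0 = x ∧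
      Ψ.target ⊆ U ∧ ContDiffOn ℝ ∞ Ψ Ψ.source ∧ ContDiffOn ℝ ∞ Ψ.symm Ψ.target ∧
      ∀ G : Coord 4 → Matrix (Fin 4) (Fin 4) ℝ,
        (∀ i j, ContDiffOn ℝ ∞ (fun z => G z i j) (fibreBox r)) →
        (∀ z ∈ fibreBox r, ∀ u v, matrixForm (G z) u v =
          B (Ψ z) (fderiv ℝ Ψ z u) (fderiv ℝ Ψ z v)) →
        (∀ z ∈ fibreBox r, ∀ i j, hessian (christoffel G) (F ∘ Ψ) i j z
          + ricci (christoffel G) i j z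
          - μ * (partialDeriv i (F ∘ Ψ) z * partialDeriv j (F ∘ Ψ) z) = lam (Ψ z) * G z i j) →
        ∃ a : Fin 2 → Fin 2 → Coord 4 → ℝ, IsWalker (fibreBox r) G a ∧
          ContDiffOn ℝ ∞ (F ∘ Ψ) (fibreBox r) ∧
          (∀ z ∈ fibreBox r, ∀ k, partialDeriv (fibIdx k) (F ∘ Ψ) z = 0) ∧
          (∀ z ∈ fibreBox r, lam (Ψ z) = lam (Ψ (joinCoord (cotangentProj z, 0)))) ∧
          ∀ z ∈ fibreBox r, ∀ i j k l,
            partialDeriv (fibIdx k) (partialDeriv (fibIdx l) (a i j)) z = 2 / 3 * lam (Ψ z) *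
            ((1 : Matrix (Fin 2) (Fin 2) ℝ) k i * (1 : Matrix (Fin 2) (Fin 2) ℝ) l j
            + (1 : Matrix (Fin 2) (Fin 2) ℝ) k j * (1 : Matrix (Fin 2) (Fin 2) ℝ) l i) := by
  obtain ⟨r, hr, Ψ, hΨs, hΨ0, hΨU, hΨc, hΨsc, hsurj, hB⟩ := h.exists_walker_parametrization hμ hx
  refine ⟨r, hr, Ψ, hΨs, hΨ0, hΨU, hΨc, hΨsc, fun G hG hGB heq => ?_⟩
  rw [hΨs] at hΨc hsurj hB
  have hVU : Set.MapsTo Ψ (fibreBox r) U := fun z hz => hΨU (Ψ.map_source (hΨs ▸ hz))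
  have hfib : ∀ i : Fin 2, joinCoord (0, coordVec i) = coordVec (fibIdx i) := fun i => by
    simp [joinCoord_apply, -Fin.sum_univ_two]
  have hpb : ∀ i : Fin 2, cotangentProj (coordVec (baseIdx i)) = coordVec i := fun i => by
    rw [← joinCoord_inl, cotangentProj_joinCoord]
  have hpf : ∀ i : Fin 2, cotangentProj (coordVec (fibIdx i)) = 0 := fun i => by
    rw [← hfib, cotangentProj_joinCoord]
  have hGs : ∀ z ∈ fibreBox r, ∀ i j, G z i j = G z j i := fun z hz i j => by
    rw [← matrixForm_coordVec (G z), ← matrixForm_coordVec (G z), hGB z hz, hGB z hz,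
      h.symm _ (hVU hz)]
  have hGf : ∀ z ∈ fibreBox r, ∀ i j, G z (fibIdx i) j = cotangentProj (coordVec j) i :=
    fun z hz i j => by
      rw [← matrixForm_coordVec (G z), hGB z hz, ← hfib, (hB z hz _).1]
      simp [EuclideanSpace.inner_single_right]
  have hW : IsWalker (fibreBox r) G fun i j z => G z (baseIdx i) (baseIdx j) := by
    refine ⟨isOpen_fibreBox r, fun i j => hG _ _, fun i j z hz => hGs z hz _ _, fun z hz => ?_⟩
    ext i j
    have hcases : ∀ k : Fin 4, (∃ i, k = baseIdx i) ∨ ∃ i, k = fibIdx i := fun k =>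
      Fin.addCases (m := 2) (n := 2) (motive := fun k : Fin 4 => (∃ i, k = baseIdx i) ∨ ∃ i, k = fibIdx i)
        (fun i => Or.inl ⟨i, rfl⟩) (fun i => Or.inr ⟨i, rfl⟩) k
    obtain ⟨i, rfl⟩ | ⟨i, rfl⟩ := hcases i <;> obtain ⟨j, rfl⟩ | ⟨j, rfl⟩ := hcases j
    · simp
    · rw [hGs z hz, hGf z hz, hpb, walkerMatrix_base_fib, Matrix.one_apply, PiLp.single_apply]
      simp only [eq_comm]
    · rw [hGf z hz, hpb, walkerMatrix_fib_base, Matrix.one_apply, PiLp.single_apply]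
    · rw [hGf z hz, hpf, walkerMatrix_fib_fib]
      rfl
  have hnd : ∀ z ∈ fibreBox r, ∀ u, (∀ v, matrixForm (G z) u v = 0) → u = 0 := by
    intro z hz u hu
    have hJ : fderiv ℝ Ψ z u = 0 := h.nondegenerate _ (hVU hz) _ fun t => by
      obtain ⟨v, rfl⟩ := hsurj z hz t
      rw [← hGB z hz, hu]
    exact (map_eq_zero_iff (fderiv ℝ Ψ z)
      ((LinearMap.injective_iff_surjective (f := (fderiv ℝ Ψ z).toLinearMap)).2 (hsurj z hz))).1 hJ
  have hLC := isLeviCivita_christoffel (isOpen_fibreBox r) hG hGs hnd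
  have hΨd : ∀ z ∈ fibreBox r, HasFDerivAt Ψ (fderiv ℝ Ψ z) z := fun z hz =>
    ((hΨc.contDiffAt ((isOpen_fibreBox r).mem_nhds hz)).differentiableAt (by simp)).hasFDerivAt
  have hpull : ∀ {H : Coord 4 → ℝ}, ContDiffOn ℝ ∞ H U → ∀ z ∈ fibreBox r, ∀ i,
      partialDeriv i (H ∘ Ψ) z = fderiv ℝ H (Ψ z) (fderiv ℝ Ψ z (coordVec i)) := fun hH z hz i => by
    have h₁ := (h.differentiableAt_of_contDiffOn hH (hVU hz)).hasFDerivAt.comp z (hΨd z hz)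
    rw [partialDeriv, h₁.fderiv]
    rfl
  have hFfib : ∀ z ∈ fibreBox r, ∀ k, fderiv ℝ F (Ψ z) (fderiv ℝ Ψ z (coordVec (fibIdx k))) = 0 :=
    fun z hz k => h.fderiv_plane (hVU hz) (by rw [← hfib]; exact (hB z hz _).2.1)
  have hFs : ContDiffOn ℝ ∞ (F ∘ Ψ) (fibreBox r) := h.smooth_potential.comp hΨc hVU
  have hFf : ∀ z ∈ fibreBox r, ∀ k, partialDeriv (fibIdx k) (F ∘ Ψ) z = 0 := fun z hz k => by
    rw [hpull h.smooth_potential z hz, hFfib z hz]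
  refine ⟨_, hW, hFs, hFf, fun z hz => ?_, fun z hz i j k l => ?_⟩
  · refine hW.eq_on_fibres (h.smooth_lam.comp hΨc hVU) (fun z hz k => ?_) hz
    rw [hpull h.smooth_lam z hz, h.fderiv_lam hμ (hVU hz), hFfib z hz, mul_zero]
  · refine hW.fibre_hessian (lam := lam ∘ Ψ) (c := ψ ∘ Ψ) (μ := μ) hFs hFf
      (fun z hz => (hLC.contDiffAt_conn hz).differentiableAt (by simp)) heq
      (fun z hz => h.three_mul_ψ hμ (hVU hz)) (fun z hz b w b' w' hbw hbw' => ?_) hz i j k l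
    have hj : ∀ b : Fin 2 → ℝ, b 0 • coordVec (fibIdx 0) + b 1 • coordVec (fibIdx 1) =
        joinCoord (0, WithLp.toLp 2 b) := fun b => by simp [joinCoord_apply]
    have hp : ∀ w : Fin 2 → ℝ, cotangentProj (w 0 • coordVec (baseIdx 0) + w 1 • coordVec (baseIdx 1)) =
        WithLp.toLp 2 w := fun w => by
      have e := cotangentProj_joinCoord (WithLp.toLp 2 w, 0)
      rw [joinCoord_apply] at e
      simpa using e
    have hin : ∀ w b : Fin 2 → ℝ, inner ℝ (WithLp.toLp 2 w : Coord 2) (WithLp.toLp 2 b) =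
        w 0 * b 0 + w 1 * b 1 := fun w b => by
      simp [PiLp.inner_apply, mul_comm]
    rw [hGB z hz, h.map_riem hLC hΨc hVU hGB hsurj hz, hj, hj, h.inner_riem_plane hμ (hVU hz)
      (hB z hz _).2.1 (hB z hz _).2.2 (hB z hz _).2.1 (hB z hz _).2.2, (hB z hz _).1,
      h.symm _ (hVU hz) (fderiv ℝ Ψ z (w 0 • _ + _)), (hB z hz _).1, hp, hp]
    · rw [hin, hin, Function.comp_apply]
      ring
    · rw [(hB z hz _).1, hp, hin]
      linarith
    · rw [(hB z hz _).1, hp, hin]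
      linarith

end IsIsotropicSelfDual

end


noncomputable section

set_option maxSynthPendingDepth 3

/-! ### The metric in charts -/

section

variable {n : ℕ} {M : Type*} [TopologicalSpace M] [ChartedSpace (Coord n) M]

theorem matrixForm_chartMatrix
    (t : (p : M) → TangentSpace (𝓡 n) p →L[ℝ] TangentSpace (𝓡 n) p →L[ℝ] ℝ)
    (e : OpenPartialHomeomorph M (Coord n)) (x u v : Coord n) :
    matrixForm (chartMatrix t e x) u v = t (e.symm x) (mfderiv (𝓡 n) (𝓡 n) e.symm x u)
      (mfderiv (𝓡 n) (𝓡 n) e.symm x v) := by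
  let J : Coord n →L[ℝ] Coord n := mfderiv (𝓡 n) (𝓡 n) e.symm x
  let t' : Coord n →L[ℝ] Coord n →L[ℝ] ℝ := t (e.symm x)
  have : matrixForm (chartMatrix t e x) = t'.bilinearComp J J :=
    bilin_ext_coordVec fun i j => by rw [matrixForm_coordVec]; rfl
  rw [this]
  rfl

theorem mdifferentiable_of_mem_maximalAtlas {e : OpenPartialHomeomorph M (Coord n)}
    (he : e ∈ IsManifold.maximalAtlas (𝓡 n) ∞ M) : e.MDifferentiable (𝓡 n) (𝓡 n) :=
  ⟨(contMDiffOn_of_mem_maximalAtlas he).mdifferentiableOn (by simp),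
    (contMDiffOn_symm_of_mem_maximalAtlas he).mdifferentiableOn (by simp)⟩

theorem contDiffOn_comp_symm {f : M → ℝ} (hf : ContMDiff (𝓡 n) 𝓘(ℝ) ∞ f)
    {e : OpenPartialHomeomorph M (Coord n)} (he : e ∈ IsManifold.maximalAtlas (𝓡 n) ∞ M) :
    ContDiffOn ℝ ∞ (fun x => f (e.symm x)) e.target :=
  contMDiffOn_iff_contDiffOn.1 (hf.comp_contMDiffOn (contMDiffOn_symm_of_mem_maximalAtlas he))

/-- The chart obtained from a change of coordinates. -/
theorem trans_mem_maximalAtlas [IsManifold (𝓡 n) ∞ M] {e : OpenPartialHomeomorph M (Coord n)}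
    (he : e ∈ IsManifold.maximalAtlas (𝓡 n) ∞ M) {Ψ : OpenPartialHomeomorph (Coord n) (Coord n)}
    (hΨ : ContDiffOn ℝ ∞ Ψ Ψ.source) (hΨ' : ContDiffOn ℝ ∞ Ψ.symm Ψ.target) :
    e.trans Ψ.symm ∈ IsManifold.maximalAtlas (𝓡 n) ∞ M := by
  refine OpenPartialHomeomorph.mem_maximalAtlas_of_contMDiffOn _ ?_ ?_
  · refine (contMDiffOn_iff_contDiffOn.2 hΨ').comp ((contMDiffOn_of_mem_maximalAtlas he).mono ?_) ?_
    · exact fun y hy => hy.1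
    · exact fun y hy => hy.2
  · refine (contMDiffOn_symm_of_mem_maximalAtlas he).comp
      ((contMDiffOn_iff_contDiffOn.2 hΨ).mono ?_) ?_
    · exact fun y hy => hy.1
    · exact fun y hy => hy.2

theorem matrixForm_chartMatrix_trans
    (t : (p : M) → TangentSpace (𝓡 n) p →L[ℝ] TangentSpace (𝓡 n) p →L[ℝ] ℝ)
    {e : OpenPartialHomeomorph M (Coord n)} (he : e ∈ IsManifold.maximalAtlas (𝓡 n) ∞ M)
    {Ψ : OpenPartialHomeomorph (Coord n) (Coord n)} (hΨ : ContDiffOn ℝ ∞ Ψ Ψ.source)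
    {z : Coord n} (hz : z ∈ Ψ.source) (hzt : Ψ z ∈ e.target) (u v : Coord n) :
    matrixForm (chartMatrix t (e.trans Ψ.symm) z) u v =
      matrixForm (chartMatrix t e (Ψ z)) (fderiv ℝ Ψ z u) (fderiv ℝ Ψ z v) := by
  rw [matrixForm_chartMatrix, matrixForm_chartMatrix]
  have h₁ : MDifferentiableAt (𝓡 n) (𝓡 n) Ψ z :=
    ((hΨ.contDiffAt (Ψ.open_source.mem_nhds hz)).differentiableAt (by simp)).mdifferentiableAt
  have h₂ : mfderiv (𝓡 n) (𝓡 n) (e.trans Ψ.symm).symm z =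
      (mfderiv (𝓡 n) (𝓡 n) e.symm (Ψ z)).comp (mfderiv (𝓡 n) (𝓡 n) Ψ z) :=
    mfderiv_comp z ((mdifferentiable_of_mem_maximalAtlas he).mdifferentiableAt_symm hzt) h₁
  rw [h₂, mfderiv_eq_fderiv]
  rfl

end

namespace PseudoRiemannianMetric

variable {n : ℕ} {M : Type*} [TopologicalSpace M] [ChartedSpace (Coord n) M]
  (g : PseudoRiemannianMetric n M) {e : OpenPartialHomeomorph M (Coord n)}

theorem matrix_symm (x : Coord n) (i j : Fin n) : g.matrix e x i j = g.matrix e x j i :=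
  g.symm _ _ _

theorem nondegenerate_matrixForm [IsManifold (𝓡 n) ∞ M]
    (he : e ∈ IsManifold.maximalAtlas (𝓡 n) ∞ M) {x : Coord n} (hx : x ∈ e.target) {u : Coord n}
    (hu : ∀ v, matrixForm (g.matrix e x) u v = 0) : u = 0 := by
  have hbij := (mdifferentiable_of_mem_maximalAtlas he).symm.mfderiv_bijective hx
  have h0 := g.nondegenerate _ (mfderiv (𝓡 n) (𝓡 n) e.symm x u) fun v => by
    obtain ⟨w, rfl⟩ := hbij.2 v
    exact (matrixForm_chartMatrix g.inner e x u w).symm.trans (hu w)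
  exact hbij.1 (h0.trans (map_zero _).symm)

end PseudoRiemannianMetric

/-! ### Walker charts on the manifold and the function `λ` -/

section

variable {M : Type*} [TopologicalSpace M] [ChartedSpace (Coord 4) M] [IsManifold (𝓡 4) ∞ M]
  {o : OrientedAtlas 4 M} {g : PseudoRiemannianMetric 4 M} {f lam : M → ℝ} {μ : ℝ}

/-- The neutral basis of the tangent space is pulled back to the chart; it supplies the positive and
negative vectors orthogonal to the gradient from which the null frame is built. -/
theorem exists_isIsotropicSelfDual_chart (hsig : g.HasNeutralSignature) (hsd : IsSelfDual g o)
    (hqe : IsGeneralizedQuasiEinstein g f μ lam) (hiso : IsIsotropic g f)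
    {e : OpenPartialHomeomorph M (Coord 4)} (he : e ∈ o.charts) {x : Coord 4} (hx : x ∈ e.target) :
    ∃ (T : Set (Coord 4)) (ψ : Coord 4 → ℝ) (n₁ n₂ m₁ m₂ : Coord 4 → Coord 4), x ∈ T ∧
      T ⊆ e.target ∧ IsIsotropicSelfDual T (fun x => matrixForm (g.matrix e x))
        (connForm (christoffel (g.matrix e))) (fun x => f (e.symm x)) (fun x => lam (e.symm x)) ψ μ
        n₁ n₂ m₁ m₂ := by
  have heM := o.subset_maximalAtlas he
  obtain ⟨b, hb⟩ := hsig (e.symm x)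
  have hbij := (mdifferentiable_of_mem_maximalAtlas heM).symm.mfderiv_bijective hx
  choose w hw using fun i => hbij.2 (b i)
  refine exists_isIsotropicSelfDual e.open_target (g.smooth e heM) (fun x _ => g.matrix_symm x)
    (fun x hx u => g.nondegenerate_matrixForm heM hx) (contDiffOn_comp_symm hqe.smooth_potential heM)
    (contDiffOn_comp_symm hqe.smooth_lam heM) (hqe.equation e heM) (fun x hx => (hiso e heM x hx).1)
    (hsd e he) hx (hiso e heM x hx).2 (w := w) fun i j => ?_
  refine (matrixForm_chartMatrix g.inner e x (w i) (w j)).trans ?_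
  exact (congrArg₂ (fun u v => g.inner (e.symm x) u v) (hw i) (hw j)).trans (hb i j)

/-- The metric is near every point a Walker metric which is quadratic on the fibres. -/
theorem exists_quadratic_walker_chart (hsig : g.HasNeutralSignature) (hsd : IsSelfDual g o)
    (hqe : IsGeneralizedQuasiEinstein g f μ lam) (hμ : μ ≠ -(1 / 2)) (hiso : IsIsotropic g f)
    (p : M) :
    ∃ e ∈ IsManifold.maximalAtlas (𝓡 4) ∞ M, p ∈ e.source ∧
      ∃ (S : AffineSurface) (Φ : Fin 2 → Fin 2 → Coord 2 → ℝ) (fhat : Coord 2 → ℝ)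
        (s : Coord 2 → Coord 4),
      e.target ⊆ S.cotangentBundle ∧ S.IsSymmTensor Φ ∧ ContDiffOn ℝ ∞ fhat S.carrier ∧
      (∀ y ∈ S.carrier, f (e.symm (s y)) = fhat y) ∧
      (∀ x ∈ e.target, f (e.symm x) = fhat (cotangentProj x)) ∧
      (∀ y ∈ S.carrier, ∀ i j,
        S.quasiEinsteinTensor μ fhat i j y = 2 / 3 * lam (e.symm (s y)) / 2 * Φ i j y) ∧
      ∀ x ∈ e.target, g.matrix e x = walkerMatrix (Matrix.of fun i j =>
        2 / 3 * lam (e.symm (s (cotangentProj x))) * (fibreCoord i x * fibreCoord j x)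
        - 2 * (∑ k, fibreCoord k x * S.Γ i j k (cotangentProj x)) + Φ i j (cotangentProj x)) := by
  obtain ⟨e₀, he₀, hp₀⟩ := o.covers p
  have heM := o.subset_maximalAtlas he₀
  obtain ⟨T, ψ, n₁, n₂, m₁, m₂, hxT, hTe, h⟩ :=
    exists_isIsotropicSelfDual_chart hsig hsd hqe hiso he₀ (e₀.map_source hp₀)
  obtain ⟨r, hr, Ψ, hΨs, hΨ0, hΨT, hΨc, hΨsc, hW⟩ := h.exists_walker_chart hμ hxT
  have h0 : (0 : Coord 4) ∈ Ψ.source := by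
    rw [hΨs, ← map_zero joinCoord]
    exact zero_mem_fibreBox (Metric.mem_ball_self hr)
  set e := e₀.trans Ψ.symm with he
  have hemax : e ∈ IsManifold.maximalAtlas (𝓡 4) ∞ M := trans_mem_maximalAtlas heM hΨc hΨsc
  have hmem : ∀ z ∈ fibreBox r, Ψ z ∈ e₀.target := fun z hz => hTe (hΨT (Ψ.map_source (hΨs ▸ hz)))
  have htarget : e.target = fibreBox r := by
    rw [he, OpenPartialHomeomorph.trans_target, ← hΨs]
    exact Set.inter_eq_left.2 fun z hz => hmem z (hΨs ▸ hz)
  have hpe : p ∈ e.source := by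
    refine ⟨hp₀, ?_⟩
    change e₀ p ∈ Ψ.target
    rw [← hΨ0]
    exact Ψ.map_source h0
  have hsymm : ∀ z, e.symm z = e₀.symm (Ψ z) := fun _ => rfl
  obtain ⟨a, haW, hFs, hFf, hlc, hA⟩ := hW (g.matrix e)
    (by rw [← htarget]; exact g.smooth e hemax)
    (fun z hz u v => matrixForm_chartMatrix_trans g.inner heM hΨc (hΨs ▸ hz) (hmem z hz) u v)
    (fun z hz i j => hqe.equation e hemax z (htarget ▸ hz) i j)
  obtain ⟨S, Φ, fhat, hS, hΦ, hfs, hff, hqeS, hGS⟩ := haW.exists_extension (μ := μ)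
    (F := (fun x => f (e₀.symm x)) ∘ Ψ) (lam := fun z => lam (e.symm z))
    -- The coefficient of the fibre Hessian in `hA`; it becomes the coefficient of `x_{i'} x_{j'}`
    -- in the metric.
    (t := fun z => 2 / 3 * lam (e.symm z)) hFs hFf
    (fun z hz i j => hqe.equation e hemax z (htarget ▸ hz) i j) (fun z hz => by ring)
    (fun z hz => by rw [hsymm, hsymm, hlc z hz]) hA
  refine ⟨e, hemax, hpe, S, Φ, fhat, fun y => joinCoord (y, 0), fun x hx => ?_, hΦ, hfs,
    fun y hy => ?_, fun x hx => hff x (htarget ▸ hx), hqeS, fun x hx => hGS x (htarget ▸ hx)⟩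
  · rw [htarget] at hx
    change cotangentProj x ∈ S.carrier
    rw [hS]
    exact hx.1
  · rw [hS] at hy
    have := hff _ (zero_mem_fibreBox hy)
    rwa [cotangentProj_joinCoord] at this

/-- The function `lam * exp f` is constant. -/
theorem exists_lam_eq [ConnectedSpace M] (hsig : g.HasNeutralSignature) (hsd : IsSelfDual g o)
    (hqe : IsGeneralizedQuasiEinstein g f μ lam) (hμ : μ ≠ -(1 / 2)) (hiso : IsIsotropic g f) :
    ∃ σ : ℝ, ∀ p, lam p = σ * Real.exp (-f p) := by
  have hloc : IsLocallyConstant fun p => lam p * Real.exp (f p) := by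
    rw [IsLocallyConstant.iff_eventually_eq]
    intro p
    obtain ⟨e, he, hp⟩ := o.covers p
    obtain ⟨T, ψ, n₁, n₂, m₁, m₂, hxT, hTe, h⟩ :=
      exists_isIsotropicSelfDual_chart hsig hsd hqe hiso he (e.map_source hp)
    obtain ⟨r, hr, hrT⟩ := Metric.isOpen_iff.1 h.isOpen _ hxT
    have hd : ∀ y ∈ T, HasFDerivAt (fun x => lam (e.symm x) * Real.exp (f (e.symm x)))
        (0 : Coord 4 →L[ℝ] ℝ) y := fun y hy => by
      have h₁ := (h.differentiableAt_of_contDiffOn h.smooth_lam hy).hasFDerivAt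
      have h₂ := (h.differentiableAt_of_contDiffOn h.smooth_potential hy).hasFDerivAt
      refine (h₁.mul h₂.exp).congr_fderiv ?_
      ext w
      simp [h.fderiv_lam hμ hy]
      ring
    have hconst : ∀ y ∈ Metric.ball (e p) r, lam (e.symm y) * Real.exp (f (e.symm y)) =
        lam p * Real.exp (f p) := fun y hy => by
      have := Metric.isOpen_ball.is_const_of_fderiv_eq_zero (𝕜 := ℝ)
        (convex_ball (e p) r).isPreconnected
        (fun z hz => (hd z (hrT hz)).differentiableAt.differentiableWithinAt)
        (fun z hz => (hd z (hrT hz)).fderiv) hy (Metric.mem_ball_self hr)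
      simpa [e.left_inv hp] using this
    filter_upwards [e.open_source.mem_nhds hp,
      (e.continuousAt hp).preimage_mem_nhds (Metric.ball_mem_nhds _ hr)] with q hq hq'
    have := hconst _ hq'
    rwa [e.left_inv hq] at this
  obtain ⟨p₀⟩ := (inferInstance : Nonempty M)
  refine ⟨lam p₀ * Real.exp (f p₀), fun p => ?_⟩
  rw [hloc.apply_eq_of_preconnectedSpace p₀ p, mul_assoc, ← Real.exp_add, add_neg_cancel,
    Real.exp_zero, mul_one]

/-- Evaluate `dλ = -λ df` on `m₁`, where `df` equals one. -/
theorem lam_eq_zero_of_const (hsig : g.HasNeutralSignature) (hsd : IsSelfDual g o)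
    (hqe : IsGeneralizedQuasiEinstein g f μ lam) (hμ : μ ≠ -(1 / 2)) (hiso : IsIsotropic g f)
    {c : ℝ} (hc : ∀ p, lam p = c) (p : M) : lam p = 0 := by
  obtain ⟨e, he, hp⟩ := o.covers p
  have hx := e.map_source hp
  obtain ⟨T, ψ, n₁, n₂, m₁, m₂, hxT, hTe, h⟩ :=
    exists_isIsotropicSelfDual_chart hsig hsd hqe hiso he hx
  have hfr := h.frame _ hxT
  have h₁ := h.fderiv_lam hμ hxT (m₁ (e p))
  rw [← h.grad _ hxT, hfr.n₁m₁] at h₁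
  simp only [hc] at h₁
  rw [hc]
  simp at h₁
  exact h₁

end

end


/-! ### Identification with the Riemannian extensions -/

noncomputable section

/-- For `T = c Id` and `U = Id` the two halves of the symmetrised quadratic term coincide and add up
to `c x_{i'} x_{j'}`. -/
theorem modifiedRiemannianExtension_smul_one (S : AffineSurface)
    (Φ : Fin 2 → Fin 2 → Coord 2 → ℝ) (c : Coord 2 → ℝ) (x : Coord 4) :
    modifiedRiemannianExtension S Φ (fun y => c y • (1 : Matrix (Fin 2) (Fin 2) ℝ)) (fun _ => 1) x =
      walkerMatrix (Matrix.of fun i j => c (cotangentProj x) * (fibreCoord i x * fibreCoord j x)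
        - 2 * (∑ k, fibreCoord k x * S.Γ i j k (cotangentProj x)) + Φ i j (cotangentProj x)) := by
  unfold modifiedRiemannianExtension
  congr 2
  ext i j
  congr 2
  obtain rfl | rfl : i = 0 ∨ i = 1 := by lia
  all_goals obtain rfl | rfl : j = 0 ∨ j = 1 := by lia
  all_goals
    simp [Fin.sum_univ_two]
    ring

end

theorem theorem1p4 {M : Type*} [TopologicalSpace M] [ChartedSpace (Coord 4) M]
    [IsManifold (𝓡 4) ∞ M] [T2Space M] [SecondCountableTopology M] [ConnectedSpace M]
    (o : OrientedAtlas 4 M) (g : PseudoRiemannianMetric 4 M) (f lam : M → ℝ) (μ : ℝ)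
    (hsig : g.HasNeutralSignature) (hsd : IsSelfDual g o)
    (hqe : IsGeneralizedQuasiEinstein g f μ lam) (hμ : μ ≠ -(1 / 2))
    (hiso : IsIsotropic g f) (hric : ¬ g.IsRicciFlat) :
    ((∃ c : ℝ, ∀ p, lam p = c) →
      (∀ p, lam p = 0) ∧
      ∀ p : M, ∃ (S : AffineSurface) (Φ : Fin 2 → Fin 2 → Coord 2 → ℝ) (fhat : Coord 2 → ℝ),
        S.IsSymmTensor Φ ∧ ContDiffOn ℝ ∞ fhat S.carrier ∧
        (∀ i j, ∀ y ∈ S.carrier, S.quasiEinsteinTensor μ fhat i j y = 0) ∧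
        IsLocallyIsometricAt g f p S.cotangentBundle (deformedRiemannianExtension S Φ)
          (fun x => fhat (cotangentProj x))) ∧
    ((¬ ∃ c : ℝ, ∀ p, lam p = c) →
      ∀ p : M, ∃ (S : AffineSurface) (fhat : Coord 2 → ℝ) (C : ℝ),
        C ≠ 0 ∧ ContDiffOn ℝ ∞ fhat S.carrier ∧
        IsLocallyIsometricAt g f p S.cotangentBundle
          (modifiedRiemannianExtension S
            (fun i j y => 2 / C * Real.exp (fhat y) * S.quasiEinsteinTensor μ fhat i j y)
            (fun y => (C * Real.exp (-fhat y)) • (1 : Matrix (Fin 2) (Fin 2) ℝ)) (fun _ => 1))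
          (fun x => fhat (cotangentProj x)) ∧
        ∀ᶠ q in 𝓝 p, lam q = 3 / 2 * C * Real.exp (-f q)) := by
  constructor
  · rintro ⟨c, hc⟩
    have h0 := lam_eq_zero_of_const hsig hsd hqe hμ hiso hc
    refine ⟨h0, fun p => ?_⟩
    obtain ⟨e, he, hp, S, Φ, fhat, s, htgt, hΦ, hfs, -, hff, hqeS, hG⟩ :=
      exists_quadratic_walker_chart hsig hsd hqe hμ hiso p
    refine ⟨S, Φ, fhat, hΦ, hfs, fun i j y hy => ?_, e, he, hp, htgt,
      fun x hx => ⟨?_, hff x hx⟩⟩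
    · rw [hqeS y hy, h0]
      ring
    · rw [hG x hx, deformedRiemannianExtension]
      congr 2
      ext i j
      rw [h0]
      ring
  · intro hnc p
    obtain ⟨σ, hσ⟩ := exists_lam_eq hsig hsd hqe hμ hiso
    have hσ0 : σ ≠ 0 := fun h => hnc ⟨0, fun q => by rw [hσ, h, zero_mul]⟩
    obtain ⟨e, he, hp, S, Φ, fhat, s, htgt, -, hfs, hfsec, hff, hqeS, hG⟩ :=
      exists_quadratic_walker_chart hsig hsd hqe hμ hiso p
    -- With `λ = σ e^{-f}`, the fibre coefficient `⅔ λ` is `C e^{-f}` for this `C`.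
    refine ⟨S, fhat, 2 / 3 * σ, by positivity, hfs, ⟨e, he, hp, htgt,
      fun x hx => ⟨?_, hff x hx⟩⟩, Filter.Eventually.of_forall fun q => by rw [hσ]; ring⟩
    have hy : cotangentProj x ∈ S.carrier := htgt hx
    rw [hG x hx, modifiedRiemannianExtension_smul_one]
    congr 2
    ext i j
    -- The base equation reads `½ C e^{-f̂} Φ` for the quasi-Einstein tensor; multiplication by
    -- `(2/C) e^{f̂}` gives back `Φ`.
    rw [hqeS _ hy, hσ, hfsec _ hy]
    have hexp : Real.exp (-fhat (cotangentProj x)) * Real.exp (fhat (cotangentProj x)) = 1 := by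
      rw [← Real.exp_add, neg_add_cancel, Real.exp_zero]
    field_simp
    linear_combination (-3 * Φ i j (cotangentProj x)) * hexp
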